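/- A rooted graph $(R,G)$ is a finite simple graph $G$ together with an independent set $R\subseteq V(G)$ of roots; put $r=|R|$. Write $v(\cdot)$ and $e(\cdot)$ for numbers of vertices and edges, and let $e_R(G)$ be the number of edges of $G$ incident with $R$. For a graph $F$ on $[n]=\{1,\dots,n\}$, an $R$-rooted copy of $G$ in $F$ is a subgraph $F'$ of $F$ for which there is a graph isomorphism from $G$ onto $F'$ mapping $R$ onto $V(F')\cap[r]$, where $|V(F')\cap [r]|=r$. Let $X=X^R_G$ be the number of $R$-rooted copies of $G$ in the binomial random graph $G(n,p)$, and $\mu=\mathbb E X$. For a subgraph $H\subseteq G$ let $H-R$ be $H$ with all vertices of $R$ deleted, and put $\Psi^R_H=n^{v(H-R)}p^{e(H)}$. The fractional independence number $\alpha^*(H)$ is the maximum of $\sum_{i\in V(H)} x_i$ over all $(x_i)_{i\in V(H)}$ with $0\le x_i\le 1$ for all $i$ and $x_i+x_j\le 1$ for every edge $ij$ of $H$. Let $$M_{R,G}=\min_{H\subseteq G,\ e(H)>0}\bigl(\Psi^R_H\bigr)^{1/\alpha^*(H-R)},\qquad m_R(G)=\max_{H\subseteq G,\ e(H)>0}\frac{e(H)}{v(H-R)}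 .$$ Theorem 3. For every rooted graph $(R,G)$ with $e_R(G)>0$ and every $t>1$ there exist constants $c>0$ and $C>0$, depending only on $t$ and $(R,G)$, such that for all integers $n\ge v(G)$ and all $0<p\le 1$, with $p_1=t^{-1/e_R(G)}$ and $p_2=t^{-1/e(G)}$: (a) if $p\le n^{-1/m_R(G)}$, then $\mathbb P(X\ge t\mu)\le \exp\{-c\}$, and if moreover $p\le p_2$, then $$p^{C}=\exp\{-C\log(1/p)\}\le\mathbb P(X\ge t\mu);$$ (b) if $n^{-1/m_R(G)}\le p\le p_1$, then $$p^{C M_{R,G}}=\exp\{-C M_{R,G}\log(1/p)\}\le\mathbb P(X\ge t\mu)\le\exp\{-c\,M_{R,G}\};$$ (c) if $p_1\le p\le p_2$, then $$\exp\{-C(n+(p-p_1)^2n^2)\}\le\mathbb P(X\ge t\mu)\le\exp\{-c(n+(p-p_1)^2n^2)\};$$ (d) if $p_2<p\le 1$, then $\mathbb P(X\ge t\mu)=0$. -/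

import Mathlib

open MeasureTheory

noncomputable section

namespace RootedTail

/-- The fractional independence number `α*(H)`: the maximum of `∑ i, x i` over all
`x : V(H) → [0, 1]` with `x i + x j ≤ 1` for every edge `ij`.  (The set below is non-empty and
compact when `H` is finite, so that the supremum is a maximum.) -/
def fracIndepNum {V : Type*} [Finite V] (H : SimpleGraph V) : ℝ :=
  sSup {s : ℝ | ∃ x : V → ℝ, (∀ i, 0 ≤ x i ∧ x i ≤ 1) ∧
    (∀ i j, H.Adj i j → x i + x j ≤ 1) ∧ s = ∑ᶠ i, x i}

/-- The vertices of `Fin n` that are used as the `r` roots: the first `r` ones. -/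
def rootSet (n r : ℕ) : Set (Fin n) := {v | (v : ℕ) < r}

section

variable {V : Type*} [Fintype V]

/-- A subgraph `F'` of a graph `F` on `Fin n` (rooted at the first `|R|` vertices) is an
`R`-rooted copy of `G` if, with the roots that it inherits from `F`, it is isomorphic to `(R, G)`
as a rooted graph: there is a graph isomorphism that maps `R` onto the set of roots in `F'`. -/
def IsRootedCopy (G : SimpleGraph V) (R : Finset V) {n : ℕ} {F : SimpleGraph (Fin n)}
    (F' : F.Subgraph) : Prop :=
  ∃ e : G ≃g F'.coe, ∀ v : V, v ∈ R ↔ (e v : Fin n) ∈ rootSet n R.card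

/-- `N^R(F, G)`: the number of `R`-rooted copies of `G` in `F`.  On a random `F` this is the
random variable `X^R_G`. -/
def rootedCount (G : SimpleGraph V) (R : Finset V) {n : ℕ} (F : SimpleGraph (Fin n)) : ℕ :=
  {F' : F.Subgraph | IsRootedCopy G R F'}.ncard

/-- `μ = E X^R_G` in the binomial random graph `G(n, p)`. -/
def rootedMean (G : SimpleGraph V) (R : Finset V) (n : ℕ) (p : unitInterval) : ℝ :=
  ∫ F, (rootedCount G R F : ℝ) ∂(SimpleGraph.binomialRandom (Fin n) p)

/-- The upper tail probability `P(X^R_G ≥ t μ)` in `G(n, p)`. -/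
def upperTail (G : SimpleGraph V) (R : Finset V) (n : ℕ) (p : unitInterval) (t : ℝ) : ℝ :=
  (SimpleGraph.binomialRandom (Fin n) p).real
    {F | t * rootedMean G R n p ≤ (rootedCount G R F : ℝ)}

/-- `e(G)`. -/
def numEdges (G : SimpleGraph V) : ℕ := G.edgeSet.ncard

/-- `e_R(G)`: the number of edges of `G` that are incident with the root set. -/
def numRootEdges (G : SimpleGraph V) (R : Finset V) : ℕ :=
  {e ∈ G.edgeSet | ∃ v ∈ R, v ∈ e}.ncard

/-- `Ψ^R_H(n, p) = n ^ v(H - R) * p ^ e(H)`. -/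
def psi {G : SimpleGraph V} (R : Finset V) (H : G.Subgraph) (n : ℕ) (p : ℝ) : ℝ :=
  (n : ℝ) ^ (H.deleteVerts (R : Set V)).verts.ncard * p ^ H.edgeSet.ncard

/-- `M_{R,G}(n, p)`: the minimum of `(Ψ^R_H) ^ (1 / α*(H - R))` over the (finitely many)
subgraphs `H` of `G` with `e(H) > 0`. -/
def bigM (G : SimpleGraph V) (R : Finset V) (n : ℕ) (p : ℝ) : ℝ :=
  ⨅ H : {H : G.Subgraph // 0 < H.edgeSet.ncard},
    psi R H.1 n p ^ (1 / fracIndepNum (H.1.deleteVerts (R : Set V)).coe)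

/-- `m_R(G)`: the maximum of `e(H) / v(H - R)` over the (finitely many) subgraphs `H` of `G` with
`e(H) > 0`. -/
def maxDensity (G : SimpleGraph V) (R : Finset V) : ℝ :=
  ⨆ H : {H : G.Subgraph // 0 < H.edgeSet.ncard},
    (H.1.edgeSet.ncard : ℝ) / ((H.1.deleteVerts (R : Set V)).verts.ncard : ℝ)

/-- `p₁ = t ^ (-1 / e_R(G))`. -/
def pOne (G : SimpleGraph V) (R : Finset V) (t : ℝ) : ℝ := t ^ (-1 / (numRootEdges G R : ℝ))

/-- `p₂ = t ^ (-1 / e(G))`. -/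
def pTwo (G : SimpleGraph V) (t : ℝ) : ℝ := t ^ (-1 / (numEdges G : ℝ))

end

end RootedTail

end

noncomputable section

namespace RootedTail

open Finset SimpleGraph

/-! ### Random graphs: moments, planting and change of measure -/

section Probability

/-! Let `N` be the number of rooted copies of `G` in the complete graph. It is of order `n ^ (v(G) -
r)`, and `X` counts those copies whose edge sets lie in the random graph, so `μ = N p ^ e(G)` and `X
≤ N`. This settles (d), where `t μ > N`, and Markov's inequality gives the upper bound in (a).

Upper bound in (b): expanding `E X ^ k` copy by copy bounds it by a product of expectations of `X`
conditioned on at most `e(G) k` planted edges. Planting `U` creates additional copies by letting the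
edges of some subgraph `H` fall into `U`. There are at most `(2|U|) ^ α*(H - R)` ways to place the
vertices of `H - R` (`card_hom_le`), so the relative increase is at most a constant times the sum
over `H` of `(2|U|) ^ α*(H - R) / Ψ_H`, which is small while `|U|` is a small multiple of `M`
(`sum_copies_sdiff_le`). With `k` of order `M` the moment method yields `exp(-c M)`. The count of
placements comes from the duality behind `α*`: Hall's theorem gives a permutation that follows edges
except at `2 α* - v` vertices at most, and a Cauchy–Schwarz inequality along its cycles does the
counting.

Lower bound in (a) and (b): plant a blow-up of a subgraph `H` in which a non-root vertex `u` has
about `m ^ x u` clones, where `x` is an optimal fractional independent set. It has `O(m)` edges and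
about `m ^ α*(H - R)` copies of `H`. If this is at least `Ψ_H`, then after adjusting constants the
conditional mean exceeds `2 t μ`, and since `X ≤ N` the conditional probability is at least `p ^
e(G)` (`exists_rpow_le_upperTail`). In (b) `m = M` with `H` a minimiser; in (a) `m = 1`. The blow-up
fits when `n` is at least a constant multiple of `m`; in (b), as `M ≤ n p`, failure forces `p` to be
bounded below and the dense argument applies.

In (c) the roots can be joined to everything at cost `exp(-O(n))`, after which a copy only needs its
`e(G) - e_R(G)` remaining edges. The mean is then `N p ^ (e(G) - e_R(G))`, and it reaches `t μ`
exactly when `p ≤ p₁`. Above `p₁` a relative excess of order `p - p₁` in copies of the non-root part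
is still needed. Moments of order `(p - p₁) n ^ 2` show that its probability is at most `exp(-c (p -
p₁) ^ 2 n ^ 2)` up to a constant factor (`exists_upperTail_le_exp_sq`). Conversely, raising the
density by `O(p - p₁ + n ^ (-1/2))` produces it, and a chi-square comparison of the two random
graphs transfers this back to `p` (`exp_le_upperTail_of_tilt`). -/

instance {W : Type*} [Finite W] : MeasurableSingletonClass (SimpleGraph W) where
  measurableSet_singleton F := by
    have : ({F} : Set (SimpleGraph W)) = edgeSet ⁻¹' {F.edgeSet} := by
      ext F'
      simp
    rw [this]
    exact measurableEmbedding_edgeSet.measurable (measurableSet_singleton _)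

variable {W : Type*}

open Classical in
/-- The indicator of the event that all pairs in `U` are edges of `F`. -/
def containInd (U : Finset (Sym2 W)) (F : SimpleGraph W) : ℝ :=
  if (U : Set (Sym2 W)) ⊆ F.edgeSet then 1 else 0

lemma containInd_nonneg (U : Finset (Sym2 W)) (F : SimpleGraph W) : 0 ≤ containInd U F := by
  unfold containInd; split_ifs <;> norm_num

lemma containInd_le_one (U : Finset (Sym2 W)) (F : SimpleGraph W) : containInd U F ≤ 1 := by
  unfold containInd; split_ifs <;> norm_num

lemma containInd_mul [DecidableEq W] (U T : Finset (Sym2 W)) (F : SimpleGraph W) :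
    containInd U F * containInd T F = containInd (U ∪ T) F := by
  unfold containInd
  rw [Finset.coe_union, Set.union_subset_iff]
  split_ifs <;> simp_all

/-- The weight of an edge set of size `k` among `N` pairs. -/
def edgeWeight (N : ℕ) (p : ℝ) (k : ℕ) : ℝ := p ^ k * (1 - p) ^ (N - k)

lemma sum_powerset_pow_mul_pow (E : Finset (Sym2 W)) (a b : ℝ) :
    ∑ S ∈ E.powerset, a ^ #S * b ^ (#E - #S) = (a + b) ^ #E :=
  Finset.sum_pow_mul_eq_add_pow a b E

/-- The number of members of a family of edge sets that are contained in `F`. -/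
def containCount {W : Type*} {ι : Type*} (𝒞 : Finset ι) (A : ι → Finset (Sym2 W))
    (F : SimpleGraph W) : ℝ :=
  ∑ c ∈ 𝒞, containInd (A c) F

variable {ι : Type*} (𝒞 : Finset ι) (A : ι → Finset (Sym2 W))

lemma containCount_nonneg (F : SimpleGraph W) : 0 ≤ containCount 𝒞 A F :=
  Finset.sum_nonneg fun _ _ => containInd_nonneg _ _

lemma containCount_le_card (F : SimpleGraph W) : containCount 𝒞 A F ≤ #𝒞 := by
  refine (Finset.sum_le_card_nsmul _ _ 1 fun c _ => containInd_le_one _ _).trans ?_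
  simp

variable [Fintype W] [DecidableEq W]

/-- The set of all pairs of distinct elements. -/
def offDiagPairs (W : Type*) [Fintype W] [DecidableEq W] : Finset (Sym2 W) :=
  univ.filter fun e => ¬ e.IsDiag

lemma card_offDiagPairs : #(offDiagPairs W) = (Fintype.card W).choose 2 := by
  rw [← Sym2.card_subtype_not_diag, Fintype.card_subtype, offDiagPairs]

lemma integral_binomialRandom (p : unitInterval) (f : SimpleGraph W → ℝ) :
    ∫ F, f F ∂(binomialRandom W p) =
      ∑ S ∈ (offDiagPairs W).powerset,
        edgeWeight #(offDiagPairs W) p #S * f (fromEdgeSet (S : Set (Sym2 W))) := by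
  classical
  have : Fintype (SimpleGraph W) := Fintype.ofFinite _
  rw [integral_fintype (Integrable.of_finite)]
  refine Finset.sum_nbij' (fun F => F.edgeSet.toFinset)
    (fun S => fromEdgeSet (S : Set (Sym2 W))) ?_ ?_ ?_ ?_ ?_
  · intro F _
    simp only [mem_powerset]
    intro e he
    simp only [Set.mem_toFinset] at he
    simp [offDiagPairs, F.not_isDiag_of_mem_edgeSet he]
  · simp
  · intro F _
    simp
  · intro S hS
    simp only [mem_powerset] at hS
    ext e
    simp only [edgeSet_fromEdgeSet, Set.mem_toFinset, Set.mem_sdiff, Finset.mem_coe]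
    constructor
    · exact fun h => h.1
    · intro h
      refine ⟨h, ?_⟩
      have := hS h
      simpa [offDiagPairs] using this
  · intro F _
    have h : (binomialRandom W p).real {F} =
        edgeWeight #(offDiagPairs W) p #F.edgeSet.toFinset := by
      rw [measureReal_def, binomialRandom_singleton, card_offDiagPairs, edgeWeight,
        Set.ncard_eq_toFinset_card']
      simp
    rw [h]
    simp

lemma integral_containInd (p : unitInterval) {U : Finset (Sym2 W)} (hU : U ⊆ offDiagPairs W) :
    ∫ F, containInd U F ∂(binomialRandom W p) = (p : ℝ) ^ #U := by
  rw [integral_binomialRandom]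
  set E := offDiagPairs W
  have h1 : ∀ S ∈ E.powerset, containInd U (fromEdgeSet (S : Set (Sym2 W))) =
      if U ⊆ S then 1 else 0 := by
    intro S hS
    unfold containInd
    congr 1
    rw [edgeSet_fromEdgeSet, eq_iff_iff]
    constructor
    · intro h e he
      exact (h he).1
    · intro h e he
      refine ⟨h he, ?_⟩
      have := hU he
      simpa [E, offDiagPairs] using this
  rw [Finset.sum_congr rfl (fun S hS => by rw [h1 S hS])]
  simp only [mul_ite, mul_one, mul_zero]
  rw [← Finset.sum_filter]
  have h2 : ∑ S ∈ E.powerset with U ⊆ S, edgeWeight #E p #S =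
      ∑ T ∈ (E \ U).powerset, (p : ℝ) ^ #U * ((p : ℝ) ^ #T * (1 - p) ^ (#(E \ U) - #T)) := by
    symm
    refine Finset.sum_nbij' (fun T => U ∪ T) (fun S => S \ U) ?_ ?_ ?_ ?_ ?_
    · intro T hT
      simp only [mem_powerset, mem_filter] at hT ⊢
      exact ⟨union_subset hU (hT.trans sdiff_subset), subset_union_left⟩
    · intro S hS
      simp only [mem_powerset, mem_filter] at hS ⊢
      exact sdiff_subset_sdiff hS.1 le_rfl
    · intro T hT
      simp only [mem_powerset] at hT
      have : Disjoint U T := (disjoint_sdiff.mono_right hT)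
      rw [union_sdiff_left, Finset.sdiff_eq_self_of_disjoint this.symm]
    · intro S hS
      simp only [mem_filter] at hS
      exact union_sdiff_of_subset hS.2
    · intro T hT
      simp only [mem_powerset] at hT
      have : Disjoint U T := (disjoint_sdiff.mono_right hT)
      rw [edgeWeight, card_union_of_disjoint this, card_sdiff_of_subset hU, pow_add, mul_assoc,
        Nat.sub_sub]
  rw [h2, ← Finset.mul_sum, sum_powerset_pow_mul_pow]
  simp

/-- Comparison of the probabilities of an event in `G(n, p)` and `G(n, q)`. -/
lemma sq_binomialRandom_le (p q : unitInterval) (hp0 : 0 < (p : ℝ)) (hp1 : (p : ℝ) < 1)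
    (A : Set (SimpleGraph W)) :
    (binomialRandom W q).real A ^ 2 ≤ (binomialRandom W p).real A *
      (1 + ((q : ℝ) - p) ^ 2 / (p * (1 - p))) ^ (Fintype.card W).choose 2 := by
  classical
  set E := offDiagPairs W
  have key : ∀ s : unitInterval, (binomialRandom W s).real A = ∑ S ∈ E.powerset with
      fromEdgeSet ((S : Finset (Sym2 W)) : Set (Sym2 W)) ∈ A, edgeWeight #E s (#S) := by
    intro s
    have hA : MeasurableSet A := A.toFinite.measurableSet
    rw [← integral_indicator_one hA, integral_binomialRandom, Finset.sum_filter]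
    refine Finset.sum_congr rfl fun S _ => ?_
    by_cases h : fromEdgeSet (S : Set (Sym2 W)) ∈ A <;> simp [h, E]
  rw [key, key]
  have hq0 := q.2.1
  have hq1 := q.2.2
  have hp1' : 0 < 1 - (p : ℝ) := by linarith
  have hw : ∀ k, 0 < edgeWeight #E p k := fun k => by unfold edgeWeight; positivity
  -- Cauchy–Schwarz for the likelihood ratio. Its second moment factors over pairs, each
  -- contributing `q² / p + (1 - q)² / (1 - p) = 1 + (q - p)² / (p (1 - p))`.
  refine (Finset.sum_sq_le_sum_mul_sum_of_sq_le_mul _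
    (f := fun S => edgeWeight #E p #S)
    (g := fun S => edgeWeight #E q #S ^ 2 / edgeWeight #E p #S)
    (fun S _ => (hw _).le) (fun S _ => div_nonneg (sq_nonneg _) (hw _).le) ?_).trans ?_
  · intro S _
    have := (hw #S).ne'
    exact le_of_eq (by field_simp)
  · refine mul_le_mul_of_nonneg_left ?_ (Finset.sum_nonneg fun S _ => (hw _).le)
    calc _ ≤ ∑ S ∈ E.powerset, edgeWeight #E q #S ^ 2 / edgeWeight #E p #S :=
          Finset.sum_le_sum_of_subset_of_nonneg (filter_subset _ _)
            fun S _ _ => div_nonneg (sq_nonneg _) (hw _).le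
      _ = ∑ S ∈ E.powerset, ((q : ℝ) ^ 2 / p) ^ #S *
            ((1 - (q : ℝ)) ^ 2 / (1 - p)) ^ (#E - #S) := by
          refine Finset.sum_congr rfl fun S _ => ?_
          unfold edgeWeight
          rw [div_pow, div_pow, mul_pow, div_mul_div_comm, ← pow_mul, ← pow_mul, ← pow_mul,
            ← pow_mul, mul_comm _ 2, mul_comm (#E - #S) 2]
      _ = _ := by
          rw [sum_powerset_pow_mul_pow, card_offDiagPairs]
          congr 1
          field_simp
          ring

variable {𝒞 A}

lemma integral_containCount (p : unitInterval) (hA : ∀ c ∈ 𝒞, A c ⊆ offDiagPairs W) :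
    ∫ F, containCount 𝒞 A F ∂(binomialRandom W p) = ∑ c ∈ 𝒞, (p : ℝ) ^ #(A c) := by
  unfold containCount
  rw [integral_finsetSum _ fun _ _ => Integrable.of_finite]
  exact Finset.sum_congr rfl fun c hc => integral_containInd p (hA c hc)

/-- Induction on `k`: one factor of the power is expanded into copies, and a copy `c` enlarges the
planted set `U` to `U ∪ A c`. The index `j` counts copies already planted, and `B i` bounds the
conditional mean when at most `e * i` edges are planted. -/
lemma integral_containInd_mul_pow_le (p : unitInterval) (hA : ∀ c ∈ 𝒞, A c ⊆ offDiagPairs W)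
    {e : ℕ} (he : ∀ c ∈ 𝒞, #(A c) ≤ e) {B : ℕ → ℝ} {k : ℕ} :
    ∀ j : ℕ, (∀ i < j + k, ∀ U ⊆ offDiagPairs W, #U ≤ e * i →
        ∑ c ∈ 𝒞, (p : ℝ) ^ #(A c \ U) ≤ B i) →
      ∀ U ⊆ offDiagPairs W, #U ≤ e * j →
      ∫ F, containInd U F * containCount 𝒞 A F ^ k ∂(binomialRandom W p) ≤
        (p : ℝ) ^ #U * ∏ i ∈ range k, B (j + i) := by
  have hp := p.2.1
  induction k with
  | zero =>
    intro j _ U hU _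
    simp [integral_containInd p hU]
  | succ k ih =>
    intro j hB U hU hUj
    have hB0 : ∀ i < j + (k + 1), 0 ≤ B i := fun i hi =>
      (Finset.sum_nonneg fun c _ => pow_nonneg hp _).trans
        (hB i hi ∅ (empty_subset _) (by simp))
    have h1 : ∀ F : SimpleGraph W, containInd U F * containCount 𝒞 A F ^ (k + 1) =
        ∑ c ∈ 𝒞, containInd (U ∪ A c) F * containCount 𝒞 A F ^ k := by
      intro F
      rw [pow_succ', ← mul_assoc]
      conv_lhs => rw [containCount.eq_1 𝒞 A F, Finset.mul_sum]
      simp_rw [containInd_mul]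
      rw [Finset.sum_mul, ← containCount.eq_1 𝒞 A F]
    simp_rw [h1]
    rw [integral_finsetSum _ fun _ _ => Integrable.of_finite]
    calc _ ≤ ∑ c ∈ 𝒞, (p : ℝ) ^ #(U ∪ A c) * ∏ i ∈ range k, B (j + 1 + i) := by
          refine Finset.sum_le_sum fun c hc => ih (j + 1) (fun i hi => hB i (by omega)) _
            (union_subset hU (hA c hc)) ?_
          have := card_union_le U (A c)
          have := he c hc
          rw [mul_add]
          omega
      _ = (p : ℝ) ^ #U * (∑ c ∈ 𝒞, (p : ℝ) ^ #(A c \ U)) * ∏ i ∈ range k, B (j + 1 + i) := by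
          rw [Finset.mul_sum, Finset.sum_mul]
          refine Finset.sum_congr rfl fun c _ => ?_
          rw [← pow_add, ← union_sdiff_self_eq_union, card_union_of_disjoint disjoint_sdiff]
      _ ≤ (p : ℝ) ^ #U * B j * ∏ i ∈ range k, B (j + 1 + i) := by
          refine mul_le_mul_of_nonneg_right (mul_le_mul_of_nonneg_left
            (hB j (by omega) U hU hUj) (pow_nonneg hp _)) (Finset.prod_nonneg fun i hi => ?_)
          rw [Finset.mem_range] at hi
          exact hB0 _ (by omega)
      _ = _ := by
          rw [Finset.prod_range_succ', mul_assoc, mul_comm (B j)]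
          simp [add_assoc, add_comm 1]

/-- The moment method for the upper tail. -/
lemma measureReal_containCount_ge_mul_pow_le (p : unitInterval)
    (hA : ∀ c ∈ 𝒞, A c ⊆ offDiagPairs W)
    {e : ℕ} (he : ∀ c ∈ 𝒞, #(A c) ≤ e) {B : ℕ → ℝ} {k : ℕ}
    (hB : ∀ i < k, ∀ U ⊆ offDiagPairs W, #U ≤ e * i → ∑ c ∈ 𝒞, (p : ℝ) ^ #(A c \ U) ≤ B i)
    {a : ℝ} (ha : 0 ≤ a) :
    (binomialRandom W p).real {F | a ≤ containCount 𝒞 A F} * a ^ k ≤ ∏ i ∈ range k, B i := by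
  have h := integral_containInd_mul_pow_le p hA he (B := B) (k := k) 0 (by simpa using hB) ∅
    (empty_subset _) (by simp)
  simp only [card_empty, pow_zero, one_mul, zero_add] at h
  refine le_trans ?_ h
  have h1 : ∀ F : SimpleGraph W, containInd ∅ F = 1 := by intro F; simp [containInd]
  simp only [h1, one_mul]
  have h2 := mul_meas_ge_le_integral_of_nonneg (μ := binomialRandom W p)
    (f := fun F => containCount 𝒞 A F ^ k)
    (Filter.Eventually.of_forall fun F => pow_nonneg (containCount_nonneg 𝒞 A F) _)
    Integrable.of_finite (a ^ k)
  rw [mul_comm]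
  refine le_trans (mul_le_mul_of_nonneg_left ?_ (pow_nonneg ha _)) h2
  exact measureReal_mono fun F hF => pow_le_pow_left₀ ha hF _

/-- A lower bound for the upper tail, obtained by planting the edges in `U`. -/
lemma sub_le_measureReal_containCount_ge_mul (p : unitInterval)
    (hA : ∀ c ∈ 𝒞, A c ⊆ offDiagPairs W) {U : Finset (Sym2 W)} (hU : U ⊆ offDiagPairs W)
    {a : ℝ} (ha : 0 ≤ a) :
    ∑ c ∈ 𝒞, (p : ℝ) ^ #(A c ∪ U) - a * (p : ℝ) ^ #U ≤
      (binomialRandom W p).real {F | a ≤ containCount 𝒞 A F} * #𝒞 := by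
  classical
  set S : Set (SimpleGraph W) := {F | a ≤ containCount 𝒞 A F}
  have hS : MeasurableSet S := S.toFinite.measurableSet
  have h1 : ∑ c ∈ 𝒞, (p : ℝ) ^ #(A c ∪ U) =
      ∫ F, containCount 𝒞 A F * containInd U F ∂(binomialRandom W p) := by
    unfold containCount
    simp_rw [Finset.sum_mul, containInd_mul]
    rw [integral_finsetSum _ fun _ _ => Integrable.of_finite]
    exact Finset.sum_congr rfl fun c hc => (integral_containInd p (union_subset (hA c hc) hU)).symm
  have h2 : (binomialRandom W p).real S * #𝒞 =
      ∫ F, S.indicator 1 F * (#𝒞 : ℝ) ∂(binomialRandom W p) := by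
    rw [integral_mul_const, integral_indicator_one hS]
  rw [h1, h2, ← integral_containInd p hU, ← integral_const_mul, ← integral_sub
    Integrable.of_finite Integrable.of_finite]
  -- Pointwise `(X - a) 1_U ≤ #𝒞 * 1_{X ≥ a}`, because `X ≤ #𝒞`.
  refine integral_mono Integrable.of_finite Integrable.of_finite fun F => ?_
  have h3 := containCount_le_card 𝒞 A F
  have h4 := containCount_nonneg 𝒞 A F
  have h5 := containInd_nonneg U F
  have h6 := containInd_le_one U F
  by_cases hF : F ∈ S
  · simp only [Set.indicator_of_mem hF, Pi.one_apply, one_mul]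
    nlinarith
  · simp only [Set.indicator_of_notMem hF, zero_mul]
    have : containCount 𝒞 A F < a := by simpa [S] using hF
    nlinarith

end Probability

/-! ### The fractional independence number and its dual -/

section FracIndep

variable {W : Type*}

lemma bddAbove_fracIndep [Finite W] (H : SimpleGraph W) :
    BddAbove {s : ℝ | ∃ x : W → ℝ, (∀ i, 0 ≤ x i ∧ x i ≤ 1) ∧
      (∀ i j, H.Adj i j → x i + x j ≤ 1) ∧ s = ∑ᶠ i, x i} := by
  have := Fintype.ofFinite W
  refine ⟨Fintype.card W, ?_⟩
  rintro s ⟨x, hx, -, rfl⟩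
  rw [finsum_eq_sum_of_fintype]
  refine (Finset.sum_le_card_nsmul _ _ 1 fun i _ => (hx i).2).trans ?_
  simp

lemma sum_le_fracIndepNum [Fintype W] {H : SimpleGraph W} {x : W → ℝ}
    (hx : ∀ i, 0 ≤ x i ∧ x i ≤ 1) (hH : ∀ i j, H.Adj i j → x i + x j ≤ 1) :
    ∑ i, x i ≤ fracIndepNum H :=
  le_csSup (bddAbove_fracIndep H) ⟨x, hx, hH, by rw [finsum_eq_sum_of_fintype]⟩

lemma fracIndepNum_le_card [Fintype W] (H : SimpleGraph W) :
    fracIndepNum H ≤ Fintype.card W := by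
  refine csSup_le ⟨0, 0, by simp, by simp, by simp⟩ ?_
  rintro s ⟨x, hx, -, rfl⟩
  rw [finsum_eq_sum_of_fintype]
  refine (Finset.sum_le_card_nsmul _ _ 1 fun i _ => (hx i).2).trans ?_
  simp

lemma half_card_le_fracIndepNum [Fintype W] (H : SimpleGraph W) :
    (Fintype.card W : ℝ) / 2 ≤ fracIndepNum H := by
  have := sum_le_fracIndepNum (H := H) (x := fun _ => 1 / 2) (fun _ => by norm_num)
    (fun _ _ _ => by norm_num)
  simpa [div_eq_mul_inv] using this

/-- Compactness of the polytope. A maximiser is needed to choose the clone numbers of the planted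
blow-up. -/
lemma exists_sum_eq_fracIndepNum [Fintype W] (H : SimpleGraph W) :
    ∃ x : W → ℝ, (∀ i, 0 ≤ x i ∧ x i ≤ 1) ∧ (∀ i j, H.Adj i j → x i + x j ≤ 1) ∧
      ∑ i, x i = fracIndepNum H := by
  set K : Set (W → ℝ) := {x | (∀ i, 0 ≤ x i ∧ x i ≤ 1) ∧ ∀ i j, H.Adj i j → x i + x j ≤ 1}
  have hK : IsCompact K := by
    have h1 : IsCompact (Set.pi Set.univ fun _ : W => Set.Icc (0 : ℝ) 1) :=
      isCompact_univ_pi fun _ => isCompact_Icc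
    refine h1.of_isClosed_subset ?_ fun x hx i _ => hx.1 i
    simp only [K, Set.ofPred_and, Set.ofPred_forall]
    refine IsClosed.inter (isClosed_iInter fun i => IsClosed.inter ?_ ?_)
      (isClosed_iInter fun i => isClosed_iInter fun j => isClosed_iInter fun _ => ?_)
    · exact isClosed_le (by fun_prop) (by fun_prop)
    · exact isClosed_le (by fun_prop) (by fun_prop)
    · exact isClosed_le (by fun_prop) (by fun_prop)
  obtain ⟨x, hx, hmax⟩ := hK.exists_isMaxOn (f := fun x => ∑ i, x i)
    ⟨0, fun _ => by simp, fun _ _ _ => by simp⟩ (by fun_prop)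
  refine ⟨x, hx.1, hx.2, le_antisymm (sum_le_fracIndepNum hx.1 hx.2) ?_⟩
  refine csSup_le ⟨0, 0, by simp, by simp, by simp⟩ ?_
  rintro s ⟨y, hy, hyH, rfl⟩
  rw [finsum_eq_sum_of_fintype]
  exact hmax ⟨hy, hyH⟩

/-- A partial matching along edges that misses at most `2 α* - |W|` vertices, extended to a
permutation. -/
lemma exists_perm_adj [Fintype W] (H : SimpleGraph W) :
    ∃ (D : Finset W) (σ : Equiv.Perm W), (∀ v ∉ D, H.Adj v (σ v)) ∧
      (Fintype.card W + #D : ℝ) / 2 ≤ fracIndepNum H := by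
  classical
  set N : Finset W → Finset W := fun S => univ.filter fun j => ∃ i ∈ S, H.Adj i j with hN
  -- The maximal deficiency `d` in Hall's condition controls both the matching and, from below,
  -- `α*`.
  obtain ⟨S₀, -, hS₀⟩ := Finset.exists_max_image (univ : Finset (Finset W))
    (fun S => (#S : ℤ) - #(N S)) ⟨∅, mem_univ _⟩
  set d : ℕ := #S₀ - #(N S₀) with hd
  have hd0 : #(N S₀) ≤ #S₀ := by
    have h := hS₀ ∅ (mem_univ _)
    have h' : N ∅ = ∅ := by simp [hN]
    rw [h', card_empty] at h
    omega
  have hdef : ∀ S, #S ≤ #(N S) + d := by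
    intro S
    have h := hS₀ S (mem_univ _)
    omega
  have hα : (Fintype.card W + d : ℝ) / 2 ≤ fracIndepNum H := by
    -- A half-integral weight: 1 on `S₀ \ N S₀`, 0 on `N S₀ \ S₀`, and 1/2 elsewhere. It is feasible
    -- since neighbours of `S₀` lie in `N S₀`.
    set x : W → ℝ := fun i => 1 / 2 + (if i ∈ S₀ then 1 / 2 else 0) -
      (if i ∈ N S₀ then 1 / 2 else 0) with hx
    have h1 : ∑ i, x i = (Fintype.card W + d : ℝ) / 2 := by
      simp only [hx, Finset.sum_add_distrib, Finset.sum_sub_distrib, Finset.sum_ite_mem,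
        Finset.univ_inter, Finset.sum_const, Finset.card_univ, nsmul_eq_mul]
      rw [hd, Nat.cast_sub hd0]
      ring
    rw [← h1]
    refine sum_le_fracIndepNum (fun i => ?_) (fun i j hij => ?_)
    · simp only [hx]
      split_ifs <;> norm_num
    · have hi : i ∈ S₀ → j ∈ N S₀ := fun h => by simpa [hN] using ⟨i, h, hij⟩
      have hj : j ∈ S₀ → i ∈ N S₀ := fun h => by simpa [hN] using ⟨j, h, hij.symm⟩
      simp only [hx]
      split_ifs <;> first
        | (norm_num; done)
        | exact absurd (hi ‹_›) ‹_›
        | exact absurd (hj ‹_›) ‹_›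
  -- Hall's condition holds once every vertex also gets `d` common dummy partners. `D` will be the
  -- set of vertices matched to dummies.
  obtain ⟨f, hf, hft⟩ := (Finset.all_card_le_biUnion_card_iff_exists_injective
    (fun i : W => (H.neighborFinset i).disjSum (univ : Finset (Fin d)))).1 (by
      intro S
      rcases S.eq_empty_or_nonempty with rfl | ⟨s, hs⟩
      · simp
      · refine (hdef S).trans ?_
        have : (N S).disjSum (univ : Finset (Fin d)) ⊆
            S.biUnion fun i : W => (H.neighborFinset i).disjSum (univ : Finset (Fin d)) := by
          intro a ha
          rw [Finset.mem_biUnion]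
          rcases a with a | a
          · simp only [inl_mem_disjSum, hN, mem_filter, mem_univ, true_and] at ha
            obtain ⟨i, hi, hia⟩ := ha
            exact ⟨i, hi, by simpa using hia⟩
          · exact ⟨s, hs, by simp⟩
        refine le_trans (le_of_eq ?_) (card_le_card this)
        simp)
  set D : Finset W := univ.filter fun i => (f i).isRight with hD
  have hDd : #D ≤ d := by
    have : #D ≤ #((univ : Finset (Fin d)).map Function.Embedding.inr : Finset (W ⊕ Fin d)) := by
      refine Finset.card_le_card_of_injOn f ?_ hf.injOn
      intro i hi
      simp only [hD, coe_filter, mem_univ, true_and, Set.mem_ofPred_eq, Sum.isRight_iff] at hi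
      obtain ⟨a, ha⟩ := hi
      simp [ha]
    simpa using this
  have hg : ∀ i : {i // i ∉ D}, ∃ j, f i = Sum.inl j := by
    rintro ⟨i, hi⟩
    simp only [hD, mem_filter, mem_univ, true_and, Bool.not_eq_true, Sum.isRight_eq_false,
      Sum.isLeft_iff] at hi
    exact hi
  choose g hg using hg
  have hginj : Function.Injective g := by
    intro i j hij
    have : f i = f j := by rw [hg, hg, hij]
    exact Subtype.ext (hf this)
  let e : {i // i ∉ D} ≃ {j // j ∈ Set.range g} := Equiv.ofInjective g hginj
  -- The matching is an injection from the complement of `D`; its values on `D` are irrelevant.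
  refine ⟨D, e.extendSubtype, fun v hv => ?_, ?_⟩
  · rw [Equiv.extendSubtype_apply_of_mem e v hv]
    have h1 := hft v
    rw [hg ⟨v, hv⟩] at h1
    simpa [e] using h1
  · refine le_trans ?_ hα
    have : (#D : ℝ) ≤ d := by exact_mod_cast hDd
    linarith

end FracIndep

/-! ### Cauchy–Schwarz along the cycles of a permutation -/

section HomCount

variable {V X : Type*} [Fintype V] [Fintype X] [DecidableEq V]

/-- Exchanging `φ x` with `y` is an involution of the pairs `(φ, y)`. -/
lemma sum_sum_update (G : (V → X) → ℝ) (x : V) :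
    ∑ φ : V → X, ∑ y, G (Function.update φ x y) = Fintype.card X * ∑ φ, G φ := by
  have h : ∑ z : (V → X) × X, G (Function.update z.1 x z.2) = ∑ z : (V → X) × X, G z.1 := by
    have hinv : Function.Involutive
        (fun z : (V → X) × X => (Function.update z.1 x z.2, z.1 x)) := by
      intro z
      simp
    exact Fintype.sum_equiv hinv.toPerm _ _ fun z => rfl
  rw [Fintype.sum_prod_type, Fintype.sum_prod_type] at h
  rw [h, Finset.mul_sum]
  simp

/-- A cyclic Cauchy–Schwarz inequality: along a permutation, a sum over all maps of a product of
kernels is at most the product of their Hilbert–Schmidt norms. -/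
lemma sum_prod_perm_le (σ : Equiv.Perm V) (K : V → X → X → ℝ) (c : V → ℝ)
    (hK : ∀ v x y, 0 ≤ K v x y) (hc : ∀ v, 0 ≤ c v)
    (hHS : ∀ v, ∑ x, ∑ y, K v x y ^ 2 ≤ c v ^ 2) (htr : ∀ v, σ v = v → ∑ x, K v x x ≤ c v) :
    ∑ φ : V → X, ∏ v, K v (φ v) (φ (σ v)) ≤ ∏ v, c v := by
  -- Induction on the number of moved points: a moved `x` is bypassed, its predecessor `u` now going
  -- to `σ x`, while `x` becomes a fixed point.
  induction hn : #σ.support using Nat.strong_induction_on generalizing σ K c with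
  | _ n ih =>
  by_cases hσ : ∀ v, σ v = v
  · simp only [hσ]
    rw [← Fintype.prod_sum (fun v x => K v x x)]
    exact Finset.prod_le_prod (fun v _ => Finset.sum_nonneg fun x _ => hK _ _ _)
      fun v _ => htr v (hσ v)
  push Not at hσ
  obtain ⟨x, hx⟩ := hσ
  rcases isEmpty_or_nonempty X with hX | hX
  · have : IsEmpty (V → X) := ⟨fun φ => hX.elim (φ x)⟩
    simp only [univ_eq_empty, Finset.sum_empty]
    exact Finset.prod_nonneg fun v _ => hc v
  have hN : (0 : ℝ) < Fintype.card X := by exact_mod_cast Fintype.card_pos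
  set u := σ.symm x with hu
  have hσu : σ u = x := by simp [hu]
  have hux : u ≠ x := fun h => hx (by rw [← h, hσu, h])
  set τ : Equiv.Perm V := Equiv.swap x (σ x) * σ with hτ
  have hτx : τ x = x := by simp [hτ]
  have hτu : τ u = σ x := by simp [hτ, hσu]
  have hτv : ∀ v, v ≠ x → v ≠ u → τ v = σ v := by
    intro v hvx hvu
    simp only [hτ, Equiv.Perm.mul_apply]
    refine Equiv.swap_apply_of_ne_of_ne (fun h => hvu ?_) (fun h => hvx (σ.injective h))
    rw [hu, ← h, Equiv.symm_apply_apply]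
  -- The kernels at `u` and `x` are composed, and the Hilbert–Schmidt norm is submultiplicative. The
  -- freed coordinate `x` receives the constant kernel `1 / |X|`, of norm and trace 1, so that the
  -- sum can still run over all maps.
  set L : X → X → ℝ := fun a b => ∑ y, K u a y * K x y b with hL
  set K' : V → X → X → ℝ :=
    Function.update (Function.update K u L) x fun _ _ => (Fintype.card X : ℝ)⁻¹ with hK'
  set c' : V → ℝ := Function.update (Function.update c u (c u * c x)) x 1 with hc'
  have hL0 : ∀ a b, 0 ≤ L a b := fun a b =>
    Finset.sum_nonneg fun y _ => mul_nonneg (hK _ _ _) (hK _ _ _)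
  have hsplit : ∀ f : V → ℝ, ∏ v, f v = f x * (f u * ∏ v ∈ (univ.erase x).erase u, f v) := by
    intro f
    rw [Finset.mul_prod_erase _ _ (by simp [hux]), Finset.mul_prod_erase _ _ (mem_univ _)]
  have hLHS : ∑ a, ∑ b, L a b ^ 2 ≤ (c u * c x) ^ 2 := by
    calc ∑ a, ∑ b, L a b ^ 2 ≤ ∑ a, ∑ b, (∑ y, K u a y ^ 2) * ∑ y, K x y b ^ 2 :=
          Finset.sum_le_sum fun a _ => Finset.sum_le_sum fun b _ =>
            Finset.sum_mul_sq_le_sq_mul_sq _ _ _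
      _ = (∑ a, ∑ y, K u a y ^ 2) * ∑ y, ∑ b, K x y b ^ 2 := by
          rw [Finset.sum_comm (s := univ) (t := univ) (f := fun y b => K x y b ^ 2),
            Finset.sum_mul_sum]
      _ ≤ c u ^ 2 * c x ^ 2 := mul_le_mul (hHS u) (hHS x)
          (Finset.sum_nonneg fun _ _ => Finset.sum_nonneg fun _ _ => sq_nonneg _) (sq_nonneg _)
      _ = _ := by ring
  -- Required when `u` and `x` form a 2-cycle: then `u` also becomes a fixed point, where the trace
  -- has to be bounded.
  have hLtr : ∑ a, L a a ≤ c u * c x := by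
    have h1 : ∑ a, L a a = ∑ z : X × X, K u z.1 z.2 * K x z.2 z.1 := by
      rw [Fintype.sum_prod_type]
    have h2 : (∑ a, L a a) ^ 2 ≤ (c u * c x) ^ 2 := by
      rw [h1]
      refine (Finset.sum_mul_sq_le_sq_mul_sq _ _ _).trans ?_
      rw [Fintype.sum_prod_type, Fintype.sum_prod_type_right, mul_pow]
      exact mul_le_mul (hHS u) (hHS x)
        (Finset.sum_nonneg fun _ _ => Finset.sum_nonneg fun _ _ => sq_nonneg _) (sq_nonneg _)
    exact le_of_sq_le_sq h2 (mul_nonneg (hc u) (hc x))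
  have key := ih #τ.support (hn ▸ Equiv.Perm.card_support_swap_mul hx) τ K' c' ?_ ?_ ?_ ?_ rfl
  · have e1 : ∏ v, c' v = ∏ v, c v := by
      rw [hsplit, hsplit c]
      have : ∏ v ∈ (univ.erase x).erase u, c' v = ∏ v ∈ (univ.erase x).erase u, c v := by
        refine Finset.prod_congr rfl fun v hv => ?_
        simp only [mem_erase, mem_univ, and_true] at hv
        simp [hc', hv.1, hv.2]
      rw [this]
      simp only [hc', Function.update_self, Function.update_of_ne hux]
      ring
    rw [e1] at key
    refine le_trans (le_of_eq ?_) key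
    have e2 : ∀ φ : V → X, ∏ v, K' v (φ v) (φ (τ v)) = (Fintype.card X : ℝ)⁻¹ *
        ∑ y, ∏ v, K v (Function.update φ x y v) (Function.update φ x y (σ v)) := by
      intro φ
      rw [hsplit]
      have h1 : ∀ y, ∏ v, K v (Function.update φ x y v) (Function.update φ x y (σ v)) =
          K u (φ u) y * K x y (φ (σ x)) *
            ∏ v ∈ (univ.erase x).erase u, K' v (φ v) (φ (τ v)) := by
        intro y
        rw [hsplit]
        have : ∏ v ∈ (univ.erase x).erase u,
            K v (Function.update φ x y v) (Function.update φ x y (σ v)) =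
            ∏ v ∈ (univ.erase x).erase u, K' v (φ v) (φ (τ v)) := by
          refine Finset.prod_congr rfl fun v hv => ?_
          simp only [mem_erase, mem_univ, and_true] at hv
          have hσv : σ v ≠ x := fun h => hv.1 (by rw [hu, ← h, Equiv.symm_apply_apply])
          rw [hτv v hv.2 hv.1, Function.update_of_ne hv.2, Function.update_of_ne hσv]
          simp [hK', hv.1, hv.2]
        rw [this]
        simp only [Function.update_self, Function.update_of_ne hx, Function.update_of_ne hux, hσu]
        ring
      simp_rw [h1]
      rw [← Finset.sum_mul, hτu]
      simp only [hK', Function.update_self, Function.update_of_ne hux, hL]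
    simp_rw [e2]
    rw [← Finset.mul_sum, sum_sum_update
      (fun φ => ∏ v, K v (φ v) (φ (σ v))), inv_mul_cancel_left₀ hN.ne']
  · intro v a b
    rcases eq_or_ne v x with rfl | hvx
    · simp [hK']
    rcases eq_or_ne v u with rfl | hvu
    · simp [hK', hux, hL0]
    · simp [hK', hvx, hvu, hK]
  · intro v
    rcases eq_or_ne v x with rfl | hvx
    · simp [hc']
    rcases eq_or_ne v u with rfl | hvu
    · simpa [hc', hux] using mul_nonneg (hc _) (hc _)
    · simp [hc', hvx, hvu, hc]
  · intro v
    rcases eq_or_ne v x with rfl | hvx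
    · simp only [hK', hc', Function.update_self, Finset.sum_const, Finset.card_univ, nsmul_eq_mul]
      field_simp
      exact le_rfl
    rcases eq_or_ne v u with rfl | hvu
    · simpa [hK', hc', hux] using hLHS
    · simpa [hK', hc', hvx, hvu] using hHS v
  · intro v hv
    rcases eq_or_ne v x with rfl | hvx
    · simp only [hK', hc', Function.update_self, Finset.sum_const, Finset.card_univ, nsmul_eq_mul]
      rw [mul_inv_cancel₀ hN.ne']
    rcases eq_or_ne v u with rfl | hvu
    · simpa [hK', hc', hux] using hLtr
    · rw [hτv v hvx hvu] at hv
      simpa [hK', hc', hvx, hvu] using htr v hv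

end HomCount

/-! ### Counting maps into a set of few edges -/

section EdgeCount

variable {X : Type*} [Fintype X] [DecidableEq X]

lemma card_pairs_le (U : Finset (Sym2 X)) :
    #{z : X × X | s(z.1, z.2) ∈ U} ≤ 2 * #U := by
  refine Finset.card_le_mul_card_image_of_maps_to (f := fun z : X × X => s(z.1, z.2)) ?_ 2 ?_
  · intro z hz
    simpa using hz
  · intro e _
    induction e with | _ a b =>
    refine (card_le_card (t := {(a, b), (b, a)}) ?_).trans card_le_two
    intro z hz
    simp only [mem_filter, Sym2.eq_iff] at hz
    simp only [mem_insert, mem_singleton, Prod.ext_iff]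
    exact hz.2

lemma card_touched_le (U : Finset (Sym2 X)) : #{x : X | ∃ e ∈ U, x ∈ e} ≤ 2 * #U := by
  refine le_trans (card_le_card_of_surjOn (s := {z : X × X | s(z.1, z.2) ∈ U}) Prod.fst ?_)
    (card_pairs_le U)
  intro x hx
  simp only [coe_filter, mem_univ, true_and, Set.mem_ofPred_eq] at hx
  obtain ⟨e, he, hxe⟩ := hx
  obtain ⟨y, rfl⟩ := hxe
  exact ⟨(x, y), by simpa using he, rfl⟩

/-- With `m = 2 |U|`, the relation "`s(x, y) ∈ U`" has Hilbert–Schmidt norm at most `√m`, and at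
most `m` vertices are touched by `U`. Cyclic Cauchy–Schwarz along the permutation of
`exists_perm_adj` gives `m ^ ((|W| + |D|) / 2)`. Nonemptiness of `U` makes `m ≥ 1`, so the exponent
may be raised to `α*`. -/
lemma card_hom_le {W : Type*} [Fintype W] [DecidableEq W] (H : SimpleGraph W)
    {U : Finset (Sym2 X)} (hU : U.Nonempty) :
    ({φ : W → X | (∀ i, ∃ e ∈ U, φ i ∈ e) ∧ ∀ i j, H.Adj i j → s(φ i, φ j) ∈ U}.ncard : ℝ) ≤
      (2 * #U : ℝ) ^ fracIndepNum H := by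
  classical
  obtain ⟨D, σ, hσ, hD⟩ := exists_perm_adj H
  set m : ℝ := 2 * #U with hm
  have hm1 : 1 ≤ m := by
    have : (1 : ℝ) ≤ #U := by exact_mod_cast hU.card_pos
    rw [hm]; linarith
  have hm0 : 0 ≤ m := by linarith
  set T : Finset X := univ.filter fun x => ∃ e ∈ U, x ∈ e with hT
  have hTm : (#T : ℝ) ≤ m := by rw [hm]; exact_mod_cast card_touched_le U
  have hPm : ((#{z : X × X | s(z.1, z.2) ∈ U} : ℕ) : ℝ) ≤ m := by
    rw [hm]; exact_mod_cast card_pairs_le U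
  -- Off `D` the edge constraint is used; on `D`, where `σ` need not follow an edge, only that the
  -- endpoints are touched by `U`.
  set K : W → X → X → ℝ := fun v x y =>
    if v ∈ D then (if x ∈ T then 1 else 0) * (if y ∈ T then 1 else 0)
    else if s(x, y) ∈ U then 1 else 0 with hK
  set c : W → ℝ := fun v => if v ∈ D then m else Real.sqrt m with hc
  have h1 := sum_prod_perm_le σ K c ?_ ?_ ?_ ?_
  · have h2 : ∏ v, c v ≤ m ^ fracIndepNum H := by
      simp only [hc]
      rw [Finset.prod_ite, Finset.prod_const, Finset.prod_const, Real.sqrt_eq_rpow,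
        ← Real.rpow_natCast, ← Real.rpow_natCast, ← Real.rpow_mul hm0,
        ← Real.rpow_add (by linarith)]
      refine Real.rpow_le_rpow_of_exponent_le hm1 (le_trans (le_of_eq ?_) hD)
      have h3 : #(univ.filter fun v => v ∈ D) = #D := by simp
      have h4 : #(univ.filter fun v => v ∈ D) + #(univ.filter fun v => v ∉ D) =
          Fintype.card W := Finset.card_filter_add_card_filter_not _
      rw [← h4, h3]
      push_cast
      ring
    refine le_trans ?_ (h1.trans h2)
    rw [Set.ncard_eq_toFinset_card', ← nsmul_one, ← Finset.sum_const]
    refine (Finset.sum_le_sum ?_).trans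
      (Finset.sum_le_sum_of_subset_of_nonneg (subset_univ _) ?_)
    · intro φ hφ
      simp only [Set.mem_toFinset, Set.mem_ofPred_eq] at hφ
      refine le_of_eq (Finset.prod_eq_one fun v _ => ?_).symm
      by_cases hv : v ∈ D
      · simp [hK, hv, hT, hφ.1]
      · simp [hK, hv, hφ.2 _ _ (hσ v hv)]
    · intro φ _ _
      refine Finset.prod_nonneg fun v _ => ?_
      simp only [hK]
      split_ifs <;> norm_num
  · intro v x y
    simp only [hK]
    split_ifs <;> norm_num
  · intro v
    simp only [hc]
    split_ifs
    · exact hm0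
    · exact Real.sqrt_nonneg _
  · intro v
    by_cases hv : v ∈ D
    · simp only [hK, hc, hv, if_true]
      simp only [mul_pow, ite_pow, one_pow, ne_eq, OfNat.ofNat_ne_zero, not_false_eq_true,
        zero_pow]
      simp_rw [← Finset.mul_sum]
      rw [← Finset.sum_mul]
      simp only [Finset.sum_ite_mem, Finset.univ_inter, Finset.sum_const, nsmul_eq_mul, mul_one]
      nlinarith [Nat.cast_nonneg (α := ℝ) #T]
    · simp only [hK, hc, hv, if_false, Real.sq_sqrt hm0]
      refine le_trans (le_of_eq ?_) hPm
      simp only [ite_pow, one_pow, ne_eq, OfNat.ofNat_ne_zero, not_false_eq_true, zero_pow]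
      rw [← Fintype.sum_prod_type (f := fun z : X × X => if s(z.1, z.2) ∈ U then (1 : ℝ) else 0)]
      simp
  · intro v hv
    have hvD : v ∈ D := by
      by_contra h
      exact (hσ v h).ne hv.symm
    simp only [hK, hc, hvD, if_true]
    simpa using hTm

end EdgeCount

/-! ### Rooted copies in the complete graph -/

section Copies

variable {V : Type*} [Fintype V]

/-- The edges of `G` as a finset. -/
def edges (G : SimpleGraph V) : Finset (Sym2 V) := G.edgeSet.toFinite.toFinset

lemma mem_edges {G : SimpleGraph V} {e : Sym2 V} : e ∈ edges G ↔ e ∈ G.edgeSet := by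
  simp [edges]

lemma card_edges (G : SimpleGraph V) : #(edges G) = numEdges G :=
  (Set.ncard_eq_toFinset_card _ _).symm

open Classical in
/-- The injections `V → [n]` that send exactly the roots to the first `|R|` vertices. -/
def rootedMaps (R : Finset V) (n : ℕ) : Finset (V → Fin n) :=
  univ.filter fun φ => Function.Injective φ ∧ ∀ v, v ∈ R ↔ φ v ∈ rootSet n #R

lemma mem_rootedMaps {R : Finset V} {n : ℕ} {φ : V → Fin n} :
    φ ∈ rootedMaps R n ↔ Function.Injective φ ∧ ∀ v, v ∈ R ↔ φ v ∈ rootSet n #R := by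
  simp [rootedMaps]

/-- The vertex set and the edge set of the image of `G` under `φ`. -/
def imagePair (G : SimpleGraph V) {n : ℕ} (φ : V → Fin n) :
    Finset (Fin n) × Finset (Sym2 (Fin n)) :=
  (univ.image φ, (edges G).image (Sym2.map φ))

/-- The rooted copies of `G` in the complete graph. -/
def copies (G : SimpleGraph V) (R : Finset V) (n : ℕ) :
    Finset (Finset (Fin n) × Finset (Sym2 (Fin n))) :=
  (rootedMaps R n).image (imagePair G)

variable {G : SimpleGraph V} {R : Finset V} {n : ℕ}

lemma mem_copies {c : Finset (Fin n) × Finset (Sym2 (Fin n))} :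
    c ∈ copies G R n ↔ ∃ φ ∈ rootedMaps R n, imagePair G φ = c := by
  simp [copies]

lemma copies_snd_subset : ∀ c ∈ copies G R n, c.2 ⊆ offDiagPairs (Fin n) := by
  intro c hc
  obtain ⟨φ, hφ, rfl⟩ := mem_copies.1 hc
  intro e he
  simp only [imagePair, mem_image] at he
  obtain ⟨s, hs, rfl⟩ := he
  have h1 := G.not_isDiag_of_mem_edgeSet (mem_edges.1 hs)
  simp only [offDiagPairs, mem_filter, mem_univ, true_and]
  rwa [Sym2.isDiag_map (mem_rootedMaps.1 hφ).1]

lemma card_copies_snd : ∀ c ∈ copies G R n, #c.2 = numEdges G := by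
  intro c hc
  obtain ⟨φ, hφ, rfl⟩ := mem_copies.1 hc
  simp only [imagePair]
  rw [card_image_of_injective _ (Sym2.map.injective (mem_rootedMaps.1 hφ).1), card_edges]

/-- A subgraph is determined by its vertex set and its edge set; the vertices matter because `G` may
have isolated ones. Copies in `F` are thus the copies in the complete graph whose edges lie in `F`,
which turns the count into a sum of indicators. -/
lemma rootedCount_eq_containCount (F : SimpleGraph (Fin n)) :
    (rootedCount G R F : ℝ) = containCount (copies G R n) Prod.snd F := by
  classical
  have h1 : containCount (copies G R n) Prod.snd F =
      #((copies G R n).filter fun c => (c.2 : Set (Sym2 (Fin n))) ⊆ F.edgeSet) := by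
    simp [containCount, containInd]
  rw [h1, rootedCount, Nat.cast_inj]
  set Θ : F.Subgraph → Finset (Fin n) × Finset (Sym2 (Fin n)) :=
    fun F' => (F'.verts.toFinite.toFinset, F'.edgeSet.toFinite.toFinset) with hΘ
  have hinj : Function.Injective Θ := by
    intro F₁ F₂ h
    simp only [hΘ, Prod.mk.injEq, Set.Finite.toFinset_inj] at h
    refine Subgraph.ext h.1 ?_
    ext a b
    rw [← Subgraph.mem_edgeSet, ← Subgraph.mem_edgeSet, h.2]
  rw [← Set.ncard_image_of_injective _ hinj, ← Set.ncard_coe_finset]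
  congr 1
  ext c
  simp only [Set.mem_image, Set.mem_ofPred_eq, coe_filter, mem_copies]
  constructor
  · rintro ⟨F', ⟨e, he⟩, rfl⟩
    refine ⟨⟨fun v => (e v : Fin n), mem_rootedMaps.2
      ⟨Subtype.val_injective.comp e.injective, he⟩, ?_⟩, ?_⟩
    · simp only [imagePair, hΘ, Prod.mk.injEq]
      constructor
      · ext a
        simp only [mem_image, mem_univ, true_and, Set.Finite.mem_toFinset]
        exact ⟨fun ⟨v, hv⟩ => hv ▸ (e v).2, fun ha => ⟨e.symm ⟨a, ha⟩, by simp⟩⟩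
      · ext s
        simp only [mem_image, mem_edges, Set.Finite.mem_toFinset]
        constructor
        · rintro ⟨s, hs, rfl⟩
          induction s with | _ a b =>
          exact (e.map_adj_iff.2 hs : F'.coe.Adj (e a) (e b))
        · induction s with | _ a b =>
          intro hs
          have hs' : F'.Adj a b := hs
          refine ⟨s(e.symm ⟨a, hs'.fst_mem⟩, e.symm ⟨b, hs'.snd_mem⟩), ?_, by simp⟩
          rw [mem_edgeSet, e.symm.map_adj_iff]
          exact hs'
    · simpa [hΘ] using F'.edgeSet_subset
  · rintro ⟨⟨φ, hφ, rfl⟩, hF⟩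
    obtain ⟨hφi, hφR⟩ := mem_rootedMaps.1 hφ
    have hadj : ∀ u v, G.Adj u v → F.Adj (φ u) (φ v) := by
      intro u v huv
      rw [← mem_edgeSet]
      apply hF
      simp only [imagePair, coe_image, Set.mem_image, Finset.mem_coe]
      exact ⟨s(u, v), mem_edges.2 huv, rfl⟩
    let F' : F.Subgraph :=
      { verts := Set.range φ
        Adj := fun a b => ∃ u v, G.Adj u v ∧ φ u = a ∧ φ v = b
        adj_sub := by
          rintro _ _ ⟨u, v, h, rfl, rfl⟩
          exact hadj u v h
        edge_vert := by
          rintro _ _ ⟨u, v, h, rfl, rfl⟩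
          exact ⟨u, rfl⟩
        symm := ⟨by
          rintro _ _ ⟨u, v, h, rfl, rfl⟩
          exact ⟨v, u, h.symm, rfl, rfl⟩⟩ }
    refine ⟨F', ⟨⟨Equiv.ofInjective φ hφi, ?_⟩, fun v => hφR v⟩, ?_⟩
    · intro a b
      show (∃ u v, G.Adj u v ∧ φ u = φ a ∧ φ v = φ b) ↔ _
      constructor
      · rintro ⟨u, v, h, h1, h2⟩
        rwa [← hφi h1, ← hφi h2]
      · exact fun h => ⟨a, b, h, rfl, rfl⟩
    · simp only [imagePair, hΘ, Prod.mk.injEq]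
      constructor
      · ext a
        simp [F']
      · ext s
        simp only [mem_image, mem_edges, Set.Finite.mem_toFinset]
        induction s with | _ a b =>
        constructor
        · rintro ⟨u, v, h, rfl, rfl⟩
          exact ⟨s(u, v), h, rfl⟩
        · rintro ⟨s, hs, h⟩
          induction s with | _ u v =>
          have : F'.Adj (φ u) (φ v) := ⟨u, v, hs, rfl, rfl⟩
          rw [← h]
          exact this

lemma rootedMean_eq (p : unitInterval) :
    rootedMean G R n p = #(copies G R n) * (p : ℝ) ^ numEdges G := by
  unfold rootedMean
  simp_rw [rootedCount_eq_containCount]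
  rw [integral_containCount p copies_snd_subset, Finset.sum_congr rfl
    (fun c hc => by rw [card_copies_snd c hc]), Finset.sum_const, nsmul_eq_mul]

lemma upperTail_eq (p : unitInterval) (t : ℝ) :
    upperTail G R n p t = (binomialRandom (Fin n) p).real
      {F | t * rootedMean G R n p ≤ containCount (copies G R n) Prod.snd F} := by
  unfold upperTail
  simp_rw [rootedCount_eq_containCount]

/-- Every copy is the image of at least one map; the overcount by automorphisms is harmless in upper
bounds. -/
lemma sum_copies_le {g : Finset (Sym2 (Fin n)) → ℝ} (hg : ∀ A, 0 ≤ g A)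
    (P : Finset (Sym2 (Fin n)) → Prop) [DecidablePred P] :
    ∑ c ∈ copies G R n with P c.2, g c.2 ≤
      ∑ φ ∈ rootedMaps R n with P ((edges G).image (Sym2.map φ)),
        g ((edges G).image (Sym2.map φ)) := by
  classical
  rw [copies, Finset.filter_image]
  exact Finset.sum_image_le_of_nonneg (f := fun c : Finset (Fin n) × Finset (Sym2 (Fin n)) => g c.2)
    fun c _ => hg c.2

/-- The number of rooted injections whose restriction to a set `Q` of non-roots lies in a given
family. -/
lemma card_filter_rootedMaps_mul_le (Q : Set V) (hQ : Disjoint Q (R : Set V))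
    (𝒯 : Set (Q → Fin n)) :
    ({φ | φ ∈ rootedMaps R n ∧ (fun q : Q => φ q) ∈ 𝒯}.ncard : ℝ) * (n : ℝ) ^ Q.ncard ≤
      (Fintype.card V : ℝ) ^ Fintype.card V * (n : ℝ) ^ (Fintype.card V - #R) * 𝒯.ncard := by
  classical
  set r := #R
  set v := Fintype.card V
  have hrv : r ≤ v := card_le_univ R
  have hfin : 𝒯.Finite := 𝒯.toFinite
  let B := {x : V // x ∉ R ∧ x ∉ Q}
  have hB : Fintype.card B + Q.ncard = v - r := by
    have h1 : Fintype.card B = #(univ.filter fun x => x ∉ R ∧ x ∉ Q) := Fintype.card_subtype _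
    have h2 : Q.ncard = #(Q.toFinite.toFinset) := Set.ncard_eq_toFinset_card _ _
    have h3 : v - r = #(Rᶜ) := (card_compl R).symm
    rw [h1, h2, h3, ← card_union_of_disjoint]
    · congr 1
      ext x
      have : x ∈ Q → x ∉ R := fun hx hR => Set.disjoint_left.1 hQ hx hR
      simp only [mem_union, mem_filter, mem_univ, true_and, Set.Finite.mem_toFinset, mem_compl]
      tauto
    · rw [Finset.disjoint_left]
      intro x hx hx'
      simp only [mem_filter, mem_univ, true_and, Set.Finite.mem_toFinset] at hx hx'
      exact hx.2 hx'
  have hle : {φ | φ ∈ rootedMaps R n ∧ (fun q : Q => φ q) ∈ 𝒯}.ncard ≤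
      v ^ v * n ^ (Fintype.card B) * 𝒯.ncard := by
    -- A rooted map is determined by its restrictions to `R`, to `Q` and to the rest `B`. On `R` the
    -- values lie below `r`, so the default value in the encoding is never used there.
    let 𝒮 : Set ((R → Fin r) × (B → Fin n) × (Q → Fin n)) := Set.univ ×ˢ Set.univ ×ˢ 𝒯
    have h𝒮 : 𝒮.ncard ≤ v ^ v * n ^ (Fintype.card B) * 𝒯.ncard := by
      rw [Set.ncard_prod, Set.ncard_prod, Set.ncard_univ, Set.ncard_univ, ← mul_assoc]
      gcongr
      · simp only [Nat.card_eq_fintype_card, Fintype.card_fun, Fintype.card_fin,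
          Fintype.card_coe]
        change r ^ r ≤ v ^ v
        rcases Nat.eq_zero_or_pos r with h | h
        · rw [h, pow_zero]
          rcases Nat.eq_zero_or_pos v with h' | h'
          · rw [h', pow_zero]
          · exact Nat.one_le_pow _ _ h'
        · exact (Nat.pow_le_pow_left hrv r).trans
            (Nat.pow_le_pow_right (h.trans_le hrv) hrv)
      · simp
    refine le_trans (Set.ncard_le_ncard_of_injOn (fun φ : V → Fin n =>
      ((fun a : R => if h : (φ a : ℕ) < r then (⟨φ a, h⟩ : Fin r) else
          ⟨0, card_pos.2 ⟨a, a.2⟩⟩),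
        (fun b : B => φ b), (fun q : Q => φ q))) ?_ ?_ (Set.toFinite _)) h𝒮
    · rintro φ ⟨_, hφ⟩
      exact ⟨Set.mem_univ _, Set.mem_univ _, hφ⟩
    · rintro φ ⟨hφ, -⟩ ψ ⟨hψ, -⟩ h
      simp only [Prod.mk.injEq] at h
      obtain ⟨h1, h2, h3⟩ := h
      funext x
      by_cases hxR : x ∈ R
      · have ha := congrFun h1 ⟨x, hxR⟩
        have hφx : (φ x : ℕ) < r := ((mem_rootedMaps.1 hφ).2 x).1 hxR
        have hψx : (ψ x : ℕ) < r := ((mem_rootedMaps.1 hψ).2 x).1 hxR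
        simp only [hφx, hψx, dif_pos, Fin.mk.injEq] at ha
        exact Fin.ext ha
      · by_cases hxQ : x ∈ Q
        · exact congrFun h3 ⟨x, hxQ⟩
        · exact congrFun h2 ⟨x, hxR, hxQ⟩
  have hle' : ({φ | φ ∈ rootedMaps R n ∧ (fun q : Q => φ q) ∈ 𝒯}.ncard : ℝ) ≤
      (v : ℝ) ^ v * (n : ℝ) ^ (Fintype.card B) * 𝒯.ncard := by exact_mod_cast hle
  calc _ ≤ (v : ℝ) ^ v * (n : ℝ) ^ (Fintype.card B) * 𝒯.ncard * (n : ℝ) ^ Q.ncard :=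
        mul_le_mul_of_nonneg_right hle' (by positivity)
    _ = _ := by
        rw [← hB, pow_add]
        ring

lemma card_rootedMaps_le :
    (#(rootedMaps R n) : ℝ) ≤
      (Fintype.card V : ℝ) ^ Fintype.card V * (n : ℝ) ^ (Fintype.card V - #R) := by
  have h := card_filter_rootedMaps_mul_le (R := R) (n := n) ∅ (by simp) Set.univ
  simpa [Set.ncard_univ] using h

lemma card_copies_le :
    (#(copies G R n) : ℝ) ≤
      (Fintype.card V : ℝ) ^ Fintype.card V * (n : ℝ) ^ (Fintype.card V - #R) :=
  le_trans (by exact_mod_cast card_image_le) card_rootedMaps_le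

/-- Disjoint blocks of `⌊n / |V|⌋` vertices, indexed by `V`, such that the first vertices of the
blocks of the roots are the roots of `[n]`. -/
lemma exists_blocks (R : Finset V) {n : ℕ} (hn : 0 < n) :
    ∃ β : V → ℕ → Fin n,
      (∀ u v i j, i < n / Fintype.card V → j < n / Fintype.card V →
        β u i = β v j → u = v ∧ i = j) ∧
      (∀ u ∈ R, 0 < n / Fintype.card V → β u 0 ∈ rootSet n #R) ∧
      ∀ u ∉ R, ∀ i < n / Fintype.card V, β u i ∉ rootSet n #R := by
  classical
  set N := Fintype.card V with hN
  have e1 : {x // x ∈ R} ≃ {i : Fin N // (i : ℕ) < #R} := by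
    refine Fintype.equivOfCardEq ?_
    rw [Fintype.card_coe, Fintype.card_subtype]
    have : #R ≤ N := card_le_univ R
    symm
    rw [Fin.card_filter_val_lt]
    omega
  let e2 : V ≃ Fin N := Fintype.equivFin V
  have e3 : {x // ¬ x ∈ R} ≃ {i : Fin N // ¬ (i : ℕ) < #R} := by
      refine Fintype.equivOfCardEq ?_
      have h1 := Fintype.card_congr e1
      have h2 := Fintype.card_subtype_compl (fun x => x ∈ R)
      have h3 := Fintype.card_subtype_compl (fun i : Fin N => (i : ℕ) < #R)
      rw [h2, h3, h1, Fintype.card_fin]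
  let e0 : V ≃ Fin N := (Equiv.sumCompl (fun x => x ∈ R)).symm.trans
      ((Equiv.sumCongr e1 e3).trans (Equiv.sumCompl _))
  have he0 : ∀ x, x ∈ R ↔ (e0 x : ℕ) < #R := by
    intro x
    by_cases hx : x ∈ R
    · simp only [hx, true_iff, e0, Equiv.trans_apply]
      rw [Equiv.sumCompl_symm_apply_of_pos hx]
      simpa using (e1 ⟨x, hx⟩).2
    · simp only [hx, false_iff, e0, Equiv.trans_apply]
      rw [Equiv.sumCompl_symm_apply_of_neg hx]
      simp only [Equiv.sumCongr_apply, Sum.map_inr, Equiv.sumCompl_apply_inr]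
      exact (e3 ⟨x, hx⟩).2
  have hval : ∀ u i, i < n / N → N * i + e0 u < n := by
    intro u i hi
    have h1 := (e0 u).2
    have h2 : N * (i + 1) ≤ N * (n / N) := Nat.mul_le_mul_left _ hi
    have h3 := Nat.mul_div_le n N
    rw [mul_add] at h2
    omega
  -- The block of `u` is a residue class modulo `N`. As `e0` sends `R` onto the residues below `r`,
  -- index 0 in the block of a root is one of the first `r` vertices.
  refine ⟨fun u i => if h : N * i + e0 u < n then ⟨N * i + e0 u, h⟩ else ⟨0, hn⟩, ?_, ?_, ?_⟩
  · intro u v i j hi hj h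
    simp only [hval u i hi, hval v j hj, dif_pos, Fin.mk.injEq] at h
    have h1 : (N * i + e0 u) % N = (N * j + e0 v) % N := by rw [h]
    simp only [Nat.mul_add_mod, Nat.mod_eq_of_lt (e0 u).2, Nat.mod_eq_of_lt (e0 v).2] at h1
    refine ⟨e0.injective (Fin.ext h1), ?_⟩
    have hN0 : 0 < N := (Nat.zero_le _).trans_lt (e0 u).2
    have : N * i = N * j := by omega
    exact Nat.eq_of_mul_eq_mul_left hN0 this
  · intro u hu h0
    have := hval u 0 h0
    rw [mul_zero, zero_add] at this
    simp only [this, dif_pos, rootSet, Set.mem_ofPred_eq, mul_zero, zero_add]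
    exact (he0 u).1 hu
  · intro u hu i hi
    simp only [hval u i hi, dif_pos, rootSet, Set.mem_ofPred_eq, not_lt]
    have := mt (he0 u).2 hu
    omega

/-- The sum over copies is at least the sum over block maps. -/
lemma sum_piFinset_le_sum_copies [DecidableEq V] {β : V → ℕ → Fin n}
    (hβ : ∀ u v i j, i < n / Fintype.card V → j < n / Fintype.card V →
        β u i = β v j → u = v ∧ i = j)
    (hβR : ∀ u ∈ R, 0 < n / Fintype.card V → β u 0 ∈ rootSet n #R)
    (hβR' : ∀ u ∉ R, ∀ i < n / Fintype.card V, β u i ∉ rootSet n #R)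
    {a : V → ℕ} (ha : ∀ u, a u ≤ n / Fintype.card V) (haR : ∀ u ∈ R, a u = 1)
    {g : Finset (Sym2 (Fin n)) → ℝ} (hg : ∀ A, 0 ≤ g A) :
    ∑ k ∈ Fintype.piFinset fun u => range (a u),
      g ((edges G).image (Sym2.map fun u => β u (k u))) ≤ ∑ c ∈ copies G R n, g c.2 := by
  classical
  have hlt : ∀ k ∈ Fintype.piFinset (fun u => range (a u)), ∀ u, k u < n / Fintype.card V := by
    intro k hk u
    have := Finset.mem_range.1 (Fintype.mem_piFinset.1 hk u)
    exact this.trans_le (ha u)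
  -- No overcount here: the vertex set of such a copy meets each block exactly once, which recovers
  -- `k`.
  have hinj : Set.InjOn (fun k : V → ℕ => imagePair G fun u => β u (k u))
      (Fintype.piFinset fun u => range (a u)) := by
    intro k hk l hl h
    simp only [imagePair, Prod.mk.injEq] at h
    funext u
    have h1 : β u (k u) ∈ univ.image fun u => β u (k u) := mem_image_of_mem _ (mem_univ u)
    rw [h.1, mem_image] at h1
    obtain ⟨w, -, hw⟩ := h1
    obtain ⟨rfl, h2⟩ := hβ _ _ _ _ (hlt l hl w) (hlt k hk u) hw
    exact h2.symm
  rw [show ∑ k ∈ Fintype.piFinset (fun u => range (a u)),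
      g ((edges G).image (Sym2.map fun u => β u (k u))) =
      ∑ c ∈ (Fintype.piFinset fun u => range (a u)).image
        (fun k : V → ℕ => imagePair G fun u => β u (k u)), g c.2 from
    (Finset.sum_image (f := fun c => g c.2) hinj).symm]
  refine Finset.sum_le_sum_of_subset_of_nonneg ?_ fun c _ _ => hg _
  intro c hc
  obtain ⟨k, hk, rfl⟩ := mem_image.1 hc
  refine mem_copies.2 ⟨_, mem_rootedMaps.2 ⟨?_, ?_⟩, rfl⟩
  · intro u w h
    exact (hβ _ _ _ _ (hlt k hk u) (hlt k hk w) h).1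
  · intro u
    by_cases hu : u ∈ R
    · have h0 : k u = 0 := by
        have := Finset.mem_range.1 (Fintype.mem_piFinset.1 hk u)
        rw [haR u hu] at this
        omega
      have h1 := hlt k hk u
      simp only [hu, h0, true_iff]
      exact hβR u hu (by omega)
    · simp only [hu, false_iff]
      exact hβR' u hu _ (hlt k hk u)

lemma div_le_cast_natDiv {m : ℕ} (hm : 0 < m) (hn : m ≤ n) :
    (n : ℝ) / (2 * m) ≤ ((n / m : ℕ) : ℝ) := by
  have h1 : 1 ≤ n / m := (Nat.one_le_div_iff hm).2 hn
  have h2 : n < m * (n / m + 1) := Nat.lt_mul_div_succ n hm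
  have h3 : n ≤ (n / m) * (2 * m) := by nlinarith
  rw [div_le_iff₀ (by positivity)]
  exact_mod_cast h3

lemma pow_le_card_copies (hV : 0 < Fintype.card V) (hn : Fintype.card V ≤ n) :
    ((n : ℝ) / (2 * Fintype.card V)) ^ (Fintype.card V - #R) ≤ #(copies G R n) := by
  classical
  obtain ⟨β, h1, h2, h3⟩ := exists_blocks R (n := n) (by omega)
  have hpos : 1 ≤ n / Fintype.card V := (Nat.one_le_div_iff hV).2 hn
  have h := sum_piFinset_le_sum_copies (G := G) h1 h2 h3
    (a := fun u => if u ∈ R then 1 else n / Fintype.card V)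
    (by intro u; split_ifs <;> omega) (by intro u hu; simp [hu]) (g := fun _ => 1) (by simp)
  simp only [Finset.sum_const, nsmul_eq_mul, mul_one, Fintype.card_piFinset, card_range,
    Finset.prod_ite, Finset.prod_const_one, one_mul, Finset.prod_const] at h
  have h4 : #(univ.filter fun u => u ∉ R) = Fintype.card V - #R := by
    rw [← card_compl]
    congr 1
    ext u
    simp
  rw [h4] at h
  refine le_trans (pow_le_pow_left₀ (by positivity) (div_le_cast_natDiv hV hn) _) ?_
  exact_mod_cast h

end Copies

/-! ### Subgraphs of `G` and the quantity `M` -/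

section Subgraphs

variable {V : Type*} {G : SimpleGraph V}

/-- The subgraph of `G` with edge set `S` and no isolated vertices. -/
def edgeSubgraph (G : SimpleGraph V) (S : Set (Sym2 V)) : G.Subgraph where
  verts := {v | ∃ w, s(v, w) ∈ S ∧ G.Adj v w}
  Adj a b := s(a, b) ∈ S ∧ G.Adj a b
  adj_sub h := h.2
  edge_vert h := ⟨_, h⟩
  symm := ⟨fun _ _ h => ⟨Sym2.eq_swap ▸ h.1, h.2.symm⟩⟩

lemma edgeSet_edgeSubgraph {S : Set (Sym2 V)} (hS : S ⊆ G.edgeSet) :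
    (edgeSubgraph G S).edgeSet = S := by
  ext s
  induction s with | _ a b =>
  exact ⟨fun h => h.1, fun h => ⟨h, hS h⟩⟩

variable [Fintype V] {R : Finset V}

omit [Fintype V] in
lemma nonempty_verts_deleteVerts (hR : G.IsIndepSet (R : Set V)) {H : G.Subgraph}
    (hH : 0 < H.edgeSet.ncard) : (H.deleteVerts (R : Set V)).verts.Nonempty := by
  obtain ⟨s, hs⟩ := Set.nonempty_of_ncard_ne_zero hH.ne'
  induction s with | _ a b =>
  have hab : H.Adj a b := hs
  by_cases ha : a ∈ R
  · refine ⟨b, hab.snd_mem, fun hb => ?_⟩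
    exact hR ha hb hab.adj_sub.ne hab.adj_sub
  · exact ⟨a, hab.fst_mem, ha⟩

lemma one_le_ncard_deleteVerts (hR : G.IsIndepSet (R : Set V)) {H : G.Subgraph}
    (hH : 0 < H.edgeSet.ncard) : 1 ≤ (H.deleteVerts (R : Set V)).verts.ncard :=
  (Set.ncard_pos (Set.toFinite _)).2 (nonempty_verts_deleteVerts hR hH)

/-- As `R` is independent, an edge of `H` has an end outside `R`, and constant weight 1/2 is
feasible. This keeps every exponent `1 / α*` at most 2. -/
lemma half_le_fracIndepNum_deleteVerts (hR : G.IsIndepSet (R : Set V)) {H : G.Subgraph}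
    (hH : 0 < H.edgeSet.ncard) :
    1 / 2 ≤ fracIndepNum (H.deleteVerts (R : Set V)).coe := by
  classical
  have h := half_card_le_fracIndepNum (H.deleteVerts (R : Set V)).coe
  have h1 := one_le_ncard_deleteVerts hR hH
  rw [← Nat.card_coe_set_eq, Nat.card_eq_fintype_card] at h1
  have h2 : (1 : ℝ) ≤ Fintype.card (H.deleteVerts (R : Set V)).verts := by exact_mod_cast h1
  refine le_trans ?_ h
  linarith

lemma fracIndepNum_deleteVerts_le (H : G.Subgraph) :
    fracIndepNum (H.deleteVerts (R : Set V)).coe ≤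
      (H.deleteVerts (R : Set V)).verts.ncard := by
  classical
  have h := fracIndepNum_le_card (H.deleteVerts (R : Set V)).coe
  rwa [← Nat.card_coe_set_eq, Nat.card_eq_fintype_card]

lemma bigM_nonneg (n : ℕ) {p : ℝ} (hp : 0 ≤ p) : 0 ≤ bigM G R n p :=
  Real.iInf_nonneg fun H => Real.rpow_nonneg (by unfold psi; positivity) _

/-- The definition of `M` with the root cleared, possible as `α* > 0`; this is the form that matches
`card_hom_le`. -/
lemma bigM_rpow_le_psi (hR : G.IsIndepSet (R : Set V)) {n : ℕ} {p : ℝ}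
    (hp : 0 ≤ p) {H : G.Subgraph} (hH : 0 < H.edgeSet.ncard) :
    bigM G R n p ^ fracIndepNum (H.deleteVerts (R : Set V)).coe ≤ psi R H n p := by
  have hα := half_le_fracIndepNum_deleteVerts hR hH
  have h0 : 0 ≤ psi R H n p := by unfold psi; positivity
  have h1 : bigM G R n p ≤
      psi R H n p ^ (1 / fracIndepNum (H.deleteVerts (R : Set V)).coe) :=
    ciInf_le (Set.finite_range _).bddBelow (⟨H, hH⟩ : {H : G.Subgraph // 0 < H.edgeSet.ncard})
  refine (Real.rpow_le_rpow (bigM_nonneg n hp) h1 (by linarith)).trans (le_of_eq ?_)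
  rw [← Real.rpow_mul h0, one_div_mul_cancel (by linarith), Real.rpow_one]

lemma exists_psi_eq_bigM_rpow (hR : G.IsIndepSet (R : Set V)) (he : 0 < numEdges G) (n : ℕ)
    {p : ℝ} (hp : 0 ≤ p) : ∃ H : G.Subgraph, 0 < H.edgeSet.ncard ∧
      psi R H n p = bigM G R n p ^ fracIndepNum (H.deleteVerts (R : Set V)).coe := by
  have : Nonempty {H : G.Subgraph // 0 < H.edgeSet.ncard} := ⟨⟨⊤, by simpa [numEdges] using he⟩⟩
  obtain ⟨H, hH⟩ := exists_eq_ciInf_of_finite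
    (f := fun H : {H : G.Subgraph // 0 < H.edgeSet.ncard} =>
      psi R H.1 n p ^ (1 / fracIndepNum (H.1.deleteVerts (R : Set V)).coe))
  have hα := half_le_fracIndepNum_deleteVerts hR H.2
  have h0 : 0 ≤ psi R H.1 n p := by unfold psi; positivity
  refine ⟨H.1, H.2, ?_⟩
  rw [bigM, ← hH, ← Real.rpow_mul h0, one_div_mul_cancel (by linarith), Real.rpow_one]

end Subgraphs

/-! ### The upper bound `exp(-c M)` -/

section Upper

variable {V : Type*} [Fintype V] {G : SimpleGraph V} {R : Finset V} {n : ℕ}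

lemma numRootEdges_le_numEdges : numRootEdges G R ≤ numEdges G :=
  Set.ncard_le_ncard (Set.sep_subset _ _) (Set.toFinite _)

/-- Each non-root vertex of the subgraph lies on an edge of `S`, so it goes to a vertex touched by
`U` even if all its neighbours are roots. Hence `card_hom_le` applies to the subgraph minus the
roots, and the remaining vertices are placed freely. -/
lemma card_rootedMaps_edges_subset_le {S : Finset (Sym2 V)}
    {U : Finset (Sym2 (Fin n))} (hU : U.Nonempty) :
    ({φ | φ ∈ rootedMaps R n ∧ ∀ s ∈ S, Sym2.map φ s ∈ U}.ncard : ℝ) *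
        (n : ℝ) ^ ((edgeSubgraph G S).deleteVerts (R : Set V)).verts.ncard ≤
      (Fintype.card V : ℝ) ^ Fintype.card V * (n : ℝ) ^ (Fintype.card V - #R) *
        (2 * #U : ℝ) ^ fracIndepNum ((edgeSubgraph G S).deleteVerts (R : Set V)).coe := by
  classical
  set H := (edgeSubgraph G S).deleteVerts (R : Set V) with hH
  set 𝒯 : Set (H.verts → Fin n) := {ψ | (∀ i, ∃ e ∈ U, ψ i ∈ e) ∧
    ∀ i j, H.coe.Adj i j → s(ψ i, ψ j) ∈ U}
  have h1 := card_filter_rootedMaps_mul_le (R := R) H.verts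
    (by simpa [hH] using Set.disjoint_sdiff_left) 𝒯
  have h2 := card_hom_le H.coe hU
  refine le_trans ?_ (h1.trans (mul_le_mul_of_nonneg_left h2 (by positivity)))
  refine mul_le_mul_of_nonneg_right ?_ (by positivity)
  refine Nat.cast_le.2 (Set.ncard_le_ncard ?_ (Set.toFinite _))
  rintro φ ⟨hφ, hφS⟩
  refine ⟨hφ, ?_, ?_⟩
  · rintro ⟨v, ⟨w, hvw, -⟩, -⟩
    exact ⟨_, hφS _ hvw, by simp⟩
  · rintro ⟨v, hv⟩ ⟨w, hw⟩ hvw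
    have h3 : H.Adj v w := hvw
    rw [hH, Subgraph.deleteVerts_adj] at h3
    exact hφS _ h3.2.2.2.2.1

/-- The ratio bound that converts `n ^ (v - r)` into the number of copies. -/
def copyConst (V : Type*) [Fintype V] : ℝ :=
  (Fintype.card V : ℝ) ^ Fintype.card V * (2 * Fintype.card V) ^ Fintype.card V

lemma copyConst_pos (hV : 0 < Fintype.card V) : 0 < copyConst V := by
  unfold copyConst
  positivity

lemma pow_le_copyConst_mul (hV : 0 < Fintype.card V) (hn : Fintype.card V ≤ n) :
    (Fintype.card V : ℝ) ^ Fintype.card V * (n : ℝ) ^ (Fintype.card V - #R) ≤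
      copyConst V * #(copies G R n) := by
  have h := pow_le_card_copies (G := G) (R := R) hV hn
  have hv1 : (1 : ℝ) ≤ 2 * Fintype.card V := by
    have : (1 : ℝ) ≤ Fintype.card V := by exact_mod_cast hV
    linarith
  unfold copyConst
  rw [mul_assoc]
  refine mul_le_mul_of_nonneg_left ?_ (by positivity)
  rw [div_pow, div_le_iff₀ (by positivity), mul_comm] at h
  refine h.trans (mul_le_mul_of_nonneg_right ?_ (by positivity))
  exact pow_le_pow_right₀ hv1 (Nat.sub_le _ _)

lemma card_copies_pos (hV : 0 < Fintype.card V) (hn : Fintype.card V ≤ n) :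
    0 < #(copies G R n) := by
  have h := pow_le_card_copies (G := G) (R := R) hV hn
  have : (0 : ℝ) < #(copies G R n) := lt_of_lt_of_le (by
    have : 0 < n := by omega
    positivity) h
  exact_mod_cast this

omit [Fintype V] in
lemma card_image_sdiff {φ : V → Fin n} (hφ : Function.Injective φ) (E : Finset (Sym2 V))
    (U : Finset (Sym2 (Fin n))) :
    #(E.image (Sym2.map φ) \ U) = #E - #(E.filter fun s => Sym2.map φ s ∈ U) := by
  classical
  have h1 : E.image (Sym2.map φ) \ U = (E.filter fun s => Sym2.map φ s ∉ U).image (Sym2.map φ) := by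
    ext s
    simp only [mem_sdiff, mem_image, mem_filter]
    constructor
    · rintro ⟨⟨s, hs, rfl⟩, h⟩
      exact ⟨s, ⟨hs, h⟩, rfl⟩
    · rintro ⟨s, ⟨hs, h⟩, rfl⟩
      exact ⟨⟨s, hs, rfl⟩, h⟩
  rw [h1, card_image_of_injective _ (Sym2.map.injective hφ)]
  have := Finset.card_filter_add_card_filter_not (s := E) (fun s => Sym2.map φ s ∈ U)
  omega

/-- Planting few edges has little effect on the expected number of copies. -/
lemma sum_copies_sdiff_le (hR : G.IsIndepSet (R : Set V)) (hV : 0 < Fintype.card V)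
    (hn : Fintype.card V ≤ n) {p : ℝ} (hp : 0 < p) {δ : ℝ} (hδ0 : 0 ≤ δ) (hδ1 : δ ≤ 1)
    {U : Finset (Sym2 (Fin n))} (hU : 2 * (#U : ℝ) ≤ δ * bigM G R n p) :
    ∑ c ∈ copies G R n, p ^ #(c.2 \ U) ≤
      #(copies G R n) * p ^ numEdges G * (1 + 2 ^ numEdges G * copyConst V * Real.sqrt δ) := by
  classical
  set e := numEdges G with he
  set N : ℝ := ((#(copies G R n) : ℕ) : ℝ)
  set M := bigM G R n p with hM
  have hM0 : 0 ≤ M := bigM_nonneg n hp.le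
  have hn0 : 0 < n := by omega
  rw [← Finset.sum_filter_add_sum_filter_not _ (fun c => Disjoint c.2 U), mul_add, mul_one]
  refine add_le_add ?_ ?_
  · calc ∑ c ∈ copies G R n with Disjoint c.2 U, p ^ #(c.2 \ U)
        = ∑ c ∈ copies G R n with Disjoint c.2 U, p ^ e := by
          refine Finset.sum_congr rfl fun c hc => ?_
          rw [mem_filter] at hc
          rw [sdiff_eq_self_of_disjoint hc.2, card_copies_snd c hc.1]
      _ ≤ ∑ c ∈ copies G R n, p ^ e :=
          Finset.sum_le_sum_of_subset_of_nonneg (filter_subset _ _) fun _ _ _ => by positivity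
      _ = N * p ^ e := by simp [N]
  · refine (sum_copies_le (g := fun A => p ^ #(A \ U)) (fun _ => by positivity)
      (fun A => ¬ Disjoint A U)).trans ?_
    rcases U.eq_empty_or_nonempty with rfl | hUne
    · simp only [disjoint_empty_right, not_true_eq_false, filter_false, Finset.sum_empty]
      have := copyConst_pos hV
      positivity
    set 𝒬 := (edges G).powerset.filter fun S => S.Nonempty with h𝒬
    have hS : ∀ S ∈ 𝒬, (∑ φ ∈ rootedMaps R n,
        if ∀ s ∈ S, Sym2.map φ s ∈ U then p ^ (e - #S) else 0) ≤
        N * p ^ e * (copyConst V * Real.sqrt δ) := by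
      intro S hS
      simp only [h𝒬, mem_filter, mem_powerset] at hS
      obtain ⟨hSG, hSne⟩ := hS
      rw [← Finset.sum_filter, Finset.sum_const, nsmul_eq_mul]
      set H := edgeSubgraph G (S : Set (Sym2 V)) with hH
      have hSset : (S : Set (Sym2 V)) ⊆ G.edgeSet := fun s hs => mem_edges.1 (hSG hs)
      have hHe : H.edgeSet.ncard = #S := by
        rw [hH, edgeSet_edgeSubgraph hSset, Set.ncard_coe_finset]
      have hHpos : 0 < H.edgeSet.ncard := by rw [hHe]; exact hSne.card_pos
      set α := fracIndepNum (H.deleteVerts (R : Set V)).coe with hα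
      have hα2 : 1 / 2 ≤ α := half_le_fracIndepNum_deleteVerts hR hHpos
      set h := (H.deleteVerts (R : Set V)).verts.ncard with hh
      have hψ : M ^ α ≤ (n : ℝ) ^ h * p ^ #S := by
        have := bigM_rpow_le_psi (n := n) hR hp.le hHpos
        rwa [psi, hHe] at this
      have hSe : #S ≤ e := by rw [he, ← card_edges]; exact card_le_card hSG
      have h1 := card_rootedMaps_edges_subset_le (G := G) (R := R) (S := S) hUne
      have h2 : (#{φ ∈ rootedMaps R n | ∀ s ∈ S, Sym2.map φ s ∈ U} : ℝ) =
          ({φ | φ ∈ rootedMaps R n ∧ ∀ s ∈ S, Sym2.map φ s ∈ U}.ncard : ℝ) := by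
        rw [← Set.ncard_coe_finset]
        simp
      rw [← h2] at h1
      set Z : ℝ := ((#{φ ∈ rootedMaps R n | ∀ s ∈ S, Sym2.map φ s ∈ U} : ℕ) : ℝ)
      -- `δ ^ α ≤ √δ` since `δ ≤ 1` and `α ≥ 1/2`, while `M ^ α ≤ Ψ_H`.
      have h3 : (2 * #U : ℝ) ^ α ≤ Real.sqrt δ * ((n : ℝ) ^ h * p ^ #S) := by
        calc (2 * #U : ℝ) ^ α ≤ (δ * M) ^ α :=
              Real.rpow_le_rpow (by positivity) hU (by linarith)
          _ = δ ^ α * M ^ α := Real.mul_rpow hδ0 hM0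
          _ ≤ Real.sqrt δ * ((n : ℝ) ^ h * p ^ #S) := by
              refine mul_le_mul ?_ hψ (Real.rpow_nonneg hM0 _) (Real.sqrt_nonneg _)
              rw [Real.sqrt_eq_rpow]
              rcases hδ0.eq_or_lt with h0 | h0
              · rw [← h0, Real.zero_rpow (by linarith), Real.zero_rpow (by norm_num)]
              · exact Real.rpow_le_rpow_of_exponent_ge h0 hδ1 hα2
      have h4 := pow_le_copyConst_mul (G := G) (R := R) hV hn
      have hnh : 0 < (n : ℝ) ^ h := by positivity
      have h5 : Z * (n : ℝ) ^ h ≤ (copyConst V * N) * (Real.sqrt δ * p ^ #S) * (n : ℝ) ^ h := by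
        calc Z * (n : ℝ) ^ h ≤ _ := h1
          _ ≤ (copyConst V * N) * (Real.sqrt δ * ((n : ℝ) ^ h * p ^ #S)) :=
              mul_le_mul h4 h3 (by positivity) (by
                have := copyConst_pos hV
                positivity)
          _ = _ := by ring
      have h6 := le_of_mul_le_mul_right h5 hnh
      calc Z * p ^ (e - #S) ≤ (copyConst V * N) * (Real.sqrt δ * p ^ #S) * p ^ (e - #S) :=
            mul_le_mul_of_nonneg_right h6 (by positivity)
        _ = copyConst V * N * Real.sqrt δ * (p ^ #S * p ^ (e - #S)) := by ring
        _ = _ := by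
            rw [← pow_add, Nat.add_sub_cancel' hSe]
            ring
    -- A map whose image meets `U` is charged to the nonempty set `S` of all edges it sends into
    -- `U`, for which the weight is exactly `p ^ (e - #S)`. There are at most `2 ^ e` such sets.
    calc _ ≤ ∑ φ ∈ rootedMaps R n, ∑ S ∈ 𝒬,
          (if ∀ s ∈ S, Sym2.map φ s ∈ U then p ^ (e - #S) else 0) := by
          rw [Finset.sum_filter]
          refine Finset.sum_le_sum fun φ hφ => ?_
          have hnn : ∀ S ∈ 𝒬, 0 ≤
              (if ∀ s ∈ S, Sym2.map φ s ∈ U then p ^ (e - #S) else 0) := by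
            intro S _
            split_ifs <;> positivity
          by_cases hd : ¬ Disjoint ((edges G).image (Sym2.map φ)) U
          · rw [if_pos hd]
            set S := (edges G).filter fun s => Sym2.map φ s ∈ U with hS'
            have hmem : S ∈ 𝒬 := by
              simp only [h𝒬, mem_filter, mem_powerset]
              refine ⟨filter_subset _ _, ?_⟩
              rw [Finset.not_disjoint_iff] at hd
              obtain ⟨a, ha, haU⟩ := hd
              obtain ⟨s, hs, rfl⟩ := mem_image.1 ha
              exact ⟨s, mem_filter.2 ⟨hs, haU⟩⟩
            refine le_trans (le_of_eq ?_) (Finset.single_le_sum hnn hmem)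
            rw [if_pos (fun s hs => (mem_filter.1 hs).2),
              card_image_sdiff (mem_rootedMaps.1 hφ).1, card_edges]
          · rw [if_neg hd]
            exact Finset.sum_nonneg hnn
      _ = ∑ S ∈ 𝒬, ∑ φ ∈ rootedMaps R n,
          (if ∀ s ∈ S, Sym2.map φ s ∈ U then p ^ (e - #S) else 0) := Finset.sum_comm
      _ ≤ ∑ S ∈ 𝒬, N * p ^ e * (copyConst V * Real.sqrt δ) := Finset.sum_le_sum hS
      _ ≤ 2 ^ e * (N * p ^ e * (copyConst V * Real.sqrt δ)) := by
          rw [Finset.sum_const, nsmul_eq_mul]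
          have := copyConst_pos hV
          refine mul_le_mul_of_nonneg_right ?_ (by positivity)
          have : #𝒬 ≤ 2 ^ e := by
            rw [he, ← card_edges, ← card_powerset]
            exact card_le_card (filter_subset _ _)
          exact_mod_cast this
      _ = _ := by ring

/-- Moment method with `k` of order `M`: all conditional means involved are at most `√t μ`, so the
tail is at most `(√t / t) ^ k = t ^ (-k / 2)`. -/
lemma exists_upperTail_le_exp_bigM (hR : G.IsIndepSet (R : Set V)) (he : 0 < numEdges G)
    (hV : 0 < Fintype.card V) {t : ℝ} (ht : 1 < t) :
    ∃ c : ℝ, 0 < c ∧ ∀ n : ℕ, Fintype.card V ≤ n → ∀ p : unitInterval, 0 < (p : ℝ) →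
      upperTail G R n p t ≤ Real.exp (-(c * bigM G R n p)) := by
  set e := numEdges G with he'
  set L : ℝ := 2 ^ e * copyConst V with hL
  have hL0 : 0 < L := mul_pos (by positivity) (copyConst_pos hV)
  have hst : 1 < Real.sqrt t := by rw [Real.lt_sqrt (by norm_num)]; linarith
  -- Chosen so that `sum_copies_sdiff_le` with `δ = η ^ 2` loses a factor `1 + L η ≤ √t`.
  set η : ℝ := min 1 ((Real.sqrt t - 1) / L) with hη
  have hη0 : 0 < η := lt_min one_pos (div_pos (by linarith) hL0)
  have hηL : 1 + L * η ≤ Real.sqrt t := by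
    have : L * η ≤ L * ((Real.sqrt t - 1) / L) :=
      mul_le_mul_of_nonneg_left (min_le_right _ _) hL0.le
    rw [mul_div_cancel₀ _ hL0.ne'] at this
    linarith
  have hlog : 0 < Real.log t := Real.log_pos ht
  have he0 : (0 : ℝ) < e := by exact_mod_cast he
  refine ⟨Real.log t / 2 * (η ^ 2 / (2 * e)), by positivity, fun n hn p hp => ?_⟩
  set M := bigM G R n p with hM
  have hM0 : 0 ≤ M := bigM_nonneg n hp.le
  -- Only `i < k` copies are planted at any stage, so `i` is at most the floor and `2 e i ≤ η ^ 2
  -- M`, whereas `k` itself exceeds the quotient.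
  set k : ℕ := ⌊η ^ 2 * M / (2 * e)⌋₊ + 1 with hk
  set N : ℝ := ((#(copies G R n) : ℕ) : ℝ) with hN
  have hN0 : 0 < N := by rw [hN]; exact_mod_cast card_copies_pos hV hn
  set μ : ℝ := N * (p : ℝ) ^ e with hμ
  have hμ0 : 0 < μ := by positivity
  have h1 := measureReal_containCount_ge_mul_pow_le (𝒞 := copies G R n) (A := Prod.snd) p
    copies_snd_subset (e := e) (fun c hc => (card_copies_snd c hc).le)
    (B := fun _ => Real.sqrt t * μ) (k := k) ?_ (a := t * μ) (by positivity)
  · rw [upperTail_eq, rootedMean_eq]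
    rw [Finset.prod_const, card_range, mul_pow t μ, mul_pow (Real.sqrt t) μ, ← mul_assoc] at h1
    have h2 := le_of_mul_le_mul_right h1 (pow_pos hμ0 k)
    have h3 : Real.sqrt t ^ k * Real.sqrt t ^ k = t ^ k := by
      rw [← mul_pow, Real.mul_self_sqrt (by linarith)]
    set P := (binomialRandom (Fin n) p).real {F | t * μ ≤ containCount (copies G R n) Prod.snd F}
    have h4 : P * Real.sqrt t ^ k ≤ 1 := by
      have hpos : 0 < Real.sqrt t ^ k := by positivity
      rw [← h3, ← mul_assoc] at h2
      refine le_of_mul_le_mul_right (a := Real.sqrt t ^ k) ?_ hpos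
      linarith
    have h5 : Real.exp (Real.log t / 2 * (η ^ 2 / (2 * e)) * M) ≤ Real.sqrt t ^ k := by
      have : Real.sqrt t = Real.exp (Real.log t / 2) := by
        rw [Real.sqrt_eq_rpow, Real.rpow_def_of_pos (by linarith)]
        congr 1
        ring
      rw [this, ← Real.exp_nat_mul, Real.exp_le_exp]
      have hfl := Nat.lt_floor_add_one (η ^ 2 * M / (2 * e))
      have : η ^ 2 * M / (2 * e) ≤ (k : ℝ) := by
        rw [hk]
        push_cast
        exact hfl.le
      calc _ = (η ^ 2 * M / (2 * e)) * (Real.log t / 2) := by ring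
        _ ≤ _ := mul_le_mul_of_nonneg_right this (by positivity)
    rw [Real.exp_neg, ← one_div, le_div_iff₀ (Real.exp_pos _)]
    exact (mul_le_mul_of_nonneg_left h5 measureReal_nonneg).trans h4
  · intro i hi U _ hU
    have hi' : (i : ℝ) ≤ η ^ 2 * M / (2 * e) := by
      have : i ≤ ⌊η ^ 2 * M / (2 * e)⌋₊ := by omega
      exact (Nat.le_floor_iff (by positivity)).1 this
    rw [le_div_iff₀ (by positivity)] at hi'
    have hU' : (#U : ℝ) ≤ e * i := by exact_mod_cast hU
    refine (sum_copies_sdiff_le hR hV hn hp (δ := η ^ 2) (by positivity)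
      (pow_le_one₀ hη0.le (min_le_left _ _)) (by linarith)).trans ?_
    rw [Real.sqrt_sq hη0.le, mul_comm]
    exact mul_le_mul_of_nonneg_right hηL hμ0.le

end Upper

/-! ### Upper bounds for `p ≥ p₁` -/

section Dense

variable {V : Type*} [Fintype V] {G : SimpleGraph V} {R : Finset V} {n : ℕ}

open Classical in
/-- The pairs in `A` that avoid the first `r` vertices. -/
def nonRootPart (r : ℕ) (A : Finset (Sym2 (Fin n))) : Finset (Sym2 (Fin n)) :=
  A.filter fun s => ∀ x ∈ s, x ∉ rootSet n r

open Classical in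
lemma nonRootPart_subset (r : ℕ) (A : Finset (Sym2 (Fin n))) : nonRootPart r A ⊆ A :=
  filter_subset _ _

open Classical in
lemma nonRootPart_image {φ : V → Fin n} (hφ : φ ∈ rootedMaps R n) (E : Finset (Sym2 V)) :
    nonRootPart #R (E.image (Sym2.map φ)) =
      (E.filter fun s => ∀ x ∈ s, x ∉ R).image (Sym2.map φ) := by
  obtain ⟨-, h2⟩ := mem_rootedMaps.1 hφ
  rw [nonRootPart, filter_image]
  congr 1
  refine filter_congr fun s _ => ?_
  simp [Sym2.mem_map, h2]

open Classical in
lemma card_edges_filter_notMem :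
    #((edges G).filter fun s => ∀ x ∈ s, x ∉ R) = numEdges G - numRootEdges G R := by
  have h1 : numRootEdges G R = #((edges G).filter fun s => ¬ ∀ x ∈ s, x ∉ R) := by
    rw [numRootEdges, ← Set.ncard_coe_finset]
    congr 1
    ext s
    simp only [coe_filter, mem_edges, Set.mem_ofPred_eq]
    refine and_congr_right fun _ => ?_
    push Not
    exact ⟨fun ⟨v, h, h'⟩ => ⟨v, h', h⟩, fun ⟨v, h, h'⟩ => ⟨v, h', h⟩⟩
  have h2 := Finset.card_filter_add_card_filter_not (s := edges G) (fun s => ∀ x ∈ s, x ∉ R)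
  rw [card_edges] at h2
  omega

lemma card_nonRootPart : ∀ c ∈ copies G R n,
    #(nonRootPart #R c.2) = numEdges G - numRootEdges G R := by
  classical
  intro c hc
  obtain ⟨φ, hφ, rfl⟩ := mem_copies.1 hc
  rw [imagePair, nonRootPart_image hφ,
    card_image_of_injective _ (Sym2.map.injective (mem_rootedMaps.1 hφ).1)]
  exact card_edges_filter_notMem

/-- Fixing the image of a non-root edge leaves two choices for its ends instead of about `n ^ 2`. -/
lemma card_rootedMaps_map_eq_le {a b : V} (hab : a ≠ b) (ha : a ∉ R) (hb : b ∉ R)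
    (u : Sym2 (Fin n)) :
    ({φ | φ ∈ rootedMaps R n ∧ s(φ a, φ b) = u}.ncard : ℝ) * (n : ℝ) ^ 2 ≤
      (Fintype.card V : ℝ) ^ Fintype.card V * (n : ℝ) ^ (Fintype.card V - #R) * 2 := by
  classical
  set Q : Set V := {a, b} with hQ
  have haQ : a ∈ Q := by simp [hQ]
  have hbQ : b ∈ Q := by simp [hQ]
  set 𝒯 : Set (Q → Fin n) := {ψ | s(ψ ⟨a, haQ⟩, ψ ⟨b, hbQ⟩) = u} with h𝒯
  have h1 := card_filter_rootedMaps_mul_le (R := R) Q (by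
    rw [Set.disjoint_left]
    rintro x (rfl | rfl)
    · exact ha
    · exact hb) 𝒯
  have h2 : 𝒯.ncard ≤ 2 := by
    have h3 := card_pairs_le ({u} : Finset (Sym2 (Fin n)))
    rw [card_singleton, mul_one, ← Set.ncard_coe_finset] at h3
    refine le_trans (Set.ncard_le_ncard_of_injOn
      (fun ψ : Q → Fin n => (ψ ⟨a, haQ⟩, ψ ⟨b, hbQ⟩)) ?_ ?_ (Set.toFinite _)) h3
    · intro ψ hψ
      simpa [h𝒯] using hψ
    · intro ψ _ ψ' _ h
      simp only [Prod.mk.injEq] at h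
      funext ⟨x, hx⟩
      rcases hx with rfl | rfl
      · exact h.1
      · exact h.2
  rw [show Q.ncard = 2 from Set.ncard_pair hab] at h1
  refine h1.trans (mul_le_mul_of_nonneg_left ?_ (by positivity))
  exact_mod_cast h2

/-- Planting few edges outside the roots has little effect on the expected number of copies of
the part of `G` outside the roots. -/
lemma sum_nonRootPart_sdiff_le (hV : 0 < Fintype.card V)
    (hn : Fintype.card V ≤ n) {p₀ p : ℝ} (hp₀ : 0 < p₀) (hp₀p : p₀ ≤ p) (hp : p ≤ 1)
    (U : Finset (Sym2 (Fin n))) :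
    ∑ c ∈ copies G R n, p ^ #(nonRootPart #R c.2 \ U) ≤
      #(copies G R n) * p ^ (numEdges G - numRootEdges G R) *
        (1 + 2 * numEdges G * copyConst V / p₀ ^ numEdges G * (#U / (n : ℝ) ^ 2)) := by
  classical
  set e := numEdges G with he
  set f := numEdges G - numRootEdges G R with hf
  set N : ℝ := ((#(copies G R n) : ℕ) : ℝ)
  have hp0 : 0 < p := hp₀.trans_le hp₀p
  have hn0 : (0 : ℝ) < n := by
    have : 0 < n := by omega
    exact_mod_cast this
  have hκ := copyConst_pos hV
  rw [← Finset.sum_filter_add_sum_filter_not _ (fun c => Disjoint (nonRootPart #R c.2) U),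
    mul_add, mul_one]
  refine add_le_add ?_ ?_
  · calc ∑ c ∈ copies G R n with Disjoint (nonRootPart #R c.2) U, p ^ #(nonRootPart #R c.2 \ U)
        = ∑ c ∈ copies G R n with Disjoint (nonRootPart #R c.2) U, p ^ f := by
          refine Finset.sum_congr rfl fun c hc => ?_
          rw [mem_filter] at hc
          rw [sdiff_eq_self_of_disjoint hc.2, card_nonRootPart c hc.1]
      _ ≤ ∑ c ∈ copies G R n, p ^ f :=
          Finset.sum_le_sum_of_subset_of_nonneg (filter_subset _ _) fun _ _ _ => by positivity
      _ = N * p ^ f := by simp [N]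
  · refine (sum_copies_le (g := fun A => p ^ #(nonRootPart #R A \ U)) (fun _ => by positivity)
      (fun A => ¬ Disjoint (nonRootPart #R A) U)).trans ?_
    set E' := (edges G).filter fun s => ∀ x ∈ s, x ∉ R with hE'
    have hbound : ∀ s ∈ E', ∀ u ∈ U,
        (∑ φ ∈ rootedMaps R n, if Sym2.map φ s = u then (1 : ℝ) else 0) ≤
          2 * copyConst V * N / (n : ℝ) ^ 2 := by
      intro s hs u _
      rw [hE', mem_filter, mem_edges] at hs
      obtain ⟨hs, hsR⟩ := hs
      induction s with | _ a b =>
      have h1 := card_rootedMaps_map_eq_le (n := n) (R := R) (G.ne_of_adj hs)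
        (hsR a (by simp)) (hsR b (by simp)) u
      have h2 := pow_le_copyConst_mul (G := G) (R := R) hV hn
      rw [← Finset.sum_filter, Finset.sum_const, nsmul_eq_mul, mul_one,
        le_div_iff₀ (by positivity)]
      have h3 : (#{φ ∈ rootedMaps R n | Sym2.map φ s(a, b) = u} : ℝ) =
          ({φ | φ ∈ rootedMaps R n ∧ s(φ a, φ b) = u}.ncard : ℝ) := by
        rw [← Set.ncard_coe_finset]
        congr 2
        ext φ
        rw [Finset.mem_coe, Finset.mem_filter]
        rfl
      rw [h3]
      linarith
    -- Union bound over which edge `s` is sent to which `u ∈ U`; the weight of such a copy is simply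
    -- bounded by 1.
    calc _ ≤ ∑ φ ∈ rootedMaps R n, ∑ s ∈ E', ∑ u ∈ U,
          (if Sym2.map φ s = u then (1 : ℝ) else 0) := by
          rw [Finset.sum_filter]
          refine Finset.sum_le_sum fun φ hφ => ?_
          have hnn : ∀ s ∈ E', 0 ≤ ∑ u ∈ U, (if Sym2.map φ s = u then (1 : ℝ) else 0) :=
            fun s _ => Finset.sum_nonneg fun u _ => by split_ifs <;> norm_num
          by_cases hd : ¬ Disjoint (nonRootPart #R ((edges G).image (Sym2.map φ))) U
          · rw [if_pos hd]
            rw [nonRootPart_image hφ, Finset.not_disjoint_iff] at hd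
            obtain ⟨a, ha, haU⟩ := hd
            obtain ⟨s, hs, rfl⟩ := mem_image.1 ha
            refine le_trans ?_ (Finset.single_le_sum hnn hs)
            simp only [Finset.sum_ite_eq, haU, if_true]
            exact pow_le_one₀ hp0.le hp
          · rw [if_neg hd]
            exact Finset.sum_nonneg hnn
      _ = ∑ s ∈ E', ∑ u ∈ U, ∑ φ ∈ rootedMaps R n,
          (if Sym2.map φ s = u then (1 : ℝ) else 0) := by
          rw [Finset.sum_comm]
          exact Finset.sum_congr rfl fun s _ => Finset.sum_comm
      _ ≤ ∑ s ∈ E', ∑ u ∈ U, 2 * copyConst V * N / (n : ℝ) ^ 2 :=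
          Finset.sum_le_sum fun s hs => Finset.sum_le_sum fun u hu => hbound s hs u hu
      _ = #E' * (#U * (2 * copyConst V * N / (n : ℝ) ^ 2)) := by simp
      _ ≤ e * (#U * (2 * copyConst V * N / (n : ℝ) ^ 2)) := by
          refine mul_le_mul_of_nonneg_right ?_ (by positivity)
          rw [he, ← card_edges]
          exact_mod_cast card_le_card (filter_subset _ _)
      -- As `p ≥ p₀`, replacing the weight by 1 costs only the constant `p₀ ^ (-e)`.
      _ = N * p₀ ^ e * (2 * e * copyConst V / p₀ ^ e * (#U / (n : ℝ) ^ 2)) := by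
          field_simp
      _ ≤ N * p ^ f * (2 * e * copyConst V / p₀ ^ e * (#U / (n : ℝ) ^ 2)) := by
          refine mul_le_mul_of_nonneg_right (mul_le_mul_of_nonneg_left ?_ (by positivity))
            (by positivity)
          calc p₀ ^ e ≤ p ^ e := pow_le_pow_left₀ hp₀.le hp₀p e
            _ ≤ p ^ f := pow_le_pow_of_le_one hp0.le hp (Nat.sub_le _ _)

lemma containInd_anti {W : Type*} {U T : Finset (Sym2 W)} (h : U ⊆ T) (F : SimpleGraph W) :
    containInd T F ≤ containInd U F := by
  unfold containInd
  split_ifs with h1 h2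
  · exact le_rfl
  · exact absurd ((Finset.coe_subset.2 h).trans h1) h2
  · norm_num
  · exact le_rfl

omit [Fintype V] in
lemma pOne_pos {t : ℝ} (ht : 1 < t) : 0 < pOne G R t := Real.rpow_pos_of_pos (by linarith) _

omit [Fintype V] in
lemma pTwo_pos {t : ℝ} (ht : 1 < t) : 0 < pTwo G t := Real.rpow_pos_of_pos (by linarith) _

omit [Fintype V] in
lemma pOne_lt_one {t : ℝ} (ht : 1 < t) (heR : 0 < numRootEdges G R) : pOne G R t < 1 := by
  have : (0 : ℝ) < numRootEdges G R := by exact_mod_cast heR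
  exact Real.rpow_lt_one_of_one_lt_of_neg ht (div_neg_of_neg_of_pos (by norm_num) this)

omit [Fintype V] in
lemma pTwo_lt_one {t : ℝ} (ht : 1 < t) (he : 0 < numEdges G) : pTwo G t < 1 := by
  have : (0 : ℝ) < numEdges G := by exact_mod_cast he
  exact Real.rpow_lt_one_of_one_lt_of_neg ht (div_neg_of_neg_of_pos (by norm_num) this)

omit [Fintype V] in
lemma mul_pOne_pow {t : ℝ} (ht : 1 < t) (heR : 0 < numRootEdges G R) :
    t * pOne G R t ^ numRootEdges G R = 1 := by
  have h : (numRootEdges G R : ℝ) ≠ 0 := by exact_mod_cast heR.ne'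
  rw [pOne, ← Real.rpow_natCast, ← Real.rpow_mul (by linarith), div_mul_cancel₀ _ h,
    Real.rpow_neg_one, mul_inv_cancel₀ (by linarith)]

omit [Fintype V] in
lemma mul_pTwo_pow {t : ℝ} (ht : 1 < t) (he : 0 < numEdges G) :
    t * pTwo G t ^ numEdges G = 1 := by
  have h : (numEdges G : ℝ) ≠ 0 := by exact_mod_cast he.ne'
  rw [pTwo, ← Real.rpow_natCast, ← Real.rpow_mul (by linarith), div_mul_cancel₀ _ h,
    Real.rpow_neg_one, mul_inv_cancel₀ (by linarith)]

/-- Each copy contains a copy of its non-root part, so `X` is at most the count of non-root parts,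
whose mean is `N p ^ (e - e_R)`. Since `t μ` is `(p / p₁) ^ e_R ≥ 1 + δ` times this mean, with `δ =
p - p₁`, the moment method applies to that count. -/
lemma exists_upperTail_le_exp_sq (hV : 0 < Fintype.card V)
    (heR : 0 < numRootEdges G R) {t : ℝ} (ht : 1 < t) :
    ∃ c : ℝ, 0 < c ∧ ∀ n : ℕ, Fintype.card V ≤ n → ∀ p : unitInterval, pOne G R t ≤ p →
      upperTail G R n p t ≤ Real.exp (1 / 4 - c * (((p : ℝ) - pOne G R t) ^ 2 * (n : ℝ) ^ 2)) := by
  set e := numEdges G with he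
  set eR := numRootEdges G R with heR'
  set p₁ := pOne G R t with hp₁
  have hp₁0 : 0 < p₁ := pOne_pos ht
  have hp₁1 : p₁ < 1 := pOne_lt_one ht heR
  have heRe : eR ≤ e := numRootEdges_le_numEdges
  have he0 : (0 : ℝ) < e := by exact_mod_cast heR.trans_le heRe
  set f := e - eR with hf
  set C : ℝ := 2 * e * copyConst V / p₁ ^ e * e with hC
  have hC0 : 0 < C := by
    have := copyConst_pos hV
    positivity
  refine ⟨1 / (16 * C), by positivity, fun n hn p hp => ?_⟩
  have hp0 : 0 < (p : ℝ) := hp₁0.trans_le hp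
  have hn0 : (0 : ℝ) < n := by
    have : 0 < n := by omega
    exact_mod_cast this
  set δ := (p : ℝ) - p₁ with hδ
  have hδ0 : 0 ≤ δ := by linarith
  have hδ1 : δ ≤ 1 := by have := p.2.2; linarith
  -- Planting `k` copies raises the mean by a factor `exp(C k / n²) ≤ exp(δ / 4)`, against the
  -- required `exp(δ / 2)`; the gain is `exp(-k δ / 4)`. Rounding down, possibly to `k = 0`, costs
  -- `δ / 4 ≤ 1 / 4` in the exponent.
  set k : ℕ := ⌊δ * (n : ℝ) ^ 2 / (4 * C)⌋₊ with hk
  have hk1 : (k : ℝ) ≤ δ * (n : ℝ) ^ 2 / (4 * C) := Nat.floor_le (by positivity)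
  have hk2 : δ * (n : ℝ) ^ 2 / (4 * C) < k + 1 := Nat.lt_floor_add_one _
  set N : ℝ := ((#(copies G R n) : ℕ) : ℝ) with hN
  have hN0 : 0 < N := by rw [hN]; exact_mod_cast card_copies_pos hV hn
  set μ : ℝ := N * (p : ℝ) ^ f with hμ
  have hμ0 : 0 < μ := by positivity
  set a : ℝ := t * (N * (p : ℝ) ^ e) with ha
  have h1 := measureReal_containCount_ge_mul_pow_le (𝒞 := copies G R n)
    (A := fun c => nonRootPart #R c.2) p
    (fun c hc => (nonRootPart_subset _ _).trans (copies_snd_subset c hc)) (e := e)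
    (fun c hc => (card_nonRootPart c hc).le.trans (Nat.sub_le _ _))
    (B := fun _ => μ * Real.exp (C * k / (n : ℝ) ^ 2)) (k := k) ?_ (a := a) (by positivity)
  · have h2 : upperTail G R n p t ≤ (binomialRandom (Fin n) p).real
        {F | a ≤ containCount (copies G R n) (fun c => nonRootPart #R c.2) F} := by
      rw [upperTail_eq, rootedMean_eq]
      refine measureReal_mono fun F hF => ?_
      exact le_trans hF (Finset.sum_le_sum fun c _ =>
        containInd_anti (nonRootPart_subset _ _) F)
    set P := (binomialRandom (Fin n) p).real
        {F | a ≤ containCount (copies G R n) (fun c => nonRootPart #R c.2) F}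
    have h3 : μ * Real.exp (δ / 2) ≤ a := by
      have h4 : (p : ℝ) ^ e = (p : ℝ) ^ f * (p : ℝ) ^ eR := by
        rw [← pow_add, hf, Nat.sub_add_cancel heRe]
      have h5 : 1 + δ ≤ t * (p : ℝ) ^ eR := by
        have h6 : t * (p : ℝ) ^ eR = (p / p₁) ^ eR := by
          have h7 := mul_pOne_pow ht heR
          rw [div_pow, eq_div_iff (by positivity), mul_right_comm]
          exact (congrArg (· * (p : ℝ) ^ eR) h7).trans (one_mul _)
        have h8 : 1 + δ ≤ p / p₁ := by
          rw [le_div_iff₀ hp₁0]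
          nlinarith
        rw [h6]
        exact h8.trans (le_self_pow₀ (by linarith) heR.ne')
      have h6 : Real.exp (δ / 2) ≤ 1 + δ := by
        have h7 := Real.add_one_le_exp (-(δ / 2))
        have h8 : Real.exp (δ / 2) * Real.exp (-(δ / 2)) = 1 := by
          rw [← Real.exp_add]; simp
        have h9 := Real.exp_pos (δ / 2)
        nlinarith [mul_le_mul_of_nonneg_left h7 h9.le]
      calc μ * Real.exp (δ / 2) ≤ μ * (t * (p : ℝ) ^ eR) :=
            mul_le_mul_of_nonneg_left (h6.trans h5) hμ0.le
        _ = a := by rw [ha, h4, hμ]; ring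
    have h4 : P * Real.exp (δ / 2) ^ k ≤ Real.exp (C * k / (n : ℝ) ^ 2) ^ k := by
      rw [Finset.prod_const, card_range, mul_pow μ] at h1
      have h5 : P * (μ ^ k * Real.exp (δ / 2) ^ k) ≤ μ ^ k *
          Real.exp (C * k / (n : ℝ) ^ 2) ^ k := by
        refine le_trans (mul_le_mul_of_nonneg_left ?_ measureReal_nonneg) h1
        rw [← mul_pow]
        exact pow_le_pow_left₀ (by positivity) h3 k
      refine le_of_mul_le_mul_left (a := μ ^ k) ?_ (by positivity)
      linarith
    refine h2.trans ?_
    rw [← Real.exp_nat_mul, ← Real.exp_nat_mul, ← le_div_iff₀ (Real.exp_pos _),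
      ← Real.exp_sub] at h4
    refine h4.trans (Real.exp_le_exp.2 ?_)
    have h5 : C * k / (n : ℝ) ^ 2 ≤ δ / 4 := by
      rw [div_le_iff₀ (by positivity)]
      rw [le_div_iff₀ (by positivity)] at hk1
      linarith
    have h6 : (k : ℝ) * (C * k / (n : ℝ) ^ 2) ≤ k * (δ / 4) :=
      mul_le_mul_of_nonneg_left h5 (Nat.cast_nonneg _)
    have h7 : δ / 4 * (δ * (n : ℝ) ^ 2 / (4 * C)) ≤ δ / 4 * (k + 1) :=
      mul_le_mul_of_nonneg_left hk2.le (by positivity)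
    have h8 : δ / 4 * (δ * (n : ℝ) ^ 2 / (4 * C)) = 1 / (16 * C) * (δ ^ 2 * (n : ℝ) ^ 2) := by
      field_simp
      ring
    linarith
  · intro i hi U _ hU
    refine (sum_nonRootPart_sdiff_le hV hn hp₁0 hp p.2.2 U).trans ?_
    refine mul_le_mul_of_nonneg_left ?_ hμ0.le
    refine le_trans ?_ (Real.add_one_le_exp _)
    rw [add_comm]
    refine add_le_add ?_ le_rfl
    have hU' : (#U : ℝ) ≤ e * k := by
      have : #U ≤ e * k := hU.trans (Nat.mul_le_mul_left _ hi.le)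
      exact_mod_cast this
    have hκ := copyConst_pos hV
    calc 2 * e * copyConst V / p₁ ^ e * (#U / (n : ℝ) ^ 2)
        ≤ 2 * e * copyConst V / p₁ ^ e * ((e * k) / (n : ℝ) ^ 2) := by gcongr
      _ = C * k / (n : ℝ) ^ 2 := by rw [hC]; ring

/-- `α* ≤ v(H - R)` gives `n ^ (v(H - R) / α*) ≥ n`, and `1 / α* ≤ 2` bounds the power of `p`. So
`M` is at least of order `n` for dense `p`. -/
lemma mul_le_bigM (hR : G.IsIndepSet (R : Set V)) (he : 0 < numEdges G) (hn : 0 < n)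
    {p₀ p : ℝ} (hp₀ : 0 < p₀) (hp₀p : p₀ ≤ p) (hp : p ≤ 1) :
    p₀ ^ (2 * numEdges G) * n ≤ bigM G R n p := by
  have : Nonempty {H : G.Subgraph // 0 < H.edgeSet.ncard} := ⟨⟨⊤, by simpa [numEdges] using he⟩⟩
  refine le_ciInf fun ⟨H, hH⟩ => ?_
  have hα := half_le_fracIndepNum_deleteVerts hR hH
  have hαh := fracIndepNum_deleteVerts_le (R := R) H
  set α := fracIndepNum (H.deleteVerts (R : Set V)).coe
  have hα0 : 0 < α := by linarith
  have hn1 : (1 : ℝ) ≤ n := by exact_mod_cast hn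
  have hHe : H.edgeSet.ncard ≤ numEdges G :=
    Set.ncard_le_ncard H.edgeSet_subset (Set.toFinite _)
  rw [psi, Real.mul_rpow (by positivity) (by have := hp₀.trans_le hp₀p; positivity), mul_comm]
  refine mul_le_mul ?_ ?_ (by positivity) (by positivity)
  · rw [← Real.rpow_natCast, ← Real.rpow_mul (by positivity)]
    conv_lhs => rw [← Real.rpow_one (n : ℝ)]
    refine Real.rpow_le_rpow_of_exponent_le hn1 ?_
    rw [mul_one_div, le_div_iff₀ hα0, one_mul]
    exact hαh
  · calc p₀ ^ (2 * numEdges G) = (p₀ ^ numEdges G) ^ (2 : ℝ) := by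
          rw [pow_mul', Real.rpow_ofNat]
      _ ≤ (p₀ ^ numEdges G) ^ (1 / α) := by
          refine Real.rpow_le_rpow_of_exponent_ge (by positivity)
            (pow_le_one₀ hp₀.le (hp₀p.trans hp)) ?_
          rw [div_le_iff₀ hα0]
          linarith
      _ ≤ (p ^ H.edgeSet.ncard) ^ (1 / α) := by
          refine Real.rpow_le_rpow (by positivity) ?_ (by positivity)
          calc p₀ ^ numEdges G ≤ p ^ numEdges G := pow_le_pow_left₀ hp₀.le hp₀p _
            _ ≤ _ := pow_le_pow_of_le_one (hp₀.le.trans hp₀p) hp hHe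

end Dense

/-! ### Lower bounds by planting -/

section Lower

variable {V : Type*} [Fintype V] {G : SimpleGraph V} {R : Finset V} {n : ℕ}

lemma pow_card_le_measureReal {W : Type*} [Fintype W] [DecidableEq W] (p : unitInterval)
    {U : Finset (Sym2 W)} (hU : U ⊆ offDiagPairs W) {S : Set (SimpleGraph W)}
    (hS : ∀ F : SimpleGraph W, (U : Set (Sym2 W)) ⊆ F.edgeSet → F ∈ S) :
    (p : ℝ) ^ #U ≤ (binomialRandom W p).real S := by
  rw [← integral_containInd p hU, ← integral_indicator_one S.toFinite.measurableSet]
  refine integral_mono Integrable.of_finite Integrable.of_finite fun F => ?_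
  by_cases h : (U : Set (Sym2 W)) ⊆ F.edgeSet
  · simp [containInd, h, hS F h]
  · simp only [containInd, h, if_false]
    exact Set.indicator_nonneg (fun _ _ => zero_le_one) _

lemma mul_rootedMean_le {t : ℝ} (ht : 1 < t) (he : 0 < numEdges G) {p : unitInterval}
    (hp : (p : ℝ) ≤ pTwo G t) : t * rootedMean G R n p ≤ #(copies G R n) := by
  have h1 : (p : ℝ) ^ numEdges G ≤ pTwo G t ^ numEdges G := pow_le_pow_left₀ p.2.1 hp _
  have h2 := mul_pTwo_pow ht he
  have h3 : t * (p : ℝ) ^ numEdges G ≤ 1 := by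
    rw [← h2]
    exact mul_le_mul_of_nonneg_left h1 (by linarith)
  rw [rootedMean_eq]
  calc _ = (#(copies G R n) : ℝ) * (t * (p : ℝ) ^ numEdges G) := by ring
    _ ≤ #(copies G R n) * 1 := mul_le_mul_of_nonneg_left h3 (Nat.cast_nonneg _)
    _ = _ := mul_one _

/-- Once every copy is present, `X = N`, and `N ≥ t μ` for `p ≤ p₂`. -/
lemma pow_card_le_upperTail {t : ℝ} (ht : 1 < t) (he : 0 < numEdges G) {p : unitInterval}
    (hp : (p : ℝ) ≤ pTwo G t) {U : Finset (Sym2 (Fin n))} (hU : U ⊆ offDiagPairs (Fin n))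
    (hcU : ∀ c ∈ copies G R n, c.2 ⊆ U) : (p : ℝ) ^ #U ≤ upperTail G R n p t := by
  rw [upperTail_eq]
  refine pow_card_le_measureReal p hU fun F hF => ?_
  have h : containCount (copies G R n) Prod.snd F = #(copies G R n) := by
    unfold containCount
    rw [Finset.sum_congr rfl (g := fun _ => (1 : ℝ))]
    · simp
    · intro c hc
      exact if_pos ((Finset.coe_subset.2 (hcU c hc)).trans hF)
  rw [Set.mem_ofPred_eq, h]
  exact mul_rootedMean_le ht he hp

lemma pow_sq_le_upperTail {t : ℝ} (ht : 1 < t) (he : 0 < numEdges G) {p : unitInterval}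
    (hp : (p : ℝ) ≤ pTwo G t) : (p : ℝ) ^ n ^ 2 ≤ upperTail G R n p t := by
  refine le_trans ?_ (pow_card_le_upperTail ht he hp le_rfl copies_snd_subset)
  refine pow_le_pow_of_le_one p.2.1 p.2.2 ?_
  rw [card_offDiagPairs, Fintype.card_fin]
  exact Nat.choose_le_pow n 2

/-- The edges that join the vertices of `H` along the blocks `β u i`, `i < a u`. -/
def blowUp (H : G.Subgraph) (β : V → ℕ → Fin n) (a : V → ℕ) : Finset (Sym2 (Fin n)) := by
  classical
  exact (univ.filter fun z : V × V => H.Adj z.1 z.2).biUnion fun z =>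
    (range (a z.1) ×ˢ range (a z.2)).image fun w => s(β z.1 w.1, β z.2 w.2)

lemma mem_blowUp {H : G.Subgraph} {β : V → ℕ → Fin n} {a : V → ℕ} {s : Sym2 (Fin n)} :
    s ∈ blowUp H β a ↔ ∃ u v, H.Adj u v ∧ ∃ i < a u, ∃ j < a v, s(β u i, β v j) = s := by
  classical
  simp only [blowUp, mem_biUnion, mem_filter, mem_univ, true_and, mem_image, mem_product,
    Finset.mem_range, Prod.exists]
  constructor
  · rintro ⟨u, v, h, i, j, ⟨hi, hj⟩, rfl⟩
    exact ⟨u, v, h, i, hi, j, hj, rfl⟩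
  · rintro ⟨u, v, h, i, hi, j, hj, rfl⟩
    exact ⟨u, v, h, i, j, ⟨hi, hj⟩, rfl⟩

lemma card_blowUp_le {H : G.Subgraph} {β : V → ℕ → Fin n} {a : V → ℕ} {B : ℝ} (hB : 0 ≤ B)
    (ha : ∀ u v, H.Adj u v → (a u : ℝ) * a v ≤ B) :
    (#(blowUp H β a) : ℝ) ≤ (Fintype.card V : ℝ) ^ 2 * B := by
  classical
  have h1 : (#(blowUp H β a) : ℝ) ≤
      ∑ z ∈ univ.filter (fun z : V × V => H.Adj z.1 z.2), (a z.1 : ℝ) * a z.2 := by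
    unfold blowUp
    refine (Nat.cast_le.2 card_biUnion_le).trans ?_
    push_cast
    refine Finset.sum_le_sum fun z _ => ?_
    have := card_image_le (s := range (a z.1) ×ˢ range (a z.2))
      (f := fun w => s(β z.1 w.1, β z.2 w.2))
    rw [card_product, card_range, card_range] at this
    exact_mod_cast this
  refine h1.trans ((Finset.sum_le_card_nsmul _ _ B fun z hz => ha _ _ (mem_filter.1 hz).2).trans ?_)
  rw [nsmul_eq_mul]
  refine mul_le_mul_of_nonneg_right ?_ hB
  have : #(univ.filter fun z : V × V => H.Adj z.1 z.2) ≤ Fintype.card V ^ 2 := by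
    refine (card_filter_le _ _).trans ?_
    rw [card_univ, Fintype.card_prod, sq]
  exact_mod_cast this

lemma prod_blockSizes (Q : Set V) (hQ : Disjoint Q (R : Set V)) (x : Q → ℝ) (L m z : ℝ)
    (hm : 0 < m) [DecidablePred (· ∈ Q)] [DecidableEq V] :
    ∏ u : V, (if u ∈ R then 1 else if h : u ∈ Q then L * m ^ x ⟨u, h⟩ else z) =
      L ^ Q.ncard * m ^ (∑ u, x u) * z ^ (Fintype.card V - #R - Q.ncard) := by
  classical
  have h1 : ∀ u : V, (if u ∈ R then 1 else if h : u ∈ Q then L * m ^ x ⟨u, h⟩ else z) =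
      (if h : u ∈ Q then L * m ^ x ⟨u, h⟩ else 1) * (if u ∉ R ∧ u ∉ Q then z else 1) := by
    intro u
    by_cases hu : u ∈ Q
    · have : u ∉ R := fun h => Set.disjoint_left.1 hQ hu h
      simp [hu, this]
    · by_cases hR : u ∈ R <;> simp [hu, hR]
  simp_rw [h1]
  rw [Finset.prod_mul_distrib]
  congr 1
  · have h2 : ∏ u : V, (if h : u ∈ Q then L * m ^ x ⟨u, h⟩ else 1) =
        ∏ u : Q, L * m ^ x u := by
      rw [Finset.prod_dite]
      simp only [Finset.prod_const_one, mul_one]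
      refine Finset.prod_bij (fun u _ => (⟨u.1, (mem_filter.1 u.2).2⟩ : Q)) ?_ ?_ ?_ ?_
      · simp
      · intro a _ b _ h
        exact Subtype.ext (congrArg (fun q : Q => (q : V)) h)
      · intro b _
        exact ⟨⟨b.1, mem_filter.2 ⟨mem_univ _, b.2⟩⟩, mem_attach _ _, rfl⟩
      · simp
    rw [h2, Finset.prod_mul_distrib, Finset.prod_const, Real.rpow_sum_of_pos hm, card_univ,
      ← Nat.card_coe_set_eq, Nat.card_eq_fintype_card]
  · rw [Finset.prod_ite]
    simp only [Finset.prod_const, one_pow, mul_one]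
    congr 1
    have h2 : Q.ncard = #(Q.toFinite.toFinset) := Set.ncard_eq_toFinset_card _ _
    have h3 : Fintype.card V - #R = #(Rᶜ) := (card_compl R).symm
    have h4 : Q.toFinite.toFinset ⊆ Rᶜ := by
      intro u hu
      simp only [Set.Finite.mem_toFinset] at hu
      simpa using fun h => Set.disjoint_left.1 hQ hu h
    rw [h2, h3, ← card_sdiff_of_subset h4]
    congr 1
    ext u
    simp

set_option maxHeartbeats 1000000 in
/-- The lower bound obtained by planting many copies of a subgraph `H`. -/
lemma exists_rpow_le_upperTail (hR : G.IsIndepSet (R : Set V)) (hV : 0 < Fintype.card V)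
    {t : ℝ} (ht : 1 < t) :
    ∃ K : ℝ, 0 < K ∧ ∃ C : ℝ, 0 < C ∧ ∀ n : ℕ, Fintype.card V ≤ n → ∀ p : unitInterval,
      0 < (p : ℝ) → ∀ H : G.Subgraph, 0 < H.edgeSet.ncard → ∀ m : ℝ, 1 ≤ m →
      psi R H n p ≤ m ^ fracIndepNum (H.deleteVerts (R : Set V)).coe → K * m ≤ n →
      (p : ℝ) ^ (C * m) ≤ upperTail G R n p t := by
  classical
  set v := Fintype.card V with hv
  set e := numEdges G with he
  set r := #R with hr
  have hv1 : (1 : ℝ) ≤ v := by exact_mod_cast hV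
  -- The oversizing factor of the blocks, making the planted mean at least `2 t μ`. A single factor
  -- `L` suffices, and `H - R` has at least one vertex to supply it.
  set L : ℝ := 2 * t * copyConst V with hL
  have hL1 : 1 ≤ L := by
    have h1 : (1 : ℝ) ≤ copyConst V := by
      unfold copyConst
      exact one_le_mul_of_one_le_of_one_le (one_le_pow₀ hv1) (one_le_pow₀ (by linarith))
    nlinarith
  have hL0 : 0 < L := by linarith
  -- `K m ≤ n` means `2 L m ≤ n / (2 v)`, so that all blocks fit. In the exponent, `e` pays for the
  -- conditional probability `p ^ e` and the other term bounds the number of planted edges per unit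
  -- of `m`.
  refine ⟨4 * L * v, by positivity, e + v ^ 2 * (4 * L ^ 2), by positivity, ?_⟩
  intro n hn p hp H hH m hm hψ hK
  have hn0 : 0 < n := by omega
  have hn0' : (0 : ℝ) < n := by exact_mod_cast hn0
  have hm0 : 0 < m := by linarith
  set Q := (H.deleteVerts (R : Set V)).verts with hQ
  have hQR : Disjoint Q (R : Set V) := Set.disjoint_sdiff_left
  have hh1 : 1 ≤ Q.ncard := one_le_ncard_deleteVerts hR hH
  obtain ⟨x, hx01, hxadj, hxsum⟩ :=
    exists_sum_eq_fracIndepNum (H.deleteVerts (R : Set V)).coe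
  set α := fracIndepNum (H.deleteVerts (R : Set V)).coe with hα
  obtain ⟨β, hβ1, hβ2, hβ3⟩ := exists_blocks R hn0
  -- Clone numbers: one for a root, about `L m ^ x u` for the other vertices of `H`, and a whole
  -- block for vertices outside `H`, which are not planted.
  set a : V → ℕ := fun u => if u ∈ R then 1 else
    if h : u ∈ Q then ⌈L * m ^ x ⟨u, h⟩⌉₊ else n / v with ha
  have hdiv : (n : ℝ) / (2 * v) ≤ ((n / v : ℕ) : ℝ) := div_le_cast_natDiv hV hn
  have hdiv1 : 1 ≤ n / v := (Nat.one_le_div_iff hV).2 hn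
  have hceil : ∀ u : Q, (⌈L * m ^ x u⌉₊ : ℝ) ≤ 2 * L * m ^ x u := by
    intro u
    have h1 : 1 ≤ L * m ^ x u :=
      one_le_mul_of_one_le_of_one_le hL1 (Real.one_le_rpow hm (hx01 u).1)
    have h2 := Nat.ceil_lt_add_one (a := L * m ^ x u) (by positivity)
    linarith
  have hxm : ∀ u : Q, m ^ x u ≤ m := by
    intro u
    conv_rhs => rw [← Real.rpow_one m]
    exact Real.rpow_le_rpow_of_exponent_le hm (hx01 u).2
  have haR : ∀ u ∈ R, a u = 1 := fun u hu => by simp [ha, hu]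
  have haQ : ∀ u : Q, a u = ⌈L * m ^ x u⌉₊ := by
    intro u
    have h1 : (u : V) ∉ R := fun h => Set.disjoint_left.1 hQR u.2 h
    simp [ha, h1, u.2]
  have hle : ∀ u, a u ≤ n / v := by
    intro u
    by_cases hu : u ∈ R
    · rw [haR u hu]; exact hdiv1
    by_cases huQ : u ∈ Q
    · rw [haQ ⟨u, huQ⟩]
      have h1 := hceil ⟨u, huQ⟩
      have h2 : 2 * L * m ^ x ⟨u, huQ⟩ ≤ 2 * L * m :=
        mul_le_mul_of_nonneg_left (hxm _) (by positivity)
      have h3 : 2 * L * m ≤ n / (2 * v) := by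
        rw [le_div_iff₀ (by positivity)]
        linarith
      exact_mod_cast (h1.trans (h2.trans (h3.trans hdiv)))
    · simp [ha, hu, huQ]
  have haadj : ∀ u w, H.Adj u w → (a u : ℝ) * a w ≤ 4 * L ^ 2 * m := by
    -- At a root edge `x ≤ 1` bounds the number of planted pairs; at other edges `x u + x w ≤ 1`
    -- does.
    have hone : ∀ u w, H.Adj u w → u ∈ R → (a u : ℝ) * a w ≤ 4 * L ^ 2 * m := by
      intro u w huw hu
      have hw : w ∉ R := fun hw => hR hu hw huw.adj_sub.ne huw.adj_sub
      have hwQ : w ∈ Q := ⟨huw.snd_mem, hw⟩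
      rw [haR u hu, haQ ⟨w, hwQ⟩, Nat.cast_one, one_mul]
      refine (hceil _).trans ?_
      have := hxm ⟨w, hwQ⟩
      calc 2 * L * m ^ x ⟨w, hwQ⟩ ≤ 2 * L * m := mul_le_mul_of_nonneg_left this (by positivity)
        _ ≤ 4 * L ^ 2 * m := mul_le_mul_of_nonneg_right (by nlinarith) hm0.le
    intro u w huw
    by_cases hu : u ∈ R
    · exact hone u w huw hu
    by_cases hw : w ∈ R
    · rw [mul_comm]; exact hone w u huw.symm hw
    have huQ : u ∈ Q := ⟨huw.fst_mem, hu⟩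
    have hwQ : w ∈ Q := ⟨huw.snd_mem, hw⟩
    rw [haQ ⟨u, huQ⟩, haQ ⟨w, hwQ⟩]
    have hadj : (H.deleteVerts (R : Set V)).coe.Adj ⟨u, huQ⟩ ⟨w, hwQ⟩ := by
      rw [Subgraph.coe_adj, Subgraph.deleteVerts_adj]
      exact ⟨huw.fst_mem, hu, huw.snd_mem, hw, huw⟩
    calc _ ≤ (2 * L * m ^ x ⟨u, huQ⟩) * (2 * L * m ^ x ⟨w, hwQ⟩) :=
          mul_le_mul (hceil _) (hceil _) (by positivity) (by positivity)
      _ = 4 * L ^ 2 * m ^ (x ⟨u, huQ⟩ + x ⟨w, hwQ⟩) := by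
          rw [Real.rpow_add hm0]; ring
      _ ≤ 4 * L ^ 2 * m ^ (1 : ℝ) := mul_le_mul_of_nonneg_left
          (Real.rpow_le_rpow_of_exponent_le hm (hxadj _ _ hadj)) (by positivity)
      _ = _ := by rw [Real.rpow_one]
  set U := blowUp H β a with hU
  have hUoff : U ⊆ offDiagPairs (Fin n) := by
    intro s hs
    obtain ⟨u, w, huw, i, hi, j, hj, rfl⟩ := mem_blowUp.1 hs
    simp only [offDiagPairs, mem_filter, mem_univ, true_and, Sym2.mk_isDiag_iff]
    exact fun h => huw.adj_sub.ne
      (hβ1 u w i j (hi.trans_le (hle u)) (hj.trans_le (hle w)) h).1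
  have hUcard : (#U : ℝ) ≤ v ^ 2 * (4 * L ^ 2 * m) := card_blowUp_le (by positivity) haadj
  have hHe : H.edgeSet.ncard ≤ e := Set.ncard_le_ncard H.edgeSet_subset (Set.toFinite _)
  set eH := H.edgeSet.ncard with heH
  set N : ℝ := ((#(copies G R n) : ℕ) : ℝ) with hN
  have hN0 : 0 < N := by rw [hN]; exact_mod_cast card_copies_pos hV hn
  -- the expected number of copies after planting
  have hsum : L * (p : ℝ) ^ (#U + e) * (n : ℝ) ^ (v - r) / (2 * v) ^ v ≤
      ∑ c ∈ copies G R n, (p : ℝ) ^ #(c.2 ∪ U) := by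
    have h1 := sum_piFinset_le_sum_copies (G := G) hβ1 hβ2 hβ3 hle haR
      (g := fun A => (p : ℝ) ^ #(A ∪ U)) (fun A => pow_nonneg hp.le _)
    refine le_trans ?_ h1
    -- Every block map has its `eH` edges from `H` inside `U`, so only `e - eH` further edges are
    -- required.
    have h2 : ∀ k ∈ Fintype.piFinset (fun u => range (a u)), (p : ℝ) ^ (#U + (e - eH)) ≤
        (p : ℝ) ^ #((edges G).image (Sym2.map fun u => β u (k u)) ∪ U) := by
      intro k hk
      have hk' : ∀ u, k u < a u := fun u => Finset.mem_range.1 (Fintype.mem_piFinset.1 hk u)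
      refine pow_le_pow_of_le_one hp.le p.2.2 ?_
      have hφ : Function.Injective fun u => β u (k u) := by
        intro u w h
        exact (hβ1 u w _ _ ((hk' u).trans_le (hle u)) ((hk' w).trans_le (hle w)) h).1
      rw [union_comm, ← union_sdiff_self_eq_union, card_union_of_disjoint disjoint_sdiff,
        card_image_sdiff hφ, card_edges]
      have h3 : eH ≤ #((edges G).filter fun s => Sym2.map (fun u => β u (k u)) s ∈ U) := by
        rw [heH, Set.ncard_eq_toFinset_card _ (Set.toFinite _)]
        refine card_le_card fun s hs => ?_
        rw [Set.Finite.mem_toFinset] at hs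
        rw [mem_filter, mem_edges]
        refine ⟨H.edgeSet_subset hs, ?_⟩
        induction s with | _ u w =>
        exact mem_blowUp.2 ⟨u, w, hs, k u, hk' u, k w, hk' w, rfl⟩
      omega
    refine le_trans ?_ (Finset.card_nsmul_le_sum _ _ _ h2)
    rw [nsmul_eq_mul, Fintype.card_piFinset]
    simp only [card_range]
    push_cast
    have h3 : L ^ Q.ncard * m ^ (∑ u, x u) * ((n : ℝ) / (2 * v)) ^ (v - r - Q.ncard) ≤
        ∏ u, (a u : ℝ) := by
      rw [← prod_blockSizes Q hQR x L m ((n : ℝ) / (2 * v)) hm0]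
      refine Finset.prod_le_prod (fun u _ => ?_) fun u _ => ?_
      · split_ifs <;> positivity
      · by_cases hu : u ∈ R
        · simp [hu, haR u hu]
        by_cases huQ : u ∈ Q
        · rw [if_neg hu, dif_pos huQ, haQ ⟨u, huQ⟩]
          exact Nat.le_ceil _
        · rw [if_neg hu, dif_neg huQ]
          simpa [ha, hu, huQ] using hdiv
    have hcard : Q.ncard + (v - r - Q.ncard) = v - r := by
      have h4 : Q.ncard + r ≤ v := by
        have h5 : Q.ncard + (R : Set V).ncard = (Q ∪ (R : Set V)).ncard :=
          (Set.ncard_union_eq hQR).symm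
        rw [Set.ncard_coe_finset] at h5
        have h6 := Set.ncard_le_ncard (Set.subset_univ (Q ∪ (R : Set V))) (Set.toFinite _)
        rw [Set.ncard_univ, Nat.card_eq_fintype_card] at h6
        omega
      omega
    have h4 : L * ((n : ℝ) ^ Q.ncard * (p : ℝ) ^ eH) *
        ((n : ℝ) ^ (v - r - Q.ncard) / (2 * v) ^ v) ≤ ∏ u, (a u : ℝ) := by
      refine le_trans ?_ h3
      rw [hxsum]
      refine mul_le_mul (mul_le_mul ?_ hψ (by positivity) (by positivity)) ?_
        (by positivity) (by positivity)
      · exact le_self_pow₀ hL1 (by omega)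
      · rw [div_pow]
        refine div_le_div_of_nonneg_left (by positivity) (by positivity) ?_
        exact pow_le_pow_right₀ (by linarith) (by omega)
    calc L * (p : ℝ) ^ (#U + e) * (n : ℝ) ^ (v - r) / (2 * v) ^ v
        = L * ((n : ℝ) ^ Q.ncard * (p : ℝ) ^ eH) *
          ((n : ℝ) ^ (v - r - Q.ncard) / (2 * v) ^ v) * (p : ℝ) ^ (#U + (e - eH)) := by
          rw [← hcard, pow_add (n : ℝ)]
          have : (p : ℝ) ^ (#U + e) = (p : ℝ) ^ eH * (p : ℝ) ^ (#U + (e - eH)) := by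
            rw [← pow_add]
            congr 1
            omega
          rw [this, hcard]
          ring
      _ ≤ _ := mul_le_mul_of_nonneg_right h4 (by positivity)
  have h1 := sub_le_measureReal_containCount_ge_mul (𝒞 := copies G R n) (A := Prod.snd) p
    copies_snd_subset hUoff (a := t * rootedMean G R n p) (by rw [rootedMean_eq]; positivity)
  rw [← upperTail_eq, rootedMean_eq] at h1
  have h2 : 2 * t * (N * (p : ℝ) ^ e) * (p : ℝ) ^ #U ≤
      L * (p : ℝ) ^ (#U + e) * (n : ℝ) ^ (v - r) / (2 * v) ^ v := by
    have h3 : N ≤ (v : ℝ) ^ v * (n : ℝ) ^ (v - r) := card_copies_le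
    calc 2 * t * (N * (p : ℝ) ^ e) * (p : ℝ) ^ #U = 2 * t * (p : ℝ) ^ (#U + e) * N := by
          rw [pow_add]; ring
      _ ≤ 2 * t * (p : ℝ) ^ (#U + e) * ((v : ℝ) ^ v * (n : ℝ) ^ (v - r)) :=
          mul_le_mul_of_nonneg_left h3 (by positivity)
      _ = _ := by
          rw [hL, copyConst, eq_div_iff (by positivity)]
          ring
  -- The conditional mean is at least `2 t μ` and `X ≤ N`, so the conditional probability is at
  -- least `t μ / N ≥ p ^ e`.
  have h3 : (p : ℝ) ^ (e + #U) ≤ upperTail G R n p t := by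
    have h4 : (p : ℝ) ^ (e + #U) * N ≤ upperTail G R n p t * N := by
      have h5 : 0 ≤ (p : ℝ) ^ (e + #U) * N := by positivity
      have h6 : t * (N * (p : ℝ) ^ e) * (p : ℝ) ^ #U = t * ((p : ℝ) ^ (e + #U) * N) := by
        rw [pow_add]; ring
      have h7 : 2 * t * (N * (p : ℝ) ^ e) * (p : ℝ) ^ #U = 2 * t * ((p : ℝ) ^ (e + #U) * N) := by
        rw [pow_add]; ring
      rw [h7] at h2
      rw [h6] at h1
      nlinarith
    exact le_of_mul_le_mul_right h4 hN0
  refine le_trans ?_ h3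
  rw [← Real.rpow_natCast (p : ℝ) (e + #U)]
  refine Real.rpow_le_rpow_of_exponent_ge hp p.2.2 ?_
  push_cast
  have : (e : ℝ) ≤ e * m := le_mul_of_one_le_right (Nat.cast_nonneg _) hm
  linarith

end Lower

/-! ### Lower bound when `p` is bounded away from zero -/

section DenseLower

variable {V : Type*} [Fintype V] {G : SimpleGraph V} {R : Finset V} {n : ℕ}

open Classical in
/-- The pairs that meet the first `r` vertices. -/
def rootPairs (n r : ℕ) : Finset (Sym2 (Fin n)) :=
  (offDiagPairs (Fin n)).filter fun s => ¬ ∀ x ∈ s, x ∉ rootSet n r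

open Classical in
lemma rootPairs_subset (n r : ℕ) : rootPairs n r ⊆ offDiagPairs (Fin n) :=
  filter_subset _ _

lemma card_rootPairs_le (n r : ℕ) : #(rootPairs n r) ≤ r * n := by
  classical
  have h1 : rootPairs n r ⊆ ((univ.filter fun x : Fin n => (x : ℕ) < r) ×ˢ univ).image
      fun z => s(z.1, z.2) := by
    intro s hs
    simp only [rootPairs, mem_filter, not_forall, not_not] at hs
    obtain ⟨-, x, ⟨y, rfl⟩, hx⟩ := hs
    exact mem_image.2 ⟨(x, y), by simpa [rootSet] using hx, rfl⟩
  refine (card_le_card h1).trans (card_image_le.trans ?_)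
  rw [card_product, card_univ, Fintype.card_fin, Fin.card_filter_val_lt]
  exact Nat.mul_le_mul_right _ (min_le_right _ _)

lemma sdiff_rootPairs : ∀ c ∈ copies G R n, c.2 \ rootPairs n #R = nonRootPart #R c.2 := by
  classical
  intro c hc
  ext s
  have := @copies_snd_subset _ _ G R n c hc s
  simp only [mem_sdiff, rootPairs, nonRootPart, mem_filter]
  tauto

/-- With all root pairs planted, a copy needs only its non-root edges. -/
lemma card_union_rootPairs : ∀ c ∈ copies G R n,
    #(c.2 ∪ rootPairs n #R) = #(rootPairs n #R) + (numEdges G - numRootEdges G R) := by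
  intro c hc
  rw [union_comm, ← union_sdiff_self_eq_union, card_union_of_disjoint disjoint_sdiff,
    sdiff_rootPairs c hc, card_nonRootPart c hc]

/-- The left side is convex in `y`, hence below its chord on `[0, 1]`. -/
lemma one_add_mul_pow_le {a y : ℝ} (ha : 0 ≤ a) (hy0 : 0 ≤ y) (hy1 : y ≤ 1) (k : ℕ) :
    (1 + a * y) ^ k ≤ 1 + y * ((1 + a) ^ k - 1) := by
  induction k with
  | zero => simp
  | succ k ih =>
    have h1 : 1 ≤ (1 + a) ^ k := one_le_pow₀ (by linarith)
    rw [pow_succ, pow_succ]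
    refine (mul_le_mul_of_nonneg_right ih (by positivity)).trans ?_
    have : 0 ≤ a * y * ((1 - y) * ((1 + a) ^ k - 1)) :=
      mul_nonneg (by positivity) (mul_nonneg (by linarith) (by linarith))
    nlinarith

/-- The lower bound obtained by planting all edges at the roots and comparing with a slightly
denser random graph. -/
lemma exp_le_upperTail_of_tilt {t : ℝ} (ht : 1 < t)
    (heR : 0 < numRootEdges G R) (hV : 0 < Fintype.card V) (hn : Fintype.card V ≤ n)
    {p₀ : ℝ} (hp₀ : 0 < p₀) {p q : unitInterval} (hp₀p : p₀ ≤ p) (hpq : (p : ℝ) ≤ q)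
    (hp : (p : ℝ) ≤ pTwo G t)
    (hq : (1 : ℝ) / n ≤ (q / p : ℝ) ^ (numEdges G - numRootEdges G R) -
      t * (p : ℝ) ^ numRootEdges G R) :
    Real.exp (-(2 * ((Fintype.card V + numEdges G) * Real.log (1 / p₀) + 1) * n +
      ((q : ℝ) - p) ^ 2 * (n : ℝ) ^ 2 / (p₀ * (1 - pTwo G t)))) ≤ upperTail G R n p t := by
  set v := Fintype.card V with hv
  set e := numEdges G with he
  set eR := numRootEdges G R with heR'
  set f := e - eR with hf
  have heRe : eR ≤ e := numRootEdges_le_numEdges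
  have hp2 : pTwo G t < 1 := pTwo_lt_one ht (heR.trans_le heRe)
  have hp0 : 0 < (p : ℝ) := hp₀.trans_le hp₀p
  have hn1 : 1 ≤ n := by omega
  have hn1' : (1 : ℝ) ≤ n := by exact_mod_cast hn1
  have hp₀1 : p₀ ≤ 1 := hp₀p.trans p.2.2
  have hlog : 0 ≤ Real.log (1 / p₀) := Real.log_nonneg (by rw [le_div_iff₀ hp₀]; linarith)
  set N : ℝ := ((#(copies G R n) : ℕ) : ℝ) with hN
  have hN0 : 0 < N := by rw [hN]; exact_mod_cast card_copies_pos hV hn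
  set U := rootPairs n #R with hU
  set P : unitInterval → ℝ := fun s => (binomialRandom (Fin n) s).real
    {F | t * rootedMean G R n p ≤ containCount (copies G R n) Prod.snd F} with hP
  have h1 := sub_le_measureReal_containCount_ge_mul (𝒞 := copies G R n) (A := Prod.snd) q
    copies_snd_subset (rootPairs_subset n #R) (a := t * rootedMean G R n p)
    (by rw [rootedMean_eq]; positivity)
  have h2 : ∑ c ∈ copies G R n, (q : ℝ) ^ #(c.2 ∪ U) = N * (q : ℝ) ^ (#U + f) := by
    rw [Finset.sum_congr rfl fun c hc => by rw [card_union_rootPairs c hc], Finset.sum_const,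
      nsmul_eq_mul]
  -- In `G(n, q)` with the root pairs planted, the mean exceeds `t μ` by at least `N p ^ f / n`, and
  -- `X ≤ N`. A relative excess of `1 / n` is enough, as its cost is absorbed in `exp(-n)`.
  have h3 : (q : ℝ) ^ #U * ((p : ℝ) ^ f * (1 / n)) ≤ P q := by
    rw [h2, rootedMean_eq] at h1
    have h4 : (q : ℝ) ^ #U * ((p : ℝ) ^ f * (1 / n)) * N ≤ P q * N := by
      simp only [hP, rootedMean_eq]
      refine le_trans ?_ h1
      have h5 : N * (q : ℝ) ^ (#U + f) - t * (N * (p : ℝ) ^ e) * (q : ℝ) ^ #U =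
          (q : ℝ) ^ #U * ((p : ℝ) ^ f * ((q / p : ℝ) ^ f - t * (p : ℝ) ^ eR)) * N := by
        have h6 : (p : ℝ) ^ e = (p : ℝ) ^ f * (p : ℝ) ^ eR := by
          rw [← pow_add, hf, Nat.sub_add_cancel heRe]
        rw [h6, pow_add, div_pow]
        field_simp
      rw [h5]
      have := q.2.1
      gcongr
    exact le_of_mul_le_mul_right h4 hN0
  have h4 : Real.exp (-(((v + e) * Real.log (1 / p₀) + 1) * n)) ≤ P q := by
    refine le_trans ?_ h3
    have hU1 : #U ≤ v * n :=
      (card_rootPairs_le n #R).trans (Nat.mul_le_mul_right _ (card_le_univ R))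
    have h5 : p₀ ^ (v * n + e * n) ≤ (q : ℝ) ^ #U * (p : ℝ) ^ f := by
      rw [pow_add]
      refine mul_le_mul ?_ ?_ (by positivity) (pow_nonneg q.2.1 _)
      · exact (pow_le_pow_of_le_one hp₀.le hp₀1 hU1).trans
          (pow_le_pow_left₀ hp₀.le (hp₀p.trans hpq) _)
      · refine (pow_le_pow_of_le_one hp₀.le hp₀1 ?_).trans (pow_le_pow_left₀ hp₀.le hp₀p _)
        exact (Nat.sub_le _ _).trans (Nat.le_mul_of_pos_right _ hn1)
    have h6 : Real.exp (-(n : ℝ)) ≤ 1 / n := by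
      rw [Real.exp_neg, ← one_div]
      refine one_div_le_one_div_of_le (by linarith) ?_
      have := Real.add_one_le_exp (n : ℝ)
      linarith
    have h7 : p₀ ^ (v * n + e * n) = Real.exp (-((v + e) * Real.log (1 / p₀) * n)) := by
      rw [← Real.rpow_natCast, Real.rpow_def_of_pos hp₀, one_div, Real.log_inv]
      congr 1
      push_cast
      ring
    calc _ = Real.exp (-((v + e) * Real.log (1 / p₀) * n)) * Real.exp (-(n : ℝ)) := by
          rw [← Real.exp_add]
          congr 1
          ring
      _ ≤ ((q : ℝ) ^ #U * (p : ℝ) ^ f) * (1 / n) := by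
          rw [← h7]
          exact mul_le_mul h5 h6 (Real.exp_pos _).le
            (mul_nonneg (pow_nonneg q.2.1 _) (pow_nonneg hp0.le _))
      _ = _ := by ring
  -- Here `μ` is still the mean at density `p`; only the measure changes. The square is the source
  -- of the factor 2 in the exponent.
  have h5 := sq_binomialRandom_le p q hp0 (hp.trans_lt hp2)
    {F | t * rootedMean G R n p ≤ containCount (copies G R n) Prod.snd F}
  have h6 : (1 + ((q : ℝ) - p) ^ 2 / (p * (1 - p))) ^ (Fintype.card (Fin n)).choose 2 ≤
      Real.exp (((q : ℝ) - p) ^ 2 * (n : ℝ) ^ 2 / (p₀ * (1 - pTwo G t))) := by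
    have h1p : 0 < 1 - pTwo G t := by linarith
    have h7 : ((q : ℝ) - p) ^ 2 / (p * (1 - p)) ≤
        ((q : ℝ) - p) ^ 2 / (p₀ * (1 - pTwo G t)) := by
      refine div_le_div_of_nonneg_left (sq_nonneg _) (by positivity) ?_
      exact mul_le_mul hp₀p (by linarith) h1p.le hp0.le
    have h8 : 0 ≤ ((q : ℝ) - p) ^ 2 / (p * (1 - p)) := by
      have := hp.trans_lt hp2
      exact div_nonneg (sq_nonneg _) (mul_nonneg hp0.le (by linarith))
    rw [Fintype.card_fin]
    calc _ ≤ (1 + ((q : ℝ) - p) ^ 2 / (p * (1 - p))) ^ n ^ 2 :=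
          pow_le_pow_right₀ (by linarith) (Nat.choose_le_pow n 2)
      _ ≤ Real.exp (((q : ℝ) - p) ^ 2 / (p₀ * (1 - pTwo G t))) ^ n ^ 2 := by
          refine pow_le_pow_left₀ (by linarith) ?_ _
          have := Real.add_one_le_exp (((q : ℝ) - p) ^ 2 / (p₀ * (1 - pTwo G t)))
          linarith
      _ = _ := by
          rw [← Real.exp_nat_mul]
          congr 1
          push_cast
          ring
  have h7 : Real.exp (-(((v + e) * Real.log (1 / p₀) + 1) * n)) ^ 2 ≤ upperTail G R n p t *
      Real.exp (((q : ℝ) - p) ^ 2 * (n : ℝ) ^ 2 / (p₀ * (1 - pTwo G t))) := by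
    rw [upperTail_eq]
    refine (pow_le_pow_left₀ (Real.exp_pos _).le h4 2).trans (h5.trans ?_)
    exact mul_le_mul_of_nonneg_left h6 measureReal_nonneg
  rw [← div_le_iff₀ (Real.exp_pos _), ← Real.exp_nat_mul, ← Real.exp_sub] at h7
  refine le_trans (le_of_eq ?_) h7
  congr 1
  push_cast
  ring

lemma pOne_le_pTwo {t : ℝ} (ht : 1 < t) (heR : 0 < numRootEdges G R) :
    pOne G R t ≤ pTwo G t := by
  refine Real.rpow_le_rpow_of_exponent_le ht.le ?_
  have h1 : (0 : ℝ) < numRootEdges G R := by exact_mod_cast heR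
  have h2 : (numRootEdges G R : ℝ) ≤ numEdges G := by exact_mod_cast numRootEdges_le_numEdges
  rw [neg_div, neg_div, neg_le_neg_iff]
  exact one_div_le_one_div_of_le h1 h2

set_option maxHeartbeats 1000000 in
/-- The lower bound for edge probabilities bounded away from zero. -/
lemma exists_exp_le_upperTail (hV : 0 < Fintype.card V)
    (heR : 0 < numRootEdges G R) {t : ℝ} (ht : 1 < t) {p₀ : ℝ} (hp₀ : 0 < p₀) :
    ∃ C : ℝ, 0 < C ∧ ∀ n : ℕ, Fintype.card V ≤ n → ∀ p : unitInterval, p₀ ≤ p →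
      (p : ℝ) ≤ pTwo G t →
      Real.exp (-(C * (n + (max ((p : ℝ) - pOne G R t) 0) ^ 2 * (n : ℝ) ^ 2))) ≤
        upperTail G R n p t := by
  set v := Fintype.card V with hv
  set e := numEdges G with he
  set eR := numRootEdges G R with heR'
  set f := e - eR with hf
  set p₁ := pOne G R t with hp₁
  have heRe : eR ≤ e := numRootEdges_le_numEdges
  have he0 : 0 < e := heR.trans_le heRe
  have hp2 : pTwo G t < 1 := pTwo_lt_one ht he0
  have hp₁0 : 0 < p₁ := pOne_pos ht
  set ℓ : ℝ := |Real.log (1 / p₀)| with hℓ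
  -- `A` bounds the slope in `t p ^ eR ≤ 1 + A x`; the additional 1 in `K` yields the excess `s ≥ 1
  -- / n` required for tilting.
  set A : ℝ := (1 + 1 / p₁) ^ eR with hA
  have hA0 : 0 < A := by positivity
  set K : ℝ := A + 1 with hK
  have hK0 : 0 < K := by positivity
  have h1p : 0 < 1 - pTwo G t := by linarith
  set C₁ : ℝ := 2 * ((v + e) * ℓ + 1) with hC₁
  set C₂ : ℝ := 2 * K ^ 2 / (p₀ * (1 - pTwo G t)) with hC₂
  set C₃ : ℝ := 2 * K ^ 2 / (1 - pTwo G t) ^ 2 * ℓ with hC₃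
  have hC₁0 : 0 < C₁ := by positivity
  have hC₂0 : 0 < C₂ := by positivity
  have hC₃0 : 0 ≤ C₃ := by positivity
  refine ⟨C₁ + C₂ + C₃, by positivity, fun n hn p hp₀p hp => ?_⟩
  have hp0 : 0 < (p : ℝ) := hp₀.trans_le hp₀p
  have hn1 : 1 ≤ n := by omega
  have hn1' : (1 : ℝ) ≤ n := by exact_mod_cast hn1
  have hp₀1 : p₀ ≤ 1 := hp₀p.trans p.2.2
  have hlog : Real.log (1 / p₀) = ℓ :=
    (abs_of_nonneg (Real.log_nonneg (by rw [le_div_iff₀ hp₀]; linarith))).symm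
  -- Truncation allows `p < p₁` as well, which is needed in (b) when the blow-up does not fit.
  set x : ℝ := max ((p : ℝ) - p₁) 0 with hx
  have hx0 : 0 ≤ x := le_max_right _ _
  have hpx : (p : ℝ) ≤ p₁ + x := by have := le_max_left ((p : ℝ) - p₁) 0; linarith
  have hx1 : x ≤ 1 := max_le (by have := p.2.2; linarith) zero_le_one
  set D : ℝ := n + x ^ 2 * (n : ℝ) ^ 2 with hD
  have hDn : (n : ℝ) ≤ D := by rw [hD]; nlinarith [mul_nonneg (sq_nonneg x) (sq_nonneg (n : ℝ))]
  have hD0 : 0 < D := by linarith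
  have hpow : ∀ k : ℕ, Real.exp (-(k * ℓ)) ≤ (p : ℝ) ^ k := by
    intro k
    refine le_trans (le_of_eq ?_) (pow_le_pow_left₀ hp₀.le hp₀p k)
    rw [← Real.rpow_natCast, Real.rpow_def_of_pos hp₀, ← hlog, one_div, Real.log_inv]
    congr 1
    ring
  rcases Nat.eq_zero_or_pos f with hf0 | hf0
  · -- all edges are at the roots
    have h1 := pow_card_le_upperTail (n := n) (G := G) (R := R) ht he0 hp
      (rootPairs_subset n #R) (by
        intro c hc
        rw [← sdiff_eq_empty_iff_subset, ← card_eq_zero, sdiff_rootPairs c hc,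
          card_nonRootPart c hc]
        exact hf0)
    refine le_trans ?_ h1
    refine le_trans ?_ (hpow _)
    rw [Real.exp_le_exp, neg_le_neg_iff]
    have h2 : (#(rootPairs n #R) : ℝ) ≤ v * n := by
      exact_mod_cast (card_rootPairs_le n #R).trans (Nat.mul_le_mul_right _ (card_le_univ R))
    calc (#(rootPairs n #R) : ℝ) * ℓ ≤ v * n * ℓ := mul_le_mul_of_nonneg_right h2 (abs_nonneg _)
      _ = (v * ℓ) * n := by ring
      _ ≤ C₁ * n := by
          refine mul_le_mul_of_nonneg_right ?_ (by linarith)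
          have h3 : 0 ≤ (v : ℝ) * ℓ := by positivity
          have h4 : 0 ≤ (e : ℝ) * ℓ := by positivity
          rw [hC₁]
          linarith
      _ ≤ (C₁ + C₂ + C₃) * D := mul_le_mul (by linarith) hDn (by linarith) (by linarith)
  -- The summand `1 / √n` guarantees the excess even for `x = 0`, and contributes only `O(n)` to `s²
  -- n²`.
  set s : ℝ := x + 1 / Real.sqrt n with hs
  have hsn : 0 < Real.sqrt n := Real.sqrt_pos.2 (by linarith)
  have hs0 : 0 < s := by positivity
  have hsn2 : s ^ 2 * (n : ℝ) ^ 2 ≤ 2 * D := by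
    have h1 : s ^ 2 ≤ 2 * (x ^ 2 + 1 / n) := by
      have h2 : (1 / Real.sqrt n) ^ 2 = 1 / n := by
        rw [div_pow, Real.sq_sqrt (by linarith), one_pow]
      rw [← h2, hs]
      nlinarith [sq_nonneg (x - 1 / Real.sqrt n)]
    calc s ^ 2 * (n : ℝ) ^ 2 ≤ 2 * (x ^ 2 + 1 / n) * (n : ℝ) ^ 2 :=
          mul_le_mul_of_nonneg_right h1 (sq_nonneg _)
      _ = 2 * D := by
          rw [hD]
          field_simp
          ring
  -- If the tilted density would exceed 1, then `s` is bounded below because `p ≤ p₂ < 1`. So `D`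
  -- has order `n ^ 2`, and planting the complete graph is affordable.
  rcases lt_or_ge 1 ((p : ℝ) * (1 + K * s)) with hq1 | hq1
  · refine le_trans ?_ (pow_sq_le_upperTail (n := n) (R := R) ht he0 hp)
    refine le_trans ?_ (hpow _)
    rw [Real.exp_le_exp, neg_le_neg_iff]
    have h1 : 1 - pTwo G t ≤ K * s := by
      have : (p : ℝ) * (K * s) ≤ 1 * (K * s) :=
        mul_le_mul_of_nonneg_right p.2.2 (by positivity)
      nlinarith
    have h2 : (1 - pTwo G t) ^ 2 * (n : ℝ) ^ 2 ≤ 2 * K ^ 2 * D := by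
      calc (1 - pTwo G t) ^ 2 * (n : ℝ) ^ 2 ≤ (K * s) ^ 2 * (n : ℝ) ^ 2 :=
            mul_le_mul_of_nonneg_right (pow_le_pow_left₀ h1p.le h1 2) (sq_nonneg _)
        _ = K ^ 2 * (s ^ 2 * (n : ℝ) ^ 2) := by ring
        _ ≤ K ^ 2 * (2 * D) := mul_le_mul_of_nonneg_left hsn2 (sq_nonneg _)
        _ = _ := by ring
    have h3 : (n : ℝ) ^ 2 * ℓ ≤ C₃ * D := by
      have h4 : (n : ℝ) ^ 2 ≤ 2 * K ^ 2 / (1 - pTwo G t) ^ 2 * D := by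
        rw [div_mul_eq_mul_div, le_div_iff₀ (by positivity)]
        linarith
      calc (n : ℝ) ^ 2 * ℓ ≤ 2 * K ^ 2 / (1 - pTwo G t) ^ 2 * D * ℓ :=
            mul_le_mul_of_nonneg_right h4 (abs_nonneg _)
        _ = C₃ * D := by rw [hC₃]; ring
    push_cast
    refine h3.trans (mul_le_mul_of_nonneg_right (by linarith) hD0.le)
  · set q : unitInterval := ⟨p * (1 + K * s), by positivity, hq1⟩ with hq
    have hqv : (q : ℝ) = p * (1 + K * s) := rfl
    have h1 := exp_le_upperTail_of_tilt (G := G) (R := R) (q := q) ht heR hV hn hp₀ hp₀p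
      (by rw [hqv]; exact le_mul_of_one_le_right hp0.le (by nlinarith [mul_pos hK0 hs0])) hp ?_
    · refine le_trans ?_ h1
      rw [Real.exp_le_exp, neg_le_neg_iff, hlog]
      have h2 : ((q : ℝ) - p) ^ 2 * (n : ℝ) ^ 2 ≤ 2 * K ^ 2 * D := by
        have h3 : ((q : ℝ) - p) ^ 2 ≤ K ^ 2 * s ^ 2 := by
          have : ((q : ℝ) - p) ^ 2 = (p : ℝ) ^ 2 * (K ^ 2 * s ^ 2) := by rw [hqv]; ring
          rw [this]
          exact mul_le_of_le_one_left (by positivity) (pow_le_one₀ hp0.le p.2.2)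
        calc ((q : ℝ) - p) ^ 2 * (n : ℝ) ^ 2 ≤ K ^ 2 * s ^ 2 * (n : ℝ) ^ 2 :=
              mul_le_mul_of_nonneg_right h3 (sq_nonneg _)
          _ = K ^ 2 * (s ^ 2 * (n : ℝ) ^ 2) := by ring
          _ ≤ K ^ 2 * (2 * D) := mul_le_mul_of_nonneg_left hsn2 (sq_nonneg _)
          _ = _ := by ring
      have h3 : ((q : ℝ) - p) ^ 2 * (n : ℝ) ^ 2 / (p₀ * (1 - pTwo G t)) ≤ C₂ * D := by
        rw [hC₂, div_mul_eq_mul_div]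
        exact div_le_div_of_nonneg_right h2 (by positivity)
      have h4 : C₁ * n ≤ C₁ * D := mul_le_mul_of_nonneg_left hDn hC₁0.le
      have h5 : 0 ≤ C₃ * D := mul_nonneg hC₃0 hD0.le
      calc _ ≤ C₁ * D + C₂ * D := add_le_add h4 h3
        _ ≤ (C₁ + C₂ + C₃) * D := by linarith
    · have h2 : (q / p : ℝ) = 1 + K * s := by
        rw [hqv, mul_div_cancel_left₀ _ hp0.ne']
      have h3 : 1 + K * s ≤ (q / p : ℝ) ^ f := by
        rw [h2]
        exact le_self_pow₀ (by nlinarith [mul_pos hK0 hs0]) hf0.ne'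
      have h4 : t * (p : ℝ) ^ eR ≤ 1 + x * A := by
        have h6 : t * (p : ℝ) ^ eR = (p / p₁) ^ eR := by
          have h7 := mul_pOne_pow ht heR
          rw [div_pow, eq_div_iff (by positivity), mul_right_comm]
          exact (congrArg (· * (p : ℝ) ^ eR) h7).trans (one_mul _)
        have h7 : (p : ℝ) / p₁ ≤ 1 + 1 / p₁ * x := by
          rw [div_le_iff₀ hp₁0]
          field_simp
          exact hpx
        rw [h6]
        refine (pow_le_pow_left₀ (by positivity) h7 _).trans ?_
        refine (one_add_mul_pow_le (by positivity) hx0 hx1 eR).trans ?_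
        have : x * (A - 1) ≤ x * A := mul_le_mul_of_nonneg_left (by linarith) hx0
        linarith
      have h5 : (1 : ℝ) / n ≤ s := by
        have h6 : (1 : ℝ) / n ≤ 1 / Real.sqrt n := by
          refine one_div_le_one_div_of_le hsn ?_
          rw [Real.sqrt_le_left (by linarith)]
          nlinarith
        linarith
      have h6 : x * A ≤ A * s := by
        rw [mul_comm]
        refine mul_le_mul_of_nonneg_left ?_ hA0.le
        have : 0 < 1 / Real.sqrt n := by positivity
        linarith
      have h7 : K * s = A * s + s := by rw [hK]; ring
      linarith

end DenseLower

/-! ### Thresholds and the four ranges of `p` -/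

section Main

variable {V : Type*} [Fintype V] {G : SimpleGraph V} {R : Finset V} {n : ℕ}

lemma upperTail_eq_zero (hV : 0 < Fintype.card V) (hn : Fintype.card V ≤ n) {t : ℝ} (ht : 1 < t)
    (he : 0 < numEdges G) {p : unitInterval} (hp : pTwo G t < p) : upperTail G R n p t = 0 := by
  have hN : (0 : ℝ) < #(copies G R n) := by exact_mod_cast card_copies_pos hV hn
  have h : {F | t * rootedMean G R n p ≤ containCount (copies G R n) Prod.snd F} = ∅ := by
    rw [Set.eq_empty_iff_forall_notMem]
    intro F hF
    have h1 := le_trans hF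
      (containCount_le_card (copies G R n) Prod.snd F)
    have h2 : 1 < t * (p : ℝ) ^ numEdges G := by
      rw [← mul_pTwo_pow ht he]
      exact mul_lt_mul_of_pos_left (pow_lt_pow_left₀ hp (pTwo_pos ht).le he.ne') (by linarith)
    rw [rootedMean_eq] at h1
    nlinarith
  rw [upperTail_eq, h, measureReal_empty]

lemma upperTail_le_inv (hV : 0 < Fintype.card V) (hn : Fintype.card V ≤ n) {t : ℝ} (ht : 1 < t)
    {p : unitInterval} (hp : 0 < (p : ℝ)) : upperTail G R n p t ≤ Real.exp (-Real.log t) := by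
  have hN : (0 : ℝ) < #(copies G R n) := by exact_mod_cast card_copies_pos hV hn
  have hμ : 0 < rootedMean G R n p := by rw [rootedMean_eq]; positivity
  have h := measureReal_containCount_ge_mul_pow_le (𝒞 := copies G R n) (A := Prod.snd) p
    copies_snd_subset (fun c hc => (card_copies_snd c hc).le)
    (B := fun _ => rootedMean G R n p) (k := 1) (a := t * rootedMean G R n p)
    (by
      intro i hi U _ hU
      have hU0 : U = ∅ := by
        rw [← card_eq_zero]
        have : i = 0 := by omega
        subst this
        simpa using hU
      subst hU0
      rw [rootedMean_eq, Finset.sum_congr rfl fun c hc => by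
        rw [sdiff_empty, card_copies_snd c hc], Finset.sum_const, nsmul_eq_mul])
    (by positivity)
  rw [← upperTail_eq] at h
  simp only [pow_one, range_one, prod_singleton] at h
  rw [Real.exp_neg, Real.exp_log (by linarith), ← one_div, le_div_iff₀ (by linarith)]
  refine le_of_mul_le_mul_right (a := rootedMean G R n p) ?_ hμ
  linarith

lemma div_le_maxDensity {H : G.Subgraph} (hH : 0 < H.edgeSet.ncard) :
    (H.edgeSet.ncard : ℝ) / (H.deleteVerts (R : Set V)).verts.ncard ≤ maxDensity G R :=
  le_ciSup (f := fun H : {H : G.Subgraph // 0 < H.edgeSet.ncard} =>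
    (H.1.edgeSet.ncard : ℝ) / ((H.1.deleteVerts (R : Set V)).verts.ncard : ℝ))
    (Set.finite_range _).bddAbove ⟨H, hH⟩

/-- A densest `H` works: `n ^ (-1 / m_R)` is exactly where its `Ψ_H` equals 1. -/
lemma exists_psi_le_one (hR : G.IsIndepSet (R : Set V)) (he : 0 < numEdges G) (hn : 0 < n)
    {p : ℝ} (hp0 : 0 < p) (hp : p ≤ (n : ℝ) ^ (-1 / maxDensity G R)) :
    ∃ H : G.Subgraph, 0 < H.edgeSet.ncard ∧ psi R H n p ≤ 1 := by
  have : Nonempty {H : G.Subgraph // 0 < H.edgeSet.ncard} := ⟨⟨⊤, by simpa [numEdges] using he⟩⟩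
  obtain ⟨⟨H, hH⟩, hm⟩ := exists_eq_ciSup_of_finite
    (f := fun H : {H : G.Subgraph // 0 < H.edgeSet.ncard} =>
      (H.1.edgeSet.ncard : ℝ) / ((H.1.deleteVerts (R : Set V)).verts.ncard : ℝ))
  refine ⟨H, hH, ?_⟩
  have hh := one_le_ncard_deleteVerts hR hH
  rw [maxDensity, ← hm] at hp
  rw [psi]
  set h := (H.deleteVerts (R : Set V)).verts.ncard
  set e := H.edgeSet.ncard
  have hn0 : (0 : ℝ) < n := by exact_mod_cast hn
  have hh0 : (h : ℝ) ≠ 0 := by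
    have : h ≠ 0 := by omega
    exact_mod_cast this
  have he0 : (e : ℝ) ≠ 0 := by exact_mod_cast hH.ne'
  have h1 : p ^ e ≤ ((n : ℝ) ^ h)⁻¹ := by
    refine (pow_le_pow_left₀ hp0.le hp e).trans (le_of_eq ?_)
    rw [← Real.rpow_natCast, ← Real.rpow_mul hn0.le, ← Real.rpow_natCast, ← Real.rpow_neg hn0.le]
    congr 1
    field_simp
  calc (n : ℝ) ^ h * p ^ e ≤ (n : ℝ) ^ h * ((n : ℝ) ^ h)⁻¹ :=
        mul_le_mul_of_nonneg_left h1 (by positivity)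
    _ = 1 := mul_inv_cancel₀ (by positivity)

/-- Every `H` satisfies `e(H) / m_R ≤ v(H - R)`, so above the threshold all `Ψ_H` are at least 1. -/
lemma one_le_bigM (hR : G.IsIndepSet (R : Set V)) (he : 0 < numEdges G) (hn : 0 < n)
    {p : ℝ} (hp : (n : ℝ) ^ (-1 / maxDensity G R) ≤ p) : 1 ≤ bigM G R n p := by
  have : Nonempty {H : G.Subgraph // 0 < H.edgeSet.ncard} := ⟨⟨⊤, by simpa [numEdges] using he⟩⟩
  refine le_ciInf fun ⟨H, hH⟩ => ?_
  have hh := one_le_ncard_deleteVerts hR hH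
  have hm := div_le_maxDensity (R := R) hH
  have hα := half_le_fracIndepNum_deleteVerts hR hH
  refine Real.one_le_rpow ?_ (by positivity)
  rw [psi]
  set h := (H.deleteVerts (R : Set V)).verts.ncard
  set e := H.edgeSet.ncard
  set m := maxDensity G R
  have hn1 : (1 : ℝ) ≤ n := by exact_mod_cast hn
  have hh0 : (0 : ℝ) < h := by
    have : 0 < h := by omega
    exact_mod_cast this
  have he0 : (0 : ℝ) < e := by exact_mod_cast hH
  have hm0 : 0 < m := lt_of_lt_of_le (by positivity) hm
  have h1 : (n : ℝ) ^ (-1 / m * e) ≤ p ^ e := by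
    rw [Real.rpow_mul (by linarith), Real.rpow_natCast]
    exact pow_le_pow_left₀ (by positivity) hp e
  have h2 : (1 : ℝ) ≤ (n : ℝ) ^ (h : ℝ) * (n : ℝ) ^ (-1 / m * e) := by
    rw [← Real.rpow_add (by linarith)]
    refine Real.one_le_rpow hn1 ?_
    have h3 : (e : ℝ) / m ≤ h := by
      rw [div_le_iff₀ hm0]
      rw [div_le_iff₀ hh0] at hm
      linarith
    have h4 : -1 / m * (e : ℝ) = -(e / m) := by ring
    linarith
  rw [Real.rpow_natCast] at h2
  exact h2.trans (mul_le_mul_of_nonneg_left h1 (by positivity))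

/-- A single root edge shows that `M ≤ n p`. -/
lemma bigM_le_mul (hR : G.IsIndepSet (R : Set V)) (heR : 0 < numRootEdges G R)
    {p : ℝ} (hp : 0 ≤ p) (hn : 0 < n) (hM : 1 ≤ bigM G R n p) : bigM G R n p ≤ n * p := by
  classical
  obtain ⟨s, hs, a, haR, has⟩ := Set.nonempty_of_ncard_ne_zero heR.ne'
  obtain ⟨b, rfl⟩ := has
  have hab : G.Adj a b := hs
  have hbR : b ∉ R := fun hb => hR haR hb hab.ne hab
  set H := edgeSubgraph G {s(a, b)} with hH
  have hHe : H.edgeSet = {s(a, b)} := edgeSet_edgeSubgraph (by simpa using hs)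
  have hHe1 : H.edgeSet.ncard = 1 := by rw [hHe, Set.ncard_singleton]
  have hHpos : 0 < H.edgeSet.ncard := by omega
  have h1 := bigM_rpow_le_psi (n := n) hR hp hHpos
  have hverts : ∀ v ∈ (H.deleteVerts (R : Set V)).verts, v = b := by
    rintro v ⟨⟨w, hvw, -⟩, hvR⟩
    simp only [Set.mem_singleton_iff, Sym2.eq_iff] at hvw
    rcases hvw with ⟨rfl, -⟩ | ⟨rfl, -⟩
    · exact absurd haR hvR
    · rfl
  have h2 : (H.deleteVerts (R : Set V)).verts.ncard ≤ 1 :=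
    (Set.ncard_le_ncard (t := {b}) hverts (Set.toFinite _)).trans (by simp)
  have hα : 1 ≤ fracIndepNum (H.deleteVerts (R : Set V)).coe := by
    have h3 := sum_le_fracIndepNum (H := (H.deleteVerts (R : Set V)).coe) (x := fun _ => 1)
      (fun _ => by norm_num) (fun i j hij => by
        exfalso
        exact hij.ne (Subtype.ext ((hverts i i.2).trans (hverts j j.2).symm)))
    refine le_trans ?_ h3
    have h4 := one_le_ncard_deleteVerts hR hHpos
    rw [← Nat.card_coe_set_eq, Nat.card_eq_fintype_card] at h4
    simpa using h4
  have hn1 : (1 : ℝ) ≤ n := by exact_mod_cast hn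
  calc bigM G R n p = bigM G R n p ^ (1 : ℝ) := (Real.rpow_one _).symm
    _ ≤ bigM G R n p ^ fracIndepNum (H.deleteVerts (R : Set V)).coe :=
        Real.rpow_le_rpow_of_exponent_le hM hα
    _ ≤ _ := h1
    _ = (n : ℝ) ^ (H.deleteVerts (R : Set V)).verts.ncard * p := by rw [psi, hHe1, pow_one]
    _ ≤ (n : ℝ) ^ 1 * p := mul_le_mul_of_nonneg_right (pow_le_pow_right₀ hn1 h2) hp
    _ = n * p := by rw [pow_one]

lemma rpow_eq_exp_neg_mul_log {p : ℝ} (hp : 0 < p) (C : ℝ) :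
    p ^ C = Real.exp (-(C * Real.log (1 / p))) := by
  rw [Real.rpow_def_of_pos hp, one_div, Real.log_inv]
  congr 1
  ring

/-- Here a blow-up with `m = 1` suffices. For `n < K` it might not fit, and the complete graph is
planted at the bounded cost `p ^ (K ^ 2)`. -/
lemma exists_rpow_le_upperTail_sparse (hR : G.IsIndepSet (R : Set V))
    (hV : 0 < Fintype.card V) (he : 0 < numEdges G) {t : ℝ} (ht : 1 < t) :
    ∃ C : ℝ, 0 < C ∧ ∀ n : ℕ, Fintype.card V ≤ n → ∀ p : unitInterval, 0 < (p : ℝ) →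
      (p : ℝ) ≤ (n : ℝ) ^ (-1 / maxDensity G R) → (p : ℝ) ≤ pTwo G t →
      (p : ℝ) ^ C ≤ upperTail G R n p t := by
  obtain ⟨K, hK, C, hC, h⟩ := exists_rpow_le_upperTail (G := G) hR hV ht
  refine ⟨max C (K ^ 2), lt_max_of_lt_left hC, fun n hn p hp hpm hp2 => ?_⟩
  rcases le_or_gt K n with hKn | hKn
  · obtain ⟨H, hH, hψ⟩ := exists_psi_le_one hR he (hV.trans_le hn) hp hpm
    have h1 := h n hn p hp H hH 1 le_rfl (by rwa [Real.one_rpow]) (by rwa [mul_one])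
    rw [mul_one] at h1
    exact (Real.rpow_le_rpow_of_exponent_ge hp p.2.2 (le_max_left _ _)).trans h1
  · refine le_trans ?_ (pow_sq_le_upperTail ht he hp2)
    rw [← Real.rpow_natCast (p : ℝ)]
    refine Real.rpow_le_rpow_of_exponent_ge hp p.2.2 (le_trans ?_ (le_max_right _ _))
    push_cast
    exact pow_le_pow_left₀ (Nat.cast_nonneg _) hKn.le 2

/-- Blow-up of a minimiser with `m = M` when `K M ≤ n`. Otherwise `M ≤ n p` forces `p > 1 / K`, and
the dense bound `exp(-D n)` is good enough because `n < K M` and `log (1 / p) ≥ log (1 / p₁) > 0`.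
-/
lemma exists_rpow_bigM_le_upperTail (hR : G.IsIndepSet (R : Set V))
    (hV : 0 < Fintype.card V) (heR : 0 < numRootEdges G R) {t : ℝ} (ht : 1 < t) :
    ∃ C : ℝ, 0 < C ∧ ∀ n : ℕ, Fintype.card V ≤ n → ∀ p : unitInterval, 0 < (p : ℝ) →
      (n : ℝ) ^ (-1 / maxDensity G R) ≤ p → (p : ℝ) ≤ pOne G R t →
      (p : ℝ) ^ (C * bigM G R n p) ≤ upperTail G R n p t := by
  have he : 0 < numEdges G := heR.trans_le numRootEdges_le_numEdges
  obtain ⟨K, hK, C, hC, h⟩ := exists_rpow_le_upperTail (G := G) hR hV ht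
  obtain ⟨D, hD, h'⟩ := exists_exp_le_upperTail (G := G) (R := R) hV heR ht (p₀ := 1 / K)
    (by positivity)
  have hp₁0 : 0 < pOne G R t := pOne_pos ht
  set ℓ := Real.log (1 / pOne G R t) with hℓ
  have hℓ0 : 0 < ℓ := Real.log_pos (by
    rw [lt_div_iff₀ hp₁0, one_mul]
    exact pOne_lt_one ht heR)
  refine ⟨max C (D * K / ℓ), lt_max_of_lt_left hC, fun n hn p hp hpm hp1 => ?_⟩
  have hn0 : 0 < n := hV.trans_le hn
  have hn0' : (0 : ℝ) < n := by exact_mod_cast hn0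
  have hM := one_le_bigM hR he hn0 hpm
  set M := bigM G R n p with hMdef
  rcases le_or_gt (K * M) n with hKM | hKM
  · obtain ⟨H, hH, hψ⟩ := exists_psi_eq_bigM_rpow hR he n hp.le
    refine le_trans ?_ (h n hn p hp H hH M hM hψ.le hKM)
    refine Real.rpow_le_rpow_of_exponent_ge hp p.2.2 ?_
    exact mul_le_mul_of_nonneg_right (le_max_left _ _) (by linarith)
  · have hMnp := bigM_le_mul hR heR hp.le hn0 hM
    have hpK : 1 / K ≤ p := by
      rw [div_le_iff₀ hK]
      have h1 : (n : ℝ) < K * (n * p) := hKM.trans_le (mul_le_mul_of_nonneg_left hMnp hK.le)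
      have h2 : (n : ℝ) * 1 < n * (p * K) := by linarith
      exact (lt_of_mul_lt_mul_left h2 hn0'.le).le
    refine le_trans ?_ (h' n hn p hpK (hp1.trans (pOne_le_pTwo ht heR)))
    rw [max_eq_right (sub_nonpos.2 hp1), rpow_eq_exp_neg_mul_log hp, Real.exp_le_exp, neg_le_neg_iff]
    have h3 : ℓ ≤ Real.log (1 / p) :=
      Real.log_le_log (by positivity) (one_div_le_one_div_of_le hp hp1)
    have h4 : D * K / ℓ * M * ℓ ≤ max C (D * K / ℓ) * M * Real.log (1 / p) :=
      mul_le_mul (mul_le_mul_of_nonneg_right (le_max_right _ _) (by linarith)) h3 hℓ0.le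
        (mul_nonneg (le_max_of_le_left hC.le) (by linarith))
    have h5 : D * K / ℓ * M * ℓ = D * (K * M) := by
      field_simp
    have h6 : D * (n : ℝ) ≤ D * (K * M) := mul_le_mul_of_nonneg_left hKM.le hD.le
    calc D * ((n : ℝ) + 0 ^ 2 * (n : ℝ) ^ 2) = D * n := by ring
      _ ≤ _ := by linarith

/-- A weighted average of the exponents of the two upper bounds. The weight `θ ≤ a` of the second is
small enough for `a n` to absorb its additive constant `1 / 4`. -/
lemma exists_upperTail_le_exp_dense (hR : G.IsIndepSet (R : Set V))
    (hV : 0 < Fintype.card V) (heR : 0 < numRootEdges G R) {t : ℝ} (ht : 1 < t) :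
    ∃ c : ℝ, 0 < c ∧ ∀ n : ℕ, Fintype.card V ≤ n → ∀ p : unitInterval, pOne G R t ≤ p →
      upperTail G R n p t ≤
        Real.exp (-(c * (n + ((p : ℝ) - pOne G R t) ^ 2 * (n : ℝ) ^ 2))) := by
  have he : 0 < numEdges G := heR.trans_le numRootEdges_le_numEdges
  obtain ⟨c₁, hc₁, h₁⟩ := exists_upperTail_le_exp_bigM (G := G) hR he hV ht
  obtain ⟨c₂, hc₂, h₂⟩ := exists_upperTail_le_exp_sq (G := G) (R := R) hV heR ht
  have hp₁0 : 0 < pOne G R t := pOne_pos ht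
  set a : ℝ := c₁ * pOne G R t ^ (2 * numEdges G) with ha
  have ha0 : 0 < a := by positivity
  set θ : ℝ := min (1 / 2) a with hθ
  have hθ0 : 0 < θ := lt_min (by norm_num) ha0
  have hθ1 : θ ≤ 1 / 2 := min_le_left _ _
  have hθa : θ ≤ a := min_le_right _ _
  refine ⟨min (a / 4) (θ * c₂), by positivity, fun n hn p hp => ?_⟩
  have hn0 : 0 < n := hV.trans_le hn
  have hn1 : (1 : ℝ) ≤ n := by exact_mod_cast hn0
  have hM := mul_le_bigM hR he hn0 hp₁0 hp p.2.2
  have h3 : upperTail G R n p t ≤ Real.exp (-(a * n)) := by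
    refine (h₁ n hn p (hp₁0.trans_le hp)).trans (Real.exp_le_exp.2 ?_)
    have := mul_le_mul_of_nonneg_left hM hc₁.le
    rw [ha]
    linarith
  have h4 := h₂ n hn p hp
  set D := ((p : ℝ) - pOne G R t) ^ 2 * (n : ℝ) ^ 2 with hD
  have hD0 : 0 ≤ D := by positivity
  have h5 : upperTail G R n p t ≤ Real.exp (min (-(a * n)) (1 / 4 - c₂ * D)) := by
    rcases min_choice (-(a * (n : ℝ))) (1 / 4 - c₂ * D) with h | h <;> rw [h] <;> assumption
  refine h5.trans (Real.exp_le_exp.2 ?_)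
  set Y := min (-(a * (n : ℝ))) (1 / 4 - c₂ * D)
  have h6 : (1 - θ) * Y ≤ (1 - θ) * -(a * n) :=
    mul_le_mul_of_nonneg_left (min_le_left _ _) (by linarith)
  have h7 : θ * Y ≤ θ * (1 / 4 - c₂ * D) := mul_le_mul_of_nonneg_left (min_le_right _ _) hθ0.le
  have h8 : min (a / 4) (θ * c₂) * n ≤ a / 4 * n :=
    mul_le_mul_of_nonneg_right (min_le_left _ _) (by linarith)
  have h9 : min (a / 4) (θ * c₂) * D ≤ θ * c₂ * D :=
    mul_le_mul_of_nonneg_right (min_le_right _ _) hD0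
  have h10 : a ≤ a * n := le_mul_of_one_le_right ha0.le hn1
  have h11 : 1 / 2 * (a * n) ≤ (1 - θ) * (a * n) :=
    mul_le_mul_of_nonneg_right (by linarith) (by positivity)
  linarith

end Main

end RootedTail

end

theorem theorem3 {V : Type*} [Fintype V] (G : SimpleGraph V) (R : Finset V)
    (hR : G.IsIndepSet (R : Set V)) (heR : 0 < RootedTail.numRootEdges G R)
    (t : ℝ) (ht : 1 < t) :
    ∃ c : ℝ, 0 < c ∧ ∃ C : ℝ, 0 < C ∧
      ∀ n : ℕ, Fintype.card V ≤ n → ∀ p : unitInterval, 0 < (p : ℝ) →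
        -- (a)
        ((p : ℝ) ≤ (n : ℝ) ^ (-1 / RootedTail.maxDensity G R) →
          ((p : ℝ) ≤ RootedTail.pTwo G t →
            (p : ℝ) ^ C = Real.exp (-(C * Real.log (1 / (p : ℝ)))) ∧
            Real.exp (-(C * Real.log (1 / (p : ℝ)))) ≤ RootedTail.upperTail G R n p t) ∧
          RootedTail.upperTail G R n p t ≤ Real.exp (-c)) ∧
        -- (b)
        ((n : ℝ) ^ (-1 / RootedTail.maxDensity G R) ≤ (p : ℝ) →
          (p : ℝ) ≤ RootedTail.pOne G R t →
            (p : ℝ) ^ (C * RootedTail.bigM G R n p) =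
              Real.exp (-(C * RootedTail.bigM G R n p * Real.log (1 / (p : ℝ)))) ∧
            Real.exp (-(C * RootedTail.bigM G R n p * Real.log (1 / (p : ℝ)))) ≤
              RootedTail.upperTail G R n p t ∧
            RootedTail.upperTail G R n p t ≤ Real.exp (-(c * RootedTail.bigM G R n p))) ∧
        -- (c)
        (RootedTail.pOne G R t ≤ (p : ℝ) → (p : ℝ) ≤ RootedTail.pTwo G t →
          Real.exp (-(C * ((n : ℝ) + ((p : ℝ) - RootedTail.pOne G R t) ^ 2 * (n : ℝ) ^ 2))) ≤
            RootedTail.upperTail G R n p t ∧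
          RootedTail.upperTail G R n p t ≤
            Real.exp (-(c * ((n : ℝ) + ((p : ℝ) - RootedTail.pOne G R t) ^ 2 * (n : ℝ) ^ 2)))) ∧
        -- (d)
        (RootedTail.pTwo G t < (p : ℝ) → RootedTail.upperTail G R n p t = 0) := by
  have he : 0 < RootedTail.numEdges G := heR.trans_le RootedTail.numRootEdges_le_numEdges
  have hV : 0 < Fintype.card V := by
    obtain ⟨s, -, v, -, -⟩ := Set.nonempty_of_ncard_ne_zero heR.ne'
    exact Fintype.card_pos_iff.2 ⟨v⟩
  obtain ⟨c₁, hc₁, hb₁⟩ := RootedTail.exists_upperTail_le_exp_bigM hR he hV ht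
  obtain ⟨c₂, hc₂, hcu⟩ := RootedTail.exists_upperTail_le_exp_dense hR hV heR ht
  obtain ⟨C₁, hC₁, ha⟩ := RootedTail.exists_rpow_le_upperTail_sparse hR hV he ht
  obtain ⟨C₂, hC₂, hb⟩ := RootedTail.exists_rpow_bigM_le_upperTail hR hV heR ht
  obtain ⟨C₃, hC₃, hcl⟩ := RootedTail.exists_exp_le_upperTail hV heR ht
    (RootedTail.pOne_pos (G := G) (R := R) ht)
  have hlog : 0 < Real.log t := Real.log_pos ht
  refine ⟨min (Real.log t) (min c₁ c₂), by positivity, max C₁ (max C₂ C₃),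
    lt_max_of_lt_left hC₁, fun n hn p hp => ⟨fun hpm => ⟨fun hp2 => ⟨?_, ?_⟩, ?_⟩,
      fun hpm hp1 => ⟨?_, ?_, ?_⟩, fun hp1 hp2 => ⟨?_, ?_⟩, ?_⟩⟩
  · exact RootedTail.rpow_eq_exp_neg_mul_log hp _
  · rw [← RootedTail.rpow_eq_exp_neg_mul_log hp]
    exact (Real.rpow_le_rpow_of_exponent_ge hp p.2.2 (le_max_left _ _)).trans
      (ha n hn p hp hpm hp2)
  · exact (RootedTail.upperTail_le_inv hV hn ht hp).trans
      (Real.exp_le_exp.2 (neg_le_neg (min_le_left _ _)))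
  · exact RootedTail.rpow_eq_exp_neg_mul_log hp _
  · rw [← RootedTail.rpow_eq_exp_neg_mul_log hp]
    refine le_trans (Real.rpow_le_rpow_of_exponent_ge hp p.2.2 ?_) (hb n hn p hp hpm hp1)
    exact mul_le_mul_of_nonneg_right ((le_max_left _ _).trans (le_max_right _ _))
      (RootedTail.bigM_nonneg n hp.le)
  · refine (hb₁ n hn p hp).trans (Real.exp_le_exp.2 (neg_le_neg ?_))
    exact mul_le_mul_of_nonneg_right ((min_le_right _ _).trans (min_le_left _ _))
      (RootedTail.bigM_nonneg n hp.le)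
  · refine le_trans (Real.exp_le_exp.2 (neg_le_neg ?_)) (hcl n hn p hp1 hp2)
    rw [max_eq_left (sub_nonneg.2 hp1)]
    exact mul_le_mul_of_nonneg_right ((le_max_right _ _).trans (le_max_right _ _)) (by positivity)
  · refine (hcu n hn p hp1).trans (Real.exp_le_exp.2 (neg_le_neg ?_))
    exact mul_le_mul_of_nonneg_right ((min_le_right _ _).trans (min_le_right _ _)) (by positivity)
  · exact RootedTail.upperTail_eq_zero hV hn ht he
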